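/- Let $p,q\ge 2$. Let $\mathrm U(p,q)\subset \mathrm{GL}(p+q,\mathbb C)$ be the group of linear isometries of the Hermitian form $((z,w),(z',w'))_{p,q}=\sum_{j=1}^p z_j\overline{z_j'}-\sum_{j=1}^q w_j\overline{w_j'}$ on $\mathbb C^{p+q}=\mathbb C^p\oplus\mathbb C^q$, and let $X^0=\{\eta\in\mathbb C^{p+q}\setminus\{0\} : (\eta,\eta)_{p,q}=0\}$ be its light cone. For $\alpha,\beta\in\mathbb C$ with $\alpha-\beta\in\mathbb Z$ let $\psi^{\alpha,\beta}(t)=t^{\alpha}\bar t^{\beta}=|t|^{\alpha+\beta}(t/|t|)^{\alpha-\beta}$ for $t\in\mathbb C^\times$, and let $$S^{\alpha,\beta}(X^0)=\{f\in C^\infty(X^0) : f(t\eta)=\psi^{\alpha,\beta}(t)f(\eta)\ \text{ for all } t\in\mathbb C^\times,\ \eta\in X^0\},$$ with the $C^\infty$ topology (uniform convergence of all derivatives on compact sets) and the action $(\rho(g)f)(\eta)=f(g^{-1}\eta)$ of $\mathrm U(p,q)$. Call $S^{\alpha,\beta}(X^0)$ reducible if it has a closed $\mathrm U(p,q)$-invariant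 subspace other than $0$ and the whole space. Then $S^{\alpha,\beta}(X^0)$ is reducible if and only if $\alpha$ and $\beta$ are both integers; equivalently, if and only if $\alpha+\beta\in\mathbb Z$ and $\alpha+\beta\equiv\alpha-\beta \pmod 2$. -/

import Mathlib

open scoped Topology ContDiff UniformConvergence ComplexConjugate

noncomputable section

namespace LightCone

/-- The complex vector space `ℂ^{p+q} = ℂ^p ⊕ ℂ^q`, with elements `(z, w)`. -/
abbrev V (p q : ℕ) : Type := (Fin p → ℂ) × (Fin q → ℂ)

/-- The Hermitian form of signature `(p, q)`:
`((z,w),(z',w')) = ∑ z_j conj z'_j - ∑ w_j conj w'_j`. -/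
def form {p q : ℕ} (v v' : V p q) : ℂ :=
  (∑ j, v.1 j * conj (v'.1 j)) - ∑ j, v.2 j * conj (v'.2 j)

lemma form_smul_smul {p q : ℕ} (t : ℂ) (v v' : V p q) :
    form (t • v) (t • v') = t * conj t * form v v' := by
  simp only [form, Prod.smul_fst, Prod.smul_snd, Pi.smul_apply, smul_eq_mul, map_mul, mul_sub,
    Finset.mul_sum]
  congr 1 <;> exact Finset.sum_congr rfl fun j _ => by ring

/-- The group `U(p,q)` of complex linear isometries of the form. -/
def U (p q : ℕ) : Subgroup (V p q ≃ₗ[ℂ] V p q) where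
  carrier := {g | ∀ v v', form (g v) (g v') = form v v'}
  mul_mem' := by
    intro a b ha hb v v'
    rw [LinearEquiv.mul_apply, LinearEquiv.mul_apply, ha, hb]
  one_mem' := fun _ _ => rfl
  inv_mem' := by
    intro a ha v v'
    have h := ha (a⁻¹ v) (a⁻¹ v')
    rw [← LinearEquiv.mul_apply, ← LinearEquiv.mul_apply, mul_inv_cancel] at h
    exact h.symm

/-- The light cone: the nonzero null vectors. -/
def X0 (p q : ℕ) : Set (V p q) := {v | v ≠ 0 ∧ form v v = 0}

/-- The action of `U(p,q)` on the light cone. -/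
def act {p q : ℕ} (g : U p q) (x : X0 p q) : X0 p q :=
  ⟨g.1 x.1, fun h => x.2.1 (g.1.map_eq_zero_iff.1 h), by rw [g.2, x.2.2]⟩

/-- The action of `ℂˣ` on the light cone by dilations. -/
def dilate {p q : ℕ} (t : ℂˣ) (x : X0 p q) : X0 p q :=
  ⟨(t : ℂ) • x.1, smul_ne_zero t.ne_zero x.2.1, by rw [form_smul_smul, x.2.2, mul_zero]⟩

/-- A function on the light cone is smooth (for its structure of embedded real submanifold of
`ℂ^{p+q}`) if near every point it is the restriction of a real-smooth function on an open subset
of the ambient space. -/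
def IsSmooth {p q : ℕ} (f : X0 p q → ℂ) : Prop :=
  ∀ x : X0 p q, ∃ (O : Set (V p q)) (F : V p q → ℂ), IsOpen O ∧ x.1 ∈ O ∧
    ContDiffOn ℝ ∞ F O ∧ ∀ y : X0 p q, y.1 ∈ O → f y = F y.1

/-- The character `ψ^{α,β}(t) = t^α (conj t)^β`, that is `|t|^(α+β) (t/|t|)^(α-β)`. For
`α - β ∈ ℤ`, the only case that is used, the last power is an ordinary integer power. -/
def psi (α β : ℂ) (t : ℂˣ) : ℂ :=
  (‖(t : ℂ)‖ : ℂ) ^ (α + β) * ((t : ℂ) / (‖(t : ℂ)‖ : ℂ)) ^ (α - β)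

/-- `S^{α,β}(X⁰)`: the smooth functions `f` on the light cone with `f (t x) = ψ^{α,β}(t) f x`
for all `t ∈ ℂˣ`. -/
def S (p q : ℕ) (α β : ℂ) : Submodule ℂ (X0 p q → ℂ) where
  carrier := {f | IsSmooth f ∧ ∀ (t : ℂˣ) (x : X0 p q), f (dilate t x) = psi α β t * f x}
  add_mem' := by
    rintro f g ⟨hf, hf'⟩ ⟨hg, hg'⟩
    refine ⟨fun x => ?_, fun t x => ?_⟩
    · obtain ⟨O, F, hO, hx, hF, hfF⟩ := hf x
      obtain ⟨O', G, hO', hx', hG, hgG⟩ := hg x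
      refine ⟨O ∩ O', F + G, hO.inter hO', ⟨hx, hx'⟩,
        (hF.mono Set.inter_subset_left).add (hG.mono Set.inter_subset_right), fun y hy => ?_⟩
      simp [hfF y hy.1, hgG y hy.2]
    · simp [hf' t x, hg' t x, mul_add]
  zero_mem' := ⟨fun _ => ⟨Set.univ, 0, isOpen_univ, trivial, contDiffOn_const, fun _ _ => rfl⟩,
    fun _ _ => by simp⟩
  smul_mem' := by
    rintro c f ⟨hf, hf'⟩
    refine ⟨fun x => ?_, fun t x => ?_⟩
    · obtain ⟨O, F, hO, hx, hF, hfF⟩ := hf x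
      refine ⟨O, fun v => c * F v, hO, hx, contDiffOn_const.mul hF, fun y hy => ?_⟩
      simp [hfF y hy]
    · simp only [Pi.smul_apply, smul_eq_mul, hf' t x]
      ring

lemma comp_act_mem {p q : ℕ} {α β : ℂ} (g : U p q) {f : X0 p q → ℂ} (hf : f ∈ S p q α β) :
    (fun x => f (act g x)) ∈ S p q α β := by
  refine ⟨fun x => ?_, fun t x => ?_⟩
  · obtain ⟨O, F, hO, hx, hF, hfF⟩ := hf.1 (act g x)
    let L : V p q →L[ℝ] V p q := (g.1.toLinearMap.restrictScalars ℝ).toContinuousLinearMap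
    exact ⟨L ⁻¹' O, F ∘ L, hO.preimage L.continuous, hx,
      hF.comp L.contDiff.contDiffOn (fun _ h => h), fun y hy => hfF (act g y) hy⟩
  · have h : act g (dilate t x) = dilate t (act g x) :=
      Subtype.ext (g.1.map_smul (t : ℂ) x.1)
    simp only [h]
    exact hf.2 t (act g x)

/-- The representation `ρ` of `U(p,q)` on `S^{α,β}(X⁰)`: `(ρ(g) f)(x) = f (g⁻¹ x)`. -/
def rho (p q : ℕ) (α β : ℂ) : Representation ℂ (U p q) (S p q α β) where
  toFun g :=
    { toFun := fun f => ⟨fun x => f.1 (act g⁻¹ x), comp_act_mem g⁻¹ f.2⟩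
      map_add' := fun _ _ => rfl
      map_smul' := fun _ _ => rfl }
  map_one' := by
    ext f x
    simp [act]
  map_mul' g h := by
    ext f x
    simp [act, mul_inv_rev]

/-- A smooth map from `ℝ^d` to the light cone. -/
structure SmoothParam (p q d : ℕ) where
  toFun : EuclideanSpace ℝ (Fin d) → X0 p q
  contDiff : ContDiff ℝ ∞ (fun u => (toFun u).1)

/-- The `C^∞` topology on `S^{α,β}(X⁰)`: uniform convergence of all derivatives on compact sets.
It is the coarsest topology such that for every smooth map `φ : ℝ^d → X⁰` (in particular for every
local parametrization of the manifold `X⁰`) and every order `k`, the map `f ↦ D^k (f ∘ φ)` is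
continuous for uniform convergence on compact subsets of `ℝ^d`. -/
@[reducible] def smoothTopology (p q : ℕ) (α β : ℂ) : TopologicalSpace (S p q α β) :=
  ⨅ (d : ℕ) (φ : SmoothParam p q d) (k : ℕ),
    TopologicalSpace.induced
      (fun f => UniformOnFun.ofFun {K : Set (EuclideanSpace ℝ (Fin d)) | IsCompact K}
        (iteratedFDeriv ℝ k (fun u => f.1 (φ.toFun u))))
      inferInstance

/-- A representation on a topological vector space is reducible if there is a closed invariant
subspace other than zero and the whole space. -/
def TopReducible {G M : Type*} [Group G] [AddCommGroup M] [Module ℂ M]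
    (τ : TopologicalSpace M) (ρ : Representation ℂ G M) : Prop :=
  ∃ W : Submodule ℂ M, IsClosed[τ] (W : Set M) ∧ (∀ g : G, ∀ f ∈ W, ρ g f ∈ W) ∧ W ≠ ⊥ ∧ W ≠ ⊤

/-- Reducibility of the `U(p,q)`-module `S^{α,β}(X⁰)`. -/
def IsReducible (p q : ℕ) (α β : ℂ) : Prop :=
  TopReducible (smoothTopology p q α β) (rho p q α β)

end LightCone

end

/-! Write points of the cone as (z, w) with |z| = |w|. A homogeneous function is determined by its
restriction to the product of the unit spheres, which is an orbit of U(p) × U(q) (`orbX`). If the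
exponents of two functions add up to -(p+q-1) in each slot, the integral of their product over this
orbit is invariant under U(p,q) (`integral_lieFun_mul`, `integral_refl`). Both directions are
arguments about annihilators for this pairing.

Nonintegral parameters give irreducibility. By conjugation (`IsReducible.conj`) let n = α - β ≥ 0. A
closed invariant subspace W is stable under Lie derivatives (`lieStable_of_invariant`). The Lie
algebra leads from the highest weight vector z_0^n |z|^(2β) to every function P |z|^(2s) with P a
bihomogeneous polynomial of the right type. Each step divides by α plus an integer, which is where
nonintegrality enters (`inL_of_inL_pow`). Such functions are dense (`eq_top_of_inL`), so W is
everything once it contains the highest weight vector. If some element of W has a nonzero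
coefficient on that vector, averaging over U(p) × U(q) puts the vector in W
(`inL_pow_of_integral_ne`). Otherwise the annihilator of the conjugates of W, in the space with
exponents -(p+q-1) - conj β and -(p+q-1) - conj α, contains its own highest weight vector. That
annihilator is then the whole space, and W = 0.

Integral parameters give reducibility. Let d be the dual bidegree, -(p+q-1) minus (α, β). The
products κψ of bidegree d, with κ in the Weyl algebra module generated by |z|^(-2(p-1)) in the z
variables and ψ a polynomial in w, form a space stable under the Lie algebra (`test`,
`rE_mem_test`). Its annihilator in S^{α,β} is closed. It is invariant under the group because
everything is analytic along one-parameter groups of reflections, and these generate U(p,q)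
(`integral_refl_eq_zero`, `mem_of_refl_mem`). It is not the whole space because the test space is
nonzero (`exists_test_ne_zero`). It is nonzero because it contains w_0^m conj(w_1)^n for large n
(`intK_test_eq_zero`): unequal bidegrees of κ are excluded by a phase rotation, bidegrees at most -p
by the vanishing of residues of derivatives, and the rest by the weight in w_1. -/

open scoped Topology ContDiff UniformConvergence ComplexConjugate

noncomputable section

namespace LightCone

open MeasureTheory Filter

/-! ### Averages of smooth families and their convergence with all derivatives. -/

section Families

variable {T E M F : Type} [NormedAddCommGroup E] [NormedSpace ℝ E]
  [NormedAddCommGroup M] [NormedSpace ℝ M] [NormedAddCommGroup F] [NormedSpace ℝ F]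

/-- A family of smooth functions whose derivatives depend continuously on the parameter. -/
structure SmoothFamily [TopologicalSpace T] (G : T → E → F) : Prop where
  smooth : ∀ t, ContDiff ℝ ∞ (G t)
  cont : ∀ k : ℕ, Continuous fun x : T × E => iteratedFDeriv ℝ k (G x.1) x.2

lemma contDiffAt_isometry_comp {A B : Type} [NormedAddCommGroup A] [NormedSpace ℝ A]
    [NormedAddCommGroup B] [NormedSpace ℝ B] (L : A ≃ₗᵢ[ℝ] B) {f : M → A} {x : M}
    (hf : ContDiffAt ℝ ∞ f x) : ContDiffAt ℝ ∞ (fun x => L (f x)) x :=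
  L.contDiff.contDiffAt.comp x hf

/-- The parameter space T is only topological, so smoothness in the parameter is expressed through a
map e into a normed space M. Differentiating along the E-factor alone keeps the result smooth
jointly on M × E, so induction applies, and continuity in the parameter follows by composing with e.
-/
lemma exists_ambient_iteratedFDeriv {e : T → M} {G : M × E → F}
    (hG : ∀ t u, ContDiffAt ℝ ∞ G (e t, u)) (k : ℕ) :
    ∃ H : M × E → (E [×k]→L[ℝ] F), (∀ t u, ContDiffAt ℝ ∞ H (e t, u)) ∧
      ∀ t u, iteratedFDeriv ℝ k (fun u => G (e t, u)) u = H (e t, u) := by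
  induction k with
  | zero =>
    refine ⟨fun x => (continuousMultilinearCurryFin0 ℝ E F).symm (G x), fun t u => ?_,
      fun t u => ?_⟩
    · exact (continuousMultilinearCurryFin0 ℝ E F).symm.contDiff.contDiffAt.comp _ (hG t u)
    · rw [iteratedFDeriv_zero_eq_comp]; rfl
  | succ k ih =>
    obtain ⟨H, hH, hHG⟩ := ih
    refine ⟨fun x => (continuousMultilinearCurryLeftEquiv ℝ (fun _ : Fin (k + 1) => E) F).symm
      ((fderiv ℝ H x).comp (ContinuousLinearMap.inr ℝ M E)), fun t u => ?_, fun t u => ?_⟩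
    · have h3 : ContDiffAt ℝ ∞
          (fun x => (fderiv ℝ H x).comp (ContinuousLinearMap.inr ℝ M E)) (e t, u) :=
        ((hH t u).fderiv_right (m := ∞) (by simp)).clm_comp contDiffAt_const
      exact contDiffAt_isometry_comp _ h3
    · have h1 : iteratedFDeriv ℝ k (fun u => G (e t, u)) = fun u => H (e t, u) :=
        funext (hHG t)
      rw [iteratedFDeriv_succ_eq_comp_left, Function.comp_apply, h1]
      congr 1
      have h2 : HasFDerivAt (fun u : E => (e t, u)) (ContinuousLinearMap.inr ℝ M E) u :=
        hasFDerivAt_prodMk_right (e t) u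
      exact ((((hH t u).differentiableAt (by simp)).hasFDerivAt).comp u h2).fderiv

lemma SmoothFamily.of_ambient [TopologicalSpace T] {e : T → M} (he : Continuous e)
    {G : M × E → F} (hG : ∀ t u, ContDiffAt ℝ ∞ G (e t, u)) :
    SmoothFamily fun t u => G (e t, u) where
  smooth t := contDiff_iff_contDiffAt.2 fun u =>
    (hG t u).comp u (contDiffAt_const.prodMk contDiffAt_id)
  cont k := by
    obtain ⟨H, hH, hHG⟩ := exists_ambient_iteratedFDeriv hG k
    simp only [hHG]
    refine continuous_iff_continuousAt.2 fun x => ?_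
    exact ContinuousAt.comp (f := fun x : T × E => (e x.1, x.2)) (hH x.1 x.2).continuousAt
      ((he.comp continuous_fst).prodMk continuous_snd).continuousAt

lemma SmoothFamily.continuous_fderiv [TopologicalSpace T] {G : T → E → F} (hG : SmoothFamily G) (k : ℕ) :
    Continuous fun x : T × E => fderiv ℝ (iteratedFDeriv ℝ k (G x.1)) x.2 := by
  have := (continuousMultilinearCurryLeftEquiv ℝ (fun _ : Fin (k + 1) => E) F).continuous.comp
    (hG.cont (k + 1))
  refine this.congr fun x => ?_
  rw [Function.comp_apply, iteratedFDeriv_succ_eq_comp_left, Function.comp_apply,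
    LinearIsometryEquiv.apply_symm_apply]

lemma SmoothFamily.continuous_apply [TopologicalSpace T] {G : T → E → F} (hG : SmoothFamily G) :
    Continuous fun x : T × E => G x.1 x.2 := by
  have := (continuousMultilinearCurryFin0 ℝ E F).continuous.comp (hG.cont 0)
  refine this.congr fun t => ?_
  simp [iteratedFDeriv_zero_eq_comp]

end Families

section Averages

set_option linter.unusedSectionVars false

variable {T E Ω : Type} [NormedAddCommGroup E] [NormedSpace ℝ E] [FiniteDimensional ℝ E]
  [MetricSpace T] [CompactSpace T] [MeasurableSpace T] [BorelSpace T] [MeasurableSpace Ω]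

lemma integrable_family {F : Type} [NormedAddCommGroup F] [NormedSpace ℝ F] [NormedSpace ℂ F]
    {ν : Measure Ω} [IsFiniteMeasure ν]
    {Φ : Ω → ℂ} (hΦ : StronglyMeasurable Φ) {B : ℝ} (hB : ∀ s, ‖Φ s‖ ≤ B)
    {σ : Ω → T} (hσ : Measurable σ) {g : T → F} (hg : Continuous g) :
    Integrable (fun s => Φ s • g (σ s)) ν := by
  obtain ⟨C, hC⟩ := isCompact_univ.exists_bound_of_continuousOn hg.continuousOn
  refine Integrable.of_bound (hΦ.smul (hg.stronglyMeasurable.comp_measurable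
    hσ)).aestronglyMeasurable (B * C) (Eventually.of_forall fun s => ?_)
  rw [norm_smul]
  exact mul_le_mul (hB s) (hC _ trivial) (norm_nonneg _) ((norm_nonneg _).trans (hB s))

lemma hasFDerivAt_average {F : Type} [NormedAddCommGroup F] [NormedSpace ℝ F] [NormedSpace ℂ F]
    [SMulCommClass ℝ ℂ F]
    {H : T → E → F} {H' : T → E → (E →L[ℝ] F)} (hH : ∀ v, Continuous fun t => H t v)
    (hH' : Continuous fun x : T × E => H' x.1 x.2) (hd : ∀ t v, HasFDerivAt (H t) (H' t v) v)
    {ν : Measure Ω} [IsFiniteMeasure ν]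
    {Φ : Ω → ℂ} (hΦ : StronglyMeasurable Φ) {B : ℝ} (hB : ∀ s, ‖Φ s‖ ≤ B)
    {σ : Ω → T} (hσ : Measurable σ) (u : E) :
    HasFDerivAt (fun u => ∫ s, Φ s • H (σ s) u ∂ν) (∫ s, Φ s • H' (σ s) u ∂ν) u := by
  have : ProperSpace E := FiniteDimensional.proper ℝ E
  -- Compactness of T gives one bound for the derivative near u, uniform in the sampling point; this
  -- is the dominating constant.
  obtain ⟨C, hC⟩ := (isCompact_univ.prod (isCompact_closedBall u 1)).exists_bound_of_continuousOn
    hH'.continuousOn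
  have hk' : ∀ v, Continuous fun t => H' t v := fun v =>
    hH'.comp (continuous_id.prodMk continuous_const)
  refine hasFDerivAt_integral_of_dominated_of_fderiv_le (bound := fun _ => B * C)
    (Metric.closedBall_mem_nhds u one_pos)
    (Eventually.of_forall fun v => (integrable_family hΦ hB hσ (hH v)).aestronglyMeasurable)
    (integrable_family hΦ hB hσ (hH u))
    (F' := fun v s => Φ s • H' (σ s) v)
    (integrable_family hΦ hB hσ (hk' u)).aestronglyMeasurable ?_ (integrable_const _) ?_
  · refine Eventually.of_forall fun s v hv => ?_
    rw [norm_smul]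
    exact mul_le_mul (hB s) (hC (σ s, v) ⟨trivial, hv⟩) (norm_nonneg _)
      ((norm_nonneg _).trans (hB s))
  · exact Eventually.of_forall fun s v hv => (hd (σ s) v).const_smul (Φ s)

/-- For the currying isometries relating successive iterated derivatives. They are typed as real
linear, so compatibility with complex weights is a separate hypothesis. -/
lemma average_map {A B : Type} [NormedAddCommGroup A] [NormedSpace ℝ A] [NormedSpace ℂ A]
    [CompleteSpace A] [NormedAddCommGroup B] [NormedSpace ℝ B] [NormedSpace ℂ B] [CompleteSpace B]
    (L : A ≃ₗᵢ[ℝ] B) (hL : ∀ (c : ℂ) a, L (c • a) = c • L a)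
    {ν : Measure Ω} [IsFiniteMeasure ν]
    {Φ : Ω → ℂ} (hΦ : StronglyMeasurable Φ) {C : ℝ} (hC : ∀ s, ‖Φ s‖ ≤ C)
    {σ : Ω → T} (hσ : Measurable σ) {g : T → A} (hg : Continuous g) :
    L (∫ s, Φ s • g (σ s) ∂ν) = ∫ s, Φ s • L (g (σ s)) ∂ν := by
  have := L.toContinuousLinearEquiv.toContinuousLinearMap.integral_comp_comm
    (integrable_family (ν := ν) hΦ hC hσ hg)
  refine Eq.trans this.symm (integral_congr_ae (Eventually.of_forall fun s => hL _ _))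

lemma iteratedFDeriv_average {G : T → E → ℂ} (hG : SmoothFamily G)
    {ν : Measure Ω} [IsFiniteMeasure ν]
    {Φ : Ω → ℂ} (hΦ : StronglyMeasurable Φ) {B : ℝ} (hB : ∀ s, ‖Φ s‖ ≤ B)
    {σ : Ω → T} (hσ : Measurable σ) (k : ℕ) :
    iteratedFDeriv ℝ k (fun u => ∫ s, Φ s • G (σ s) u ∂ν) =
      fun u => ∫ s, Φ s • iteratedFDeriv ℝ k (G (σ s)) u ∂ν := by
  induction k with
  | zero =>
    funext u
    rw [iteratedFDeriv_zero_eq_comp, Function.comp_apply]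
    simp only [iteratedFDeriv_zero_eq_comp, Function.comp_apply]
    have h0 : Continuous fun t => G t u :=
      hG.continuous_apply.comp (continuous_id.prodMk continuous_const)
    exact average_map (continuousMultilinearCurryFin0 ℝ E ℂ).symm (fun c a => rfl) hΦ hB hσ h0
  | succ k ih =>
    funext u
    have h1 := hasFDerivAt_average (ν := ν) (H := fun t => iteratedFDeriv ℝ k (G t))
      (fun v => (hG.cont k).comp (continuous_id.prodMk continuous_const))
      (hG.continuous_fderiv k)
      (fun t v => (((hG.smooth t).differentiable_iteratedFDeriv
        (by exact_mod_cast WithTop.coe_lt_top _)) v).hasFDerivAt) hΦ hB hσ u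
    rw [iteratedFDeriv_succ_eq_comp_left, Function.comp_apply, ih, h1.fderiv]
    have h2 : Continuous fun t => fderiv ℝ (iteratedFDeriv ℝ k (G t)) u :=
      (hG.continuous_fderiv k).comp (continuous_id.prodMk continuous_const)
    exact average_map (ν := ν) (A := E →L[ℝ] E [×k]→L[ℝ] ℂ) (B := E [×(k + 1)]→L[ℝ] ℂ)
      (continuousMultilinearCurryLeftEquiv ℝ (fun _ : Fin (k + 1) => E) ℂ).symm
      (fun c a => rfl) hΦ hB hσ h2

/-- H is uniformly continuous on T × C. Where the sampling points are δ-close the integrands differ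
by at most B η; elsewhere they differ by at most 2 B |A|, on a set whose measure tends to zero. -/
lemma eventually_average_lt {F : Type} [NormedAddCommGroup F] [NormedSpace ℝ F] [NormedSpace ℂ F]
    {H : T → E → F} (hH : Continuous fun x : T × E => H x.1 x.2) {C : Set E} (hC : IsCompact C)
    {ι : Type} {l : Filter ι} {ν : ι → Measure Ω} [∀ i, IsFiniteMeasure (ν i)]
    {b : ℝ} (hb : ∀ i, (ν i).real Set.univ ≤ b)
    {Φ : Ω → ℂ} (hΦ : StronglyMeasurable Φ) {B : ℝ} (hB : ∀ s, ‖Φ s‖ ≤ B)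
    {σ : ι → Ω → T} (hσ : ∀ i, Measurable (σ i)) {τ : Ω → T} (hτ : Measurable τ)
    (hconv : ∀ δ > 0, Tendsto (fun i => (ν i).real {s | δ ≤ dist (σ i s) (τ s)}) l (𝓝 0))
    {ε : ℝ} (hε : 0 < ε) :
    ∀ᶠ i in l, ∀ u ∈ C,
      ‖∫ s, Φ s • H (σ i s) u ∂ν i - ∫ s, Φ s • H (τ s) u ∂ν i‖ < ε := by
  rcases isEmpty_or_nonempty ι with hι | ⟨⟨i₀⟩⟩
  · exact Eventually.of_forall fun i => (hι.false i).elim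
  have hb0 : 0 ≤ b := measureReal_nonneg.trans (hb i₀)
  rcases isEmpty_or_nonempty Ω with hΩ | ⟨⟨s₀⟩⟩
  · refine Eventually.of_forall fun i u _ => ?_
    simp [Measure.eq_zero_of_isEmpty, hε]
  have hB0 : 0 ≤ B := (norm_nonneg _).trans (hB s₀)
  obtain ⟨A, hA⟩ := (isCompact_univ.prod hC).exists_bound_of_continuousOn hH.continuousOn
  have hunif := (isCompact_univ.prod hC).uniformContinuousOn_of_continuous hH.continuousOn
  -- Chosen so that total mass b times B η is at most ε / 2; the added 1 keeps the denominator
  -- positive.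
  set η := ε / (2 * (B * b + 1)) with hη
  have hη0 : 0 < η := by positivity
  obtain ⟨δ, hδ, hδH⟩ := Metric.uniformContinuousOn_iff.1 hunif η hη0
  have hsmall : ∀ᶠ i in l, B * (2 * |A|) * (ν i).real {s | δ ≤ dist (σ i s) (τ s)} < ε / 2 := by
    have := (hconv δ hδ).const_mul (B * (2 * |A|))
    rw [mul_zero] at this
    exact this.eventually_lt_const (half_pos hε)
  filter_upwards [hsmall] with i hi u hu
  have hcu : Continuous fun t => H t u := hH.comp (continuous_id.prodMk continuous_const)
  rw [← integral_sub (integrable_family hΦ hB (hσ i) hcu) (integrable_family hΦ hB hτ hcu)]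
  have hset : MeasurableSet {s | δ ≤ dist (σ i s) (τ s)} :=
    measurableSet_le measurable_const ((hσ i).dist hτ)
  have hle : ∀ s, ‖Φ s • H (σ i s) u - Φ s • H (τ s) u‖ ≤
      B * η + {s | δ ≤ dist (σ i s) (τ s)}.indicator (fun _ => B * (2 * |A|)) s := by
    intro s
    rw [← smul_sub, norm_smul]
    by_cases h : δ ≤ dist (σ i s) (τ s)
    · have h1 : ‖H (σ i s) u - H (τ s) u‖ ≤ 2 * |A| := by
        have h2 := (hA (σ i s, u) ⟨trivial, hu⟩).trans (le_abs_self A)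
        have h3 := (hA (τ s, u) ⟨trivial, hu⟩).trans (le_abs_self A)
        exact (norm_sub_le _ _).trans (by linarith)
      rw [Set.indicator_of_mem (by exact h)]
      have := mul_le_mul (hB s) h1 (norm_nonneg _) hB0
      nlinarith [mul_nonneg hB0 hη0.le]
    · rw [Set.indicator_of_notMem (by exact h), add_zero]
      refine mul_le_mul (hB s) ?_ (norm_nonneg _) hB0
      have := hδH (σ i s, u) ⟨trivial, hu⟩ (τ s, u) ⟨trivial, hu⟩
        (by rw [dist_prod_same_right]; exact not_le.1 h)
      rw [dist_eq_norm] at this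
      exact this.le
  have hint : Integrable (fun s => B * η +
      {s | δ ≤ dist (σ i s) (τ s)}.indicator (fun _ => B * (2 * |A|)) s) (ν i) :=
    (integrable_const _).add ((integrable_const _).indicator hset)
  refine (norm_integral_le_of_norm_le hint (Eventually.of_forall hle)).trans_lt ?_
  rw [integral_add (integrable_const _) ((integrable_const _).indicator hset), integral_const,
    integral_indicator_const _ hset, smul_eq_mul, smul_eq_mul]
  have h4 : (ν i).real Set.univ * (B * η) ≤ ε / 2 := by
    have h5 : (ν i).real Set.univ * (B * η) ≤ b * (B * η) :=
      mul_le_mul_of_nonneg_right (hb i) (by positivity)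
    have h6 : b * (B * η) ≤ ε / 2 := by
      have h7 : (B * b + 1) * η = ε / 2 := by rw [hη]; field_simp
      nlinarith
    linarith
  linarith

/-- Averages of a smooth family converge with all derivatives, uniformly on compact sets, when
the sampling points converge in measure. -/
lemma tendstoUniformlyOn_average {G : T → E → ℂ} (hG : SmoothFamily G)
    {ι : Type} {l : Filter ι} {ν : ι → Measure Ω} [∀ i, IsFiniteMeasure (ν i)]
    {b : ℝ} (hb : ∀ i, (ν i).real Set.univ ≤ b)
    {Φ : Ω → ℂ} (hΦ : StronglyMeasurable Φ) {B : ℝ} (hB : ∀ s, ‖Φ s‖ ≤ B)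
    {σ : ι → Ω → T} (hσ : ∀ i, Measurable (σ i)) {τ : Ω → T} (hτ : Measurable τ)
    (hconv : ∀ δ > 0, Tendsto (fun i => (ν i).real {s | δ ≤ dist (σ i s) (τ s)}) l (𝓝 0))
    {g : E → ℂ} (hg : ∀ i u, ∫ s, Φ s • G (τ s) u ∂ν i = g u) (k : ℕ)
    {C : Set E} (hC : IsCompact C) :
    TendstoUniformlyOn (fun i => iteratedFDeriv ℝ k (fun u => ∫ s, Φ s • G (σ i s) u ∂ν i))
      (iteratedFDeriv ℝ k g) l C := by
  rw [Metric.tendstoUniformlyOn_iff]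
  intro ε hε
  filter_upwards [eventually_average_lt (F := E [×k]→L[ℝ] ℂ)
    (H := fun t => iteratedFDeriv ℝ k (G t)) (hG.cont k) hC hb hΦ hB hσ hτ hconv hε] with i hi u hu
  have h1 : g = fun u => ∫ s, Φ s • G (τ s) u ∂ν i := funext fun u => (hg i u).symm
  rw [dist_comm, dist_eq_norm, h1, iteratedFDeriv_average hG hΦ hB (hσ i),
    iteratedFDeriv_average hG hΦ hB hτ]
  exact hi u hu

end Averages

end LightCone

end

/-! ### The cone: extension of homogeneous functions, reflections, Lie derivatives. -/

open scoped Topology ContDiff UniformConvergence ComplexConjugate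

noncomputable section

namespace LightCone

open MeasureTheory Filter

variable {p q : ℕ}

/-! ### The squared norms of the two components -/

/-- The squared Euclidean norm of the first component. -/
def rz (v : V p q) : ℝ := ∑ i, Complex.normSq (v.1 i)

/-- The squared Euclidean norm of the second component. -/
def rw' (v : V p q) : ℝ := ∑ j, Complex.normSq (v.2 j)

lemma rz_nonneg (v : V p q) : 0 ≤ rz v := Finset.sum_nonneg fun _ _ => Complex.normSq_nonneg _

lemma rw'_nonneg (v : V p q) : 0 ≤ rw' v := Finset.sum_nonneg fun _ _ => Complex.normSq_nonneg _

lemma rz_eq_zero {v : V p q} : rz v = 0 ↔ v.1 = 0 := by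
  rw [rz, Finset.sum_eq_zero_iff_of_nonneg fun _ _ => Complex.normSq_nonneg _]
  simp [funext_iff]

lemma rw'_eq_zero {v : V p q} : rw' v = 0 ↔ v.2 = 0 := by
  rw [rw', Finset.sum_eq_zero_iff_of_nonneg fun _ _ => Complex.normSq_nonneg _]
  simp [funext_iff]

lemma form_self (v : V p q) : form v v = ((rz v - rw' v : ℝ) : ℂ) := by
  simp [form, rz, rw', Complex.mul_conj]

lemma rz_eq_rw' (x : X0 p q) : rz x.1 = rw' x.1 := by
  have h := x.2.2
  rw [form_self] at h
  exact sub_eq_zero.1 (by exact_mod_cast h)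

lemma rz_pos (x : X0 p q) : 0 < rz x.1 := by
  refine (rz_nonneg _).lt_of_ne' fun h => x.2.1 ?_
  exact Prod.ext (rz_eq_zero.1 h) (rw'_eq_zero.1 ((rz_eq_rw' x).symm.trans h))

lemma mem_X0 {v : V p q} (h : 0 < rz v) (h' : rz v = rw' v) : v ∈ X0 p q := by
  refine ⟨fun h0 => ?_, ?_⟩
  · rw [h0, rz] at h
    simp at h
  · rw [form_self, h', sub_self, Complex.ofReal_zero]

lemma contDiff_rz : ContDiff ℝ ∞ (rz : V p q → ℝ) := by
  have : (rz : V p q → ℝ) = fun v => ∑ i, (Complex.reCLM (v.1 i) * Complex.reCLM (v.1 i) +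
      Complex.imCLM (v.1 i) * Complex.imCLM (v.1 i)) := by
    funext v
    exact Finset.sum_congr rfl fun i _ => Complex.normSq_apply _
  rw [this]
  fun_prop

lemma contDiff_rw' : ContDiff ℝ ∞ (rw' : V p q → ℝ) := by
  have : (rw' : V p q → ℝ) = fun v => ∑ i, (Complex.reCLM (v.2 i) * Complex.reCLM (v.2 i) +
      Complex.imCLM (v.2 i) * Complex.imCLM (v.2 i)) := by
    funext v
    exact Finset.sum_congr rfl fun i _ => Complex.normSq_apply _
  rw [this]
  fun_prop

/-- The open set of vectors with both components nonzero. -/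
def Opn (p q : ℕ) : Set (V p q) := {v | 0 < rz v ∧ 0 < rw' v}

lemma isOpen_Opn : IsOpen (Opn p q) :=
  (isOpen_lt continuous_const contDiff_rz.continuous).inter
    (isOpen_lt continuous_const contDiff_rw'.continuous)

lemma mem_Opn (x : X0 p q) : x.1 ∈ Opn p q := ⟨rz_pos x, rz_eq_rw' x ▸ rz_pos x⟩

/-- Complex powers of the squared norm of the first component. -/
def pw (s : ℂ) (v : V p q) : ℂ := Complex.exp (s * (Real.log (rz v) : ℂ))

lemma pw_add (s t : ℂ) (v : V p q) : pw (s + t) v = pw s v * pw t v := by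
  rw [pw, add_mul, Complex.exp_add]; rfl

lemma pw_one {v : V p q} (h : 0 < rz v) : pw 1 v = (rz v : ℂ) := by
  rw [pw, one_mul, ← Complex.ofReal_exp, Real.exp_log h]

lemma pw_of_rz_eq_one (s : ℂ) {v : V p q} (h : rz v = 1) : pw s v = 1 := by simp [pw, h]

lemma contDiffAt_pw (s : ℂ) {v : V p q} (h : 0 < rz v) : ContDiffAt ℝ ∞ (pw s) v := by
  have h1 : ContDiffAt ℝ ∞ (fun v : V p q => Real.log (rz v)) v :=
    (contDiff_rz.contDiffAt).log h.ne'
  exact (contDiffAt_const.mul (Complex.ofRealCLM.contDiff.contDiffAt.comp v h1)).cexp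

/-! ### Projection to the product of the unit spheres and extension of functions -/

/-- Normalization of both components. -/
def proj (v : V p q) : V p q := ((√(rz v))⁻¹ • v.1, (√(rw' v))⁻¹ • v.2)

lemma rz_smul_fst (c : ℝ) (v : V p q) (w : Fin q → ℂ) : rz (c • v.1, w) = c ^ 2 * rz v := by
  simp only [rz, Finset.mul_sum]
  exact Finset.sum_congr rfl fun i _ => by
    rw [Pi.smul_apply, Complex.real_smul, map_mul, Complex.normSq_ofReal, sq]

lemma rw'_smul_snd (c : ℝ) (v : V p q) (z : Fin p → ℂ) : rw' (z, c • v.2) = c ^ 2 * rw' v := by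
  simp only [rw', Finset.mul_sum]
  exact Finset.sum_congr rfl fun i _ => by
    rw [Pi.smul_apply, Complex.real_smul, map_mul, Complex.normSq_ofReal, sq]

lemma rz_proj {v : V p q} (h : v ∈ Opn p q) : rz (proj v) = 1 := by
  rw [proj, rz_smul_fst, inv_pow, Real.sq_sqrt h.1.le, inv_mul_cancel₀ h.1.ne']

lemma rw'_proj {v : V p q} (h : v ∈ Opn p q) : rw' (proj v) = 1 := by
  rw [proj, rw'_smul_snd, inv_pow, Real.sq_sqrt h.2.le, inv_mul_cancel₀ h.2.ne']

lemma proj_mem {v : V p q} (h : v ∈ Opn p q) : proj v ∈ X0 p q :=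
  mem_X0 (by rw [rz_proj h]; exact one_pos) (by rw [rz_proj h, rw'_proj h])

lemma contDiffAt_proj {v : V p q} (h : v ∈ Opn p q) : ContDiffAt ℝ ∞ proj v := by
  have h1 : ContDiffAt ℝ ∞ (fun v : V p q => (√(rz v))⁻¹) v :=
    (contDiff_rz.contDiffAt.sqrt h.1.ne').inv (Real.sqrt_pos.2 h.1).ne'
  have h2 : ContDiffAt ℝ ∞ (fun v : V p q => (√(rw' v))⁻¹) v :=
    (contDiff_rw'.contDiffAt.sqrt h.2.ne').inv (Real.sqrt_pos.2 h.2).ne'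
  exact (h1.smul contDiffAt_fst).prodMk (h2.smul contDiffAt_snd)

lemma proj_eq_self {v : V p q} (h : rz v = 1) (h' : rw' v = 1) : proj v = v := by
  simp [proj, h, h']

open Classical in
/-- Extension by zero of a function on the cone. -/
def zext (f : X0 p q → ℂ) (v : V p q) : ℂ := if h : v ∈ X0 p q then f ⟨v, h⟩ else 0

lemma zext_coe (f : X0 p q → ℂ) (x : X0 p q) : zext f x.1 = f x := dif_pos x.2

/-- Extension by zero is not even continuous, but `proj` maps the open set into the cone, where it
may be replaced locally by an ambient smooth representative of f. -/
lemma contDiffAt_zext_proj {f : X0 p q → ℂ} (hf : IsSmooth f) {v : V p q} (h : v ∈ Opn p q) :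
    ContDiffAt ℝ ∞ (fun v => zext f (proj v)) v := by
  obtain ⟨O, F, hO, hx, hF, hfF⟩ := hf ⟨proj v, proj_mem h⟩
  have h1 : ContDiffAt ℝ ∞ (fun v => F (proj v)) v :=
    ContDiffAt.comp v (hF.contDiffAt (hO.mem_nhds hx)) (contDiffAt_proj h)
  refine h1.congr_of_eventuallyEq ?_
  filter_upwards [isOpen_Opn.mem_nhds h,
    (contDiffAt_proj h).continuousAt.preimage_mem_nhds (hO.mem_nhds hx)] with w hw hw'
  rw [← hfF ⟨proj w, proj_mem hw⟩ hw', ← zext_coe f]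

/-- The extension of a homogeneous function on the cone to the vectors with nonzero
components. -/
def ext (α β : ℂ) (f : X0 p q → ℂ) (v : V p q) : ℂ := pw ((α + β) / 2) v * zext f (proj v)

lemma contDiffAt_ext {α β : ℂ} {f : X0 p q → ℂ} (hf : IsSmooth f) {v : V p q}
    (h : v ∈ Opn p q) : ContDiffAt ℝ ∞ (ext α β f) v :=
  (contDiffAt_pw _ h.1).mul (contDiffAt_zext_proj hf h)

lemma psi_ofReal (α β : ℂ) {r : ℝ} (hr : 0 < r) (t : ℂˣ) (ht : (t : ℂ) = r) :
    psi α β t = Complex.exp ((α + β) * (Real.log r : ℂ)) := by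
  have hr' : (r : ℂ) ≠ 0 := by exact_mod_cast hr.ne'
  rw [psi, ht, Complex.norm_real, Real.norm_of_nonneg hr.le, div_self hr', Complex.one_cpow,
    mul_one, Complex.cpow_def_of_ne_zero hr', Complex.ofReal_log hr.le, mul_comm]

/-- On the cone both components have the same norm r, so x is the single real dilation by r of its
projection, and ψ(r) = r^(α+β) is the power of |z|² used in `ext`. -/
lemma ext_coe {α β : ℂ} {f : X0 p q → ℂ} (hf : f ∈ S p q α β) (x : X0 p q) :
    ext α β f x.1 = f x := by
  have hr := Real.sqrt_pos.2 (rz_pos x)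
  set r := √(rz x.1) with hrdef
  have hr' : (r : ℂ) ≠ 0 := by exact_mod_cast hr.ne'
  have h1 : dilate (Units.mk0 (r : ℂ) hr') ⟨proj x.1, proj_mem (mem_Opn x)⟩ = x := by
    refine Subtype.ext ?_
    change (r : ℂ) • proj x.1 = x.1
    rw [proj, ← rz_eq_rw' x, ← hrdef]
    refine Prod.ext ?_ ?_ <;> · ext i; simp [hr']
  have h2 := hf.2 (Units.mk0 (r : ℂ) hr') ⟨proj x.1, proj_mem (mem_Opn x)⟩
  rw [h1, psi_ofReal α β hr _ rfl] at h2
  rw [ext, h2, ← zext_coe f]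
  congr 1
  rw [pw, hrdef, Real.log_sqrt (rz_nonneg _)]
  push_cast
  ring_nf

/-! ### Reflections -/

lemma form_add_left (v v' w : V p q) : form (v + v') w = form v w + form v' w := by
  simp only [form, Prod.fst_add, Prod.snd_add, Pi.add_apply, add_mul, Finset.sum_add_distrib]
  ring

lemma form_smul_left (c : ℂ) (v w : V p q) : form (c • v) w = c * form v w := by
  simp only [form, Prod.smul_fst, Prod.smul_snd, Pi.smul_apply, smul_eq_mul, mul_sub,
    Finset.mul_sum, mul_assoc]

lemma form_conj (v w : V p q) : conj (form v w) = form w v := by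
  simp only [form, map_sub, map_sum, map_mul, Complex.conj_conj]
  congr 1 <;> exact Finset.sum_congr rfl fun i _ => mul_comm _ _

lemma form_add_right (v w w' : V p q) : form v (w + w') = form v w + form v w' := by
  rw [← form_conj, form_add_left, map_add, form_conj, form_conj]

lemma form_smul_right (c : ℂ) (v w : V p q) : form v (c • w) = conj c * form v w := by
  rw [← form_conj, form_smul_left, map_mul, form_conj]

/-- The form as a linear functional of its first argument. -/
def formL (x : V p q) : V p q →ₗ[ℂ] ℂ where
  toFun v := form v x
  map_add' v v' := form_add_left v v' x
  map_smul' c v := form_smul_left c v x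

/-- The linear map `v ↦ v + c (v, x) x`. -/
def transv (x : V p q) (c : ℂ) : V p q →ₗ[ℂ] V p q :=
  LinearMap.id + (c • formL x).smulRight x

lemma transv_apply (x : V p q) (c : ℂ) (v : V p q) : transv x c v = v + (c * form v x) • x := rfl

/-- Maps of this shape compose by the law c + d + c d (x,x); invertibility of reflections reduces to
making this scalar vanish. -/
lemma transv_transv (x : V p q) (c d : ℂ) (v : V p q) :
    transv x c (transv x d v) = transv x (c + d + c * d * form x x) v := by
  simp only [transv_apply, form_add_left, form_smul_left]
  rw [add_assoc, ← add_smul]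
  congr 2
  ring

/-- The unitary reflection with mirror orthogonal to the nonisotropic vector `x` and with
eigenvalue `u` on `x`. -/
def unitaryRefl (x : V p q) (hx : form x x ≠ 0) (u : ℂ) (hu : u * conj u = 1) : U p q :=
  ⟨LinearEquiv.ofLinearMap (transv x ((u - 1) / form x x)) (transv x ((conj u - 1) / form x x))
    (by
      ext1 <;> · refine LinearMap.ext fun v => ?_
                 rw [LinearMap.comp_apply, LinearMap.comp_apply, transv_transv, transv_apply]
                 have : (u - 1) / form x x + (conj u - 1) / form x x +
                    (u - 1) / form x x * ((conj u - 1) / form x x) * form x x = 0 := by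
                   field_simp
                   linear_combination hu
                 rw [this, zero_mul, zero_smul, add_zero]
                 rfl)
    (by
      ext1 <;> · refine LinearMap.ext fun v => ?_
                 rw [LinearMap.comp_apply, LinearMap.comp_apply, transv_transv, transv_apply]
                 have : (conj u - 1) / form x x + (u - 1) / form x x +
                    (conj u - 1) / form x x * ((u - 1) / form x x) * form x x = 0 := by
                   field_simp
                   linear_combination hu
                 rw [this, zero_mul, zero_smul, add_zero]
                 rfl), by
    intro v v'
    have hk : conj (form x x) = form x x := form_conj x x
    simp only [LinearEquiv.coe_ofLinearMap, transv_apply, form_add_left, form_add_right,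
      form_smul_left, form_smul_right, map_mul, map_div₀, map_sub, map_one, hk]
    rw [← form_conj v' x]
    field_simp
    linear_combination (conj (form v' x) * form v x) * hu⟩

lemma exp_mul_conj (t : ℝ) (x : V p q) : Complex.exp (Complex.I * t * form x x) *
    conj (Complex.exp (Complex.I * t * form x x)) = 1 := by
  rw [← Complex.exp_conj, map_mul, map_mul, form_conj, Complex.conj_I, Complex.conj_ofReal,
    ← Complex.exp_add]
  ring_nf
  exact Complex.exp_zero

/-- The one-parameter group of reflections generated by `v ↦ i (v, x) x`. -/
def refl (x : V p q) (hx : form x x ≠ 0) (t : ℝ) : U p q :=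
  unitaryRefl x hx (Complex.exp (Complex.I * t * form x x)) (exp_mul_conj t x)

/-- The vector field generating `refl`. -/
def vf (x v : V p q) : V p q := (Complex.I * form v x) • x

lemma refl_apply (x : V p q) (hx : form x x ≠ 0) (t : ℝ) (v : V p q) : (refl x hx t).1 v =
    v + ((Complex.exp (Complex.I * t * form x x) - 1) / form x x * form v x) • x := rfl

lemma refl_zero (x : V p q) (hx : form x x ≠ 0) : refl x hx 0 = 1 := by
  ext1
  refine LinearEquiv.ext fun v => ?_
  rw [refl_apply]
  simp

lemma refl_add (x : V p q) (hx : form x x ≠ 0) (s t : ℝ) :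
    refl x hx (s + t) = refl x hx s * refl x hx t := by
  ext1
  refine LinearEquiv.ext fun v => ?_
  change _ = (refl x hx s).1 ((refl x hx t).1 v)
  simp only [refl_apply, form_add_left, form_smul_left]
  rw [add_assoc, ← add_smul]
  congr 2
  push_cast
  rw [mul_add, add_mul, Complex.exp_add]
  field_simp
  ring

lemma refl_neg (x : V p q) (hx : form x x ≠ 0) (t : ℝ) : refl x hx (-t) = (refl x hx t)⁻¹ := by
  rw [eq_inv_iff_mul_eq_one, ← refl_add, neg_add_cancel, refl_zero]

lemma act_mul (g h : U p q) (η : X0 p q) : act (g * h) η = act g (act h η) := rfl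

lemma act_one (η : X0 p q) : act 1 η = η := rfl

lemma hasDerivAt_refl (x : V p q) (hx : form x x ≠ 0) (v : V p q) (t : ℝ) :
    HasDerivAt (fun t : ℝ => (refl x hx t).1 v) (vf x ((refl x hx t).1 v)) t := by
  have h0 : HasDerivAt (fun t : ℝ => Complex.I * (t : ℂ) * form x x)
      (Complex.I * form x x) t := by
    simpa using ((Complex.ofRealCLM.hasDerivAt (x := t)).const_mul Complex.I).mul_const (form x x)
  have h1 : HasDerivAt (fun t : ℝ => (Complex.exp (Complex.I * t * form x x) - 1) / form x x *
      form v x) (Complex.exp (Complex.I * t * form x x) * (Complex.I * form x x) / form x x *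
        form v x) t :=
    (((h0.cexp).sub_const 1).div_const _).mul_const _
  have h2 := (h1.smul_const x).const_add v
  refine h2.congr_deriv ?_
  rw [vf, refl_apply, form_add_left, form_smul_left]
  congr 1
  field_simp
  ring

lemma contDiff_vf (x : V p q) : ContDiff ℝ ∞ (vf x) := by
  have : ContDiff ℝ ∞ (fun v : V p q => form v x) :=
    ((formL x).restrictScalars ℝ).toContinuousLinearMap.contDiff
  exact (contDiff_const.mul this).smul contDiff_const

/-! ### Lie derivatives -/

/-- The derivative of `f` along the one-parameter group of reflections in `x`. -/
def lieFun (α β : ℂ) (x : V p q) (f : X0 p q → ℂ) (η : X0 p q) : ℂ :=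
  fderiv ℝ (ext α β f) η.1 (vf x η.1)

lemma hasDerivAt_refl_comp {F : V p q → ℂ} {x : V p q} (hx : form x x ≠ 0) {v : V p q} {t : ℝ}
    (hF : DifferentiableAt ℝ F ((refl x hx t).1 v)) :
    HasDerivAt (fun t : ℝ => F ((refl x hx t).1 v))
      (fderiv ℝ F ((refl x hx t).1 v) (vf x ((refl x hx t).1 v))) t :=
  hF.hasFDerivAt.comp_hasDerivAt t (hasDerivAt_refl x hx v t)

lemma hasDerivAt_act {α β : ℂ} {f : X0 p q → ℂ} (hf : f ∈ S p q α β) {x : V p q}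
    (hx : form x x ≠ 0) (η : X0 p q) (t : ℝ) :
    HasDerivAt (fun t : ℝ => f (act (refl x hx t) η))
      (lieFun α β x f (act (refl x hx t) η)) t := by
  have h1 := hasDerivAt_refl_comp (F := ext α β f) hx (v := η.1) (t := t)
    ((contDiffAt_ext hf.1 (mem_Opn (act (refl x hx t) η))).differentiableAt (by simp))
  refine h1.congr_of_eventuallyEq (Eventually.of_forall fun s => ?_)
  exact (ext_coe hf (act (refl x hx s) η)).symm

/-- Reflections preserve the cone, so the Lie derivative depends only on f and not on the extension
in its definition. Any derivative along the orbit at time 0 must therefore agree with it. -/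
lemma lieFun_eq {α β : ℂ} {f f' : X0 p q → ℂ} (hf : f ∈ S p q α β) {x : V p q}
    (hx : form x x ≠ 0) {η : X0 p q}
    (h : HasDerivAt (fun t : ℝ => f (act (refl x hx t) η)) (f' η) 0) :
    lieFun α β x f η = f' η := by
  have h1 := hasDerivAt_act hf hx η 0
  rw [refl_zero, act_one] at h1
  exact h1.unique h

lemma lieFun_mem {α β : ℂ} {f : X0 p q → ℂ} (hf : f ∈ S p q α β) {x : V p q}
    (hx : form x x ≠ 0) : lieFun α β x f ∈ S p q α β := by
  refine ⟨fun η => ⟨Opn p q, fun v => fderiv ℝ (ext α β f) v (vf x v), isOpen_Opn, mem_Opn η,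
    fun v hv => ContDiffAt.contDiffWithinAt ?_, fun y _ => rfl⟩, fun s η => ?_⟩
  · exact ((contDiffAt_ext hf.1 hv).fderiv_right (m := ∞) (by simp)).clm_apply
      (contDiff_vf x).contDiffAt
  · have h1 := hasDerivAt_act hf hx (dilate s η) 0
    have h2 := (hasDerivAt_act hf hx η 0).const_mul (psi α β s)
    rw [refl_zero, act_one] at h1 h2
    refine h1.unique (h2.congr_of_eventuallyEq (Eventually.of_forall fun t => ?_))
    have h : act (refl x hx t) (dilate s η) = dilate s (act (refl x hx t) η) :=
      Subtype.ext ((refl x hx t).1.map_smul (s : ℂ) η.1)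
    simp only [h]
    exact hf.2 s _

/-- A subspace is stable under Lie derivatives. -/
def LieStable {α β : ℂ} (L : Submodule ℂ (S p q α β)) : Prop :=
  ∀ x : V p q, ∀ hx : form x x ≠ 0, ∀ f ∈ L, (⟨lieFun α β x f.1, lieFun_mem f.2 hx⟩ : S p q α β) ∈ L

/-! ### Convergence in the smooth topology -/

lemma tendsto_smoothTopology {α β : ℂ} {ι : Type} {l : Filter ι} {f : ι → S p q α β}
    {g : S p q α β}
    (h : ∀ (d : ℕ) (φ : SmoothParam p q d) (k : ℕ) (C : Set (EuclideanSpace ℝ (Fin d))),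
      IsCompact C → TendstoUniformlyOn
        (fun i => iteratedFDeriv ℝ k (fun u => (f i).1 (φ.toFun u)))
        (iteratedFDeriv ℝ k (fun u => g.1 (φ.toFun u))) l C) :
    Tendsto f l (@nhds _ (smoothTopology p q α β) g) := by
  rw [smoothTopology]
  simp only [nhds_iInf, tendsto_iInf]
  intro d φ k
  rw [nhds_induced, tendsto_comap_iff, UniformOnFun.tendsto_iff_tendstoUniformlyOn]
  exact fun C hC => h d φ k C hC

lemma mem_of_tendsto_smoothTopology {α β : ℂ} {W : Submodule ℂ (S p q α β)}
    (hW : IsClosed[smoothTopology p q α β] (W : Set (S p q α β)))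
    {ι : Type} {l : Filter ι} [l.NeBot] {f : ι → S p q α β} {g : S p q α β}
    (hf : ∀ᶠ i in l, f i ∈ W)
    (h : ∀ (d : ℕ) (φ : SmoothParam p q d) (k : ℕ) (C : Set (EuclideanSpace ℝ (Fin d))),
      IsCompact C → TendstoUniformlyOn
        (fun i => iteratedFDeriv ℝ k (fun u => (f i).1 (φ.toFun u)))
        (iteratedFDeriv ℝ k (fun u => g.1 (φ.toFun u))) l C) : g ∈ W :=
  @IsClosed.mem_of_tendsto _ (smoothTopology p q α β) _ _ _ _ _ _ hW (tendsto_smoothTopology h) hf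

lemma smoothFamily_comp {α β : ℂ} {f : X0 p q → ℂ} (hf : f ∈ S p q α β) {T M E : Type}
    [TopologicalSpace T] [NormedAddCommGroup M] [NormedSpace ℝ M] [NormedAddCommGroup E]
    [NormedSpace ℝ E] {e : T → M} (he : Continuous e) {Ψ : T → E → X0 p q} {ψ : M × E → V p q}
    (hψ : ∀ t u, ContDiffAt ℝ ∞ ψ (e t, u)) (h : ∀ t u, (Ψ t u).1 = ψ (e t, u)) :
    SmoothFamily fun t u => f (Ψ t u) := by
  have h1 : SmoothFamily fun t u => (fun x => ext α β f (ψ x)) (e t, u) :=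
    SmoothFamily.of_ambient (G := fun x => ext α β f (ψ x)) he fun t u => by
      refine ContDiffAt.comp (g := ext α β f) (e t, u) ?_ (hψ t u)
      rw [← h]
      exact contDiffAt_ext hf.1 (mem_Opn _)
  have h2 : (fun t u => f (Ψ t u)) = fun t u => (fun x => ext α β f (ψ x)) (e t, u) := by
    funext t u
    simp only [← h, ext_coe hf]
  rw [h2]
  exact h1

lemma contDiff_refl (x : V p q) (hx : form x x ≠ 0) {d : ℕ} (φ : SmoothParam p q d) :
    ContDiff ℝ ∞ fun y : ℝ × EuclideanSpace ℝ (Fin d) =>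
      (refl x hx y.1).1 (φ.toFun y.2).1 := by
  simp only [refl_apply]
  have h1 : ContDiff ℝ ∞ (fun v : V p q => form v x) :=
    ((formL x).restrictScalars ℝ).toContinuousLinearMap.contDiff
  have h2 : ContDiff ℝ ∞ fun y : ℝ × EuclideanSpace ℝ (Fin d) => (φ.toFun y.2).1 :=
    φ.contDiff.comp contDiff_snd
  have h3 : ContDiff ℝ ∞ fun y : ℝ × EuclideanSpace ℝ (Fin d) => (y.1 : ℂ) :=
    Complex.ofRealCLM.contDiff.comp contDiff_fst
  have h4 : ContDiff ℝ ∞ fun y : ℝ × EuclideanSpace ℝ (Fin d) =>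
      (Complex.exp (Complex.I * (y.1 : ℂ) * form x x) - 1) / form x x :=
    ((((contDiff_const.mul h3).mul contDiff_const).cexp).sub contDiff_const).div_const _
  exact h2.add ((h4.mul (h1.comp h2)).smul contDiff_const)

/-- The closed invariant subspaces are stable under Lie derivatives. -/
lemma lieStable_of_invariant {α β : ℂ} {W : Submodule ℂ (S p q α β)}
    (hW : IsClosed[smoothTopology p q α β] (W : Set (S p q α β)))
    (hinv : ∀ g : U p q, ∀ f ∈ W, rho p q α β g f ∈ W) : LieStable W := by
  intro x hx f hf
  set f' : S p q α β := ⟨lieFun α β x f.1, lieFun_mem f.2 hx⟩ with hf'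
  let T := Set.Icc (-1 : ℝ) 1
  have h01 : (-1 : ℝ) ≤ 1 := by norm_num
  let ν : Measure ℝ := volume.restrict (Set.Icc 0 1)
  have hν : ν.real Set.univ = 1 := by simp [ν]
  -- The difference quotients, which lie in W. The sign is -t because `rho` acts through the
  -- inverse.
  let fam : ℝ → S p q α β := fun t => (t : ℂ)⁻¹ • (rho p q α β (refl x hx (-t)) f - f)
  have hmem : ∀ t, fam t ∈ W := fun t => W.smul_mem _ (W.sub_mem (hinv _ f hf) hf)
  -- By the fundamental theorem of calculus the quotient is the mean over s in [0,1] of the Lie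
  -- derivative at time ts, so the convergence theorem for averages applies. The projection to
  -- [-1,1] only makes the parameter space compact.
  have hfam : ∀ t ∈ Set.Icc (-1 : ℝ) 1, t ≠ 0 → ∀ η, (fam t).1 η =
      ∫ s, (1 : ℂ) • f'.1 (act (refl x hx (Set.projIcc (-1) 1 h01 (t * s)).1) η) ∂ν := by
    intro t ht ht0 η
    have hcont : Continuous fun s : ℝ => f'.1 (act (refl x hx (t * s)) η) :=
      continuous_iff_continuousAt.2 fun s => by
        have := (hasDerivAt_act f'.2 hx η (t * s)).continuousAt
        exact this.comp (continuous_const.mul continuous_id).continuousAt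
    have h1 : ∀ s ∈ Set.uIcc (0 : ℝ) 1, HasDerivAt
        (fun s : ℝ => (t : ℂ)⁻¹ * f.1 (act (refl x hx (t * s)) η))
        (f'.1 (act (refl x hx (t * s)) η)) s := by
      intro s _
      have h2 : HasDerivAt (fun s : ℝ => t * s) t s := by
        simpa using (hasDerivAt_id s).const_mul t
      have h3 := ((hasDerivAt_act f.2 hx η (t * s)).scomp s h2).const_mul (t : ℂ)⁻¹
      refine h3.congr_deriv ?_
      have ht0' : (t : ℂ) ≠ 0 := by exact_mod_cast ht0
      rw [Complex.real_smul, ← mul_assoc, inv_mul_cancel₀ ht0', one_mul]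
    have h2 := intervalIntegral.integral_eq_sub_of_hasDerivAt h1 (hcont.intervalIntegrable 0 1)
    rw [intervalIntegral.integral_of_le zero_le_one, ← integral_Icc_eq_integral_Ioc] at h2
    have h3 : ∫ s, (1 : ℂ) • f'.1 (act (refl x hx (Set.projIcc (-1) 1 h01 (t * s)).1) η) ∂ν =
        ∫ s in Set.Icc (0 : ℝ) 1, f'.1 (act (refl x hx (t * s)) η) := by
      refine setIntegral_congr_fun measurableSet_Icc fun s hs => ?_
      have : t * s ∈ Set.Icc (-1 : ℝ) 1 := by
        constructor <;> nlinarith [ht.1, ht.2, hs.1, hs.2]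
      simp only [one_smul, Set.projIcc_of_mem h01 this]
    rw [h3, h2, mul_one, mul_zero, refl_zero, act_one]
    change (t : ℂ)⁻¹ * (f.1 (act (refl x hx (-t))⁻¹ η) - f.1 η) = _
    rw [refl_neg, inv_inv, mul_sub]
  refine mem_of_tendsto_smoothTopology hW (l := 𝓝[≠] 0) (f := fam)
    (Eventually.of_forall hmem) fun d φ k C hC => ?_
  have hG : SmoothFamily fun (t : T) u => f'.1 (act (refl x hx t.1) (φ.toFun u)) := by
    exact smoothFamily_comp f'.2 continuous_subtype_val
      (fun t u => (contDiff_refl x hx φ).contDiffAt) fun t u => rfl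
  have hconv := tendstoUniformlyOn_average hG (l := 𝓝[≠] (0 : ℝ)) (ν := fun _ => ν) (b := 1)
    (fun _ => hν.le) (Φ := fun _ => 1) stronglyMeasurable_const (B := 1) (fun _ => by simp)
    (σ := fun t s => Set.projIcc (-1) 1 h01 (t * s))
    (fun t => (continuous_projIcc.comp (continuous_const.mul continuous_id)).measurable)
    (τ := fun _ => ⟨0, by simp [T]⟩) measurable_const ?_
    (g := fun u => f'.1 (φ.toFun u)) ?_ k hC
  · refine hconv.congr ?_
    filter_upwards [self_mem_nhdsWithin, mem_nhdsWithin_of_mem_nhds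
      (Icc_mem_nhds (by norm_num : (-1 : ℝ) < 0) one_pos)] with t ht0 ht u _
    congr 2
    funext u
    exact (hfam t ht ht0 _).symm
  · intro δ hδ
    refine tendsto_const_nhds.congr' ?_
    filter_upwards [mem_nhdsWithin_of_mem_nhds (Icc_mem_nhds (by norm_num : (-1 : ℝ) < 0) one_pos),
      mem_nhdsWithin_of_mem_nhds (Metric.ball_mem_nhds (0 : ℝ) hδ)] with t ht htδ
    rw [measureReal_restrict_apply' measurableSet_Icc]
    have : {s : ℝ | δ ≤ dist (Set.projIcc (-1 : ℝ) 1 h01 (t * s))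
        (⟨0, by simp [T]⟩ : T)} ∩ Set.Icc 0 1 = ∅ := by
      refine Set.eq_empty_of_forall_notMem fun s ⟨hs, hs'⟩ => ?_
      have h2 : t * s ∈ Set.Icc (-1 : ℝ) 1 := by
        constructor <;> nlinarith [ht.1, ht.2, hs'.1, hs'.2]
      rw [Set.mem_ofPred_eq, Set.projIcc_of_mem h01 h2, Subtype.dist_eq, Real.dist_0_eq_abs,
        abs_mul, abs_of_nonneg hs'.1] at hs
      rw [Metric.mem_ball, Real.dist_0_eq_abs] at htδ
      nlinarith [abs_nonneg t, hs'.2]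
    rw [this, measureReal_empty]
  · intro _ u
    simp [hν, refl_zero, act_one]

end LightCone

end

/-! ### U(p) × U(q), its Haar measure, and its orbit the product of unit spheres. -/

open scoped Topology ContDiff UniformConvergence ComplexConjugate

noncomputable section

namespace LightCone

set_option linter.unusedSectionVars false

open MeasureTheory Filter

/-! ### The maximal compact subgroup -/

/-- The group `U(p) × U(q)`. -/
def K (p q : ℕ) : Type := Matrix.unitaryGroup (Fin p) ℂ × Matrix.unitaryGroup (Fin q) ℂ

instance (p q : ℕ) : Group (K p q) :=
  inferInstanceAs (Group (Matrix.unitaryGroup (Fin p) ℂ × Matrix.unitaryGroup (Fin q) ℂ))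

/-- The matrix entries of an element of `U(p) × U(q)`. -/
def entries {p q : ℕ} (k : K p q) : (Fin p → Fin p → ℂ) × (Fin q → Fin q → ℂ) :=
  (fun i j => k.1.1 i j, fun i j => k.2.1 i j)

variable {p q : ℕ}

lemma entries_injective : Function.Injective (entries : K p q → _) := by
  intro k l h
  exact Prod.ext (Subtype.ext (congrArg Prod.fst h)) (Subtype.ext (congrArg Prod.snd h))

instance : MetricSpace (K p q) := MetricSpace.induced entries entries_injective inferInstance

lemma continuous_entries : Continuous (entries : K p q → _) := continuous_induced_dom

lemma continuous_fst_entry (i j : Fin p) : Continuous fun k : K p q => k.1.1 i j :=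
  (continuous_apply_apply i j).comp (continuous_fst.comp continuous_entries)

lemma continuous_snd_entry (i j : Fin q) : Continuous fun k : K p q => k.2.1 i j :=
  (continuous_apply_apply i j).comp (continuous_snd.comp continuous_entries)

lemma continuous_toK {T : Type} [TopologicalSpace T] {f : T → K p q}
    (h1 : ∀ i j, Continuous fun t => (f t).1.1 i j) (h2 : ∀ i j, Continuous fun t => (f t).2.1 i j) :
    Continuous f :=
  continuous_induced_rng.2 ((continuous_pi fun i => continuous_pi fun j => h1 i j).prodMk
    (continuous_pi fun i => continuous_pi fun j => h2 i j))

instance : IsTopologicalGroup (K p q) where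
  continuous_mul := by
    refine continuous_toK (fun i j => ?_) fun i j => ?_
    · have : (fun x : K p q × K p q => (x.1 * x.2).1.1 i j) =
          fun x => ∑ l, x.1.1.1 i l * x.2.1.1 l j := by
        funext x; exact Matrix.mul_apply
      rw [this]
      exact continuous_finsetSum _ fun l _ => ((continuous_fst_entry i l).comp
        continuous_fst).mul ((continuous_fst_entry l j).comp continuous_snd)
    · have : (fun x : K p q × K p q => (x.1 * x.2).2.1 i j) =
          fun x => ∑ l, x.1.2.1 i l * x.2.2.1 l j := by
        funext x; exact Matrix.mul_apply
      rw [this]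
      exact continuous_finsetSum _ fun l _ => ((continuous_snd_entry i l).comp
        continuous_fst).mul ((continuous_snd_entry l j).comp continuous_snd)
  continuous_inv := continuous_toK
    (fun i j => Complex.continuous_conj.comp (continuous_fst_entry j i))
    fun i j => Complex.continuous_conj.comp (continuous_snd_entry j i)

instance : CompactSpace (K p q) := by
  have hind : Topology.IsInducing (entries : K p q → _) := ⟨rfl⟩
  refine ⟨hind.isCompact_iff.2 ?_⟩
  refine Metric.isCompact_of_isClosed_isBounded ?_ ?_
  · have : entries '' (Set.univ : Set (K p q)) =
        {x | (Matrix.of x.1).conjTranspose * Matrix.of x.1 = 1} ∩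
        {x | (Matrix.of x.2).conjTranspose * Matrix.of x.2 = 1} := by
      ext x
      constructor
      · rintro ⟨k, -, rfl⟩
        exact ⟨(Matrix.mem_unitaryGroup_iff').1 k.1.2, (Matrix.mem_unitaryGroup_iff').1 k.2.2⟩
      · rintro ⟨h1, h2⟩
        exact ⟨(⟨Matrix.of x.1, Matrix.mem_unitaryGroup_iff'.2 h1⟩,
          ⟨Matrix.of x.2, Matrix.mem_unitaryGroup_iff'.2 h2⟩), trivial, rfl⟩
    rw [this]
    refine (isClosed_eq ?_ continuous_const).inter (isClosed_eq ?_ continuous_const)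
    · exact continuous_fst.matrix_conjTranspose.matrix_mul continuous_fst
    · exact continuous_snd.matrix_conjTranspose.matrix_mul continuous_snd
  · refine (Metric.isBounded_closedBall (x := 0) (r := 1)).subset ?_
    rintro x ⟨k, -, rfl⟩
    rw [mem_closedBall_zero_iff, Prod.norm_def, max_le_iff]
    exact ⟨(pi_norm_le_iff_of_nonneg zero_le_one).2 fun i =>
        (pi_norm_le_iff_of_nonneg zero_le_one).2 fun j => entry_norm_bound_of_unitary k.1.2 i j,
      (pi_norm_le_iff_of_nonneg zero_le_one).2 fun i =>
        (pi_norm_le_iff_of_nonneg zero_le_one).2 fun j => entry_norm_bound_of_unitary k.2.2 i j⟩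

instance : MeasurableSpace (K p q) := borel _

instance : BorelSpace (K p q) := ⟨rfl⟩

/-- The invariant probability measure on `U(p) × U(q)`. -/
def haarK (p q : ℕ) : Measure (K p q) := Measure.haarMeasure ⊤

instance : (haarK p q).IsHaarMeasure := inferInstanceAs (Measure.haarMeasure ⊤).IsHaarMeasure

instance : IsProbabilityMeasure (haarK p q) := ⟨by
  have := Measure.haarMeasure_self (K₀ := (⊤ : TopologicalSpace.PositiveCompacts (K p q)))
  simpa [haarK] using this⟩

/-- Conjugation by g⁻¹ is an automorphism of a compact group and so preserves Haar measure; followed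
by left translation by g it is right translation by g. -/
instance : (haarK p q).IsMulRightInvariant := ⟨fun g => by
  have h1 : MeasurePreserving (MulAut.conj g⁻¹).toMonoidHom (haarK p q) (haarK p q) :=
    MonoidHom.measurePreserving ((continuous_const.mul continuous_id).mul continuous_const)
      (MulAut.conj g⁻¹).surjective rfl
  have h2 := (measurePreserving_mul_left (haarK p q) g).comp h1
  have h3 : (g * ·) ∘ (MulAut.conj g⁻¹).toMonoidHom = (· * g) := by
    funext x; simp [mul_assoc]
  rw [h3] at h2
  exact h2.map_eq⟩

/-- The action of `U(p) × U(q)` on vectors. -/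
def kact (k : K p q) (v : V p q) : V p q := (k.1.1.mulVec v.1, k.2.1.mulVec v.2)

lemma kact_mul (k l : K p q) (v : V p q) : kact (k * l) v = kact k (kact l v) := by
  simp only [kact, Matrix.mulVec_mulVec]
  rfl

lemma kact_one (v : V p q) : kact 1 v = v :=
  Prod.ext (Matrix.one_mulVec _) (Matrix.one_mulVec _)

lemma unitary_dotProduct {n : ℕ} (A : Matrix.unitaryGroup (Fin n) ℂ) (v w : Fin n → ℂ) :
    A.1.mulVec v ⬝ᵥ star (A.1.mulVec w) = v ⬝ᵥ star w := by
  rw [Matrix.star_mulVec, dotProduct_comm, ← Matrix.dotProduct_mulVec, Matrix.mulVec_mulVec,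
    ← Matrix.star_eq_conjTranspose, (Matrix.mem_unitaryGroup_iff').1 A.2, Matrix.one_mulVec,
    dotProduct_comm]

lemma form_eq_dotProduct (v w : V p q) : form v w = v.1 ⬝ᵥ star w.1 - v.2 ⬝ᵥ star w.2 := rfl

lemma form_kact (k : K p q) (v w : V p q) : form (kact k v) (kact k w) = form v w := by
  simp only [form_eq_dotProduct, kact, unitary_dotProduct]

lemma rz_kact (k : K p q) (v : V p q) : rz (kact k v) = rz v := by
  have h : ∀ z : Fin p → ℂ, ((∑ i, Complex.normSq (z i) : ℝ) : ℂ) = z ⬝ᵥ star z := by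
    intro z; simp [dotProduct, Complex.mul_conj]
  have := unitary_dotProduct k.1 v.1 v.1
  rw [← h, ← h] at this
  exact_mod_cast this

/-- The inclusion of `U(p) × U(q)` in `U(p, q)`. -/
def toU (k : K p q) : U p q :=
  ⟨{ toFun := kact k
     invFun := kact k⁻¹
     map_add' := fun v w => by simp [kact, Matrix.mulVec_add]
     map_smul' := fun c v => by simp [kact, Matrix.mulVec_smul]
     left_inv := fun v => by rw [← kact_mul, inv_mul_cancel, kact_one]
     right_inv := fun v => by rw [← kact_mul, mul_inv_cancel, kact_one] },
    fun v w => form_kact k v w⟩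

/-- A unitary reflection as a matrix. -/
def reflMatrix {n : ℕ} (a : Fin n → ℂ) (ha : a ⬝ᵥ star a ≠ 0) (u : ℂ) (hu : u * conj u = 1) :
    Matrix.unitaryGroup (Fin n) ℂ :=
  ⟨1 + ((u - 1) / (a ⬝ᵥ star a)) • Matrix.vecMulVec a (star a), by
    have hk : star (a ⬝ᵥ star a) = a ⬝ᵥ star a := by
      simp only [dotProduct, star_sum, star_mul', Pi.star_apply, star_star]
      exact Finset.sum_congr rfl fun i _ => mul_comm _ _
    have h2 : star (Matrix.vecMulVec a (star a)) = Matrix.vecMulVec a (star a) := by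
      rw [Matrix.star_eq_conjTranspose, Matrix.conjTranspose_vecMulVec, star_star]
    have h3 : Matrix.vecMulVec a (star a) * Matrix.vecMulVec a (star a) =
        (a ⬝ᵥ star a) • Matrix.vecMulVec a (star a) := by
      rw [Matrix.vecMulVec_mul_vecMulVec, dotProduct_comm]
      ext i j
      simp [Matrix.vecMulVec_apply]
      ring
    have h4 : star u = conj u := rfl
    rw [Matrix.mem_unitaryGroup_iff', star_add, star_one, star_smul, h2, mul_add, add_mul, add_mul,
      smul_mul_smul_comm, h3, one_mul, mul_one, one_mul,
      star_div₀, star_sub, star_one, hk, h4, smul_smul, add_assoc, ← add_smul,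
      ← add_smul]
    have : (conj u - 1) / (a ⬝ᵥ star a) + ((u - 1) / (a ⬝ᵥ star a) +
        (conj u - 1) / (a ⬝ᵥ star a) * ((u - 1) / (a ⬝ᵥ star a) * (a ⬝ᵥ star a))) = 0 := by
      field_simp
      linear_combination hu
    rw [← mul_assoc] at this
    simp [this]⟩

lemma reflMatrix_mulVec {n : ℕ} (a : Fin n → ℂ) (ha : a ⬝ᵥ star a ≠ 0) (u : ℂ)
    (hu : u * conj u = 1) (v : Fin n → ℂ) : (reflMatrix a ha u hu).1.mulVec v =
      v + ((u - 1) / (a ⬝ᵥ star a) * (v ⬝ᵥ star a)) • a := by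
  rw [reflMatrix, Matrix.add_mulVec, Matrix.one_mulVec, Matrix.smul_mulVec,
    Matrix.vecMulVec_mulVec, dotProduct_comm (star a) v]
  simp [smul_smul]

/-- Reflections in vectors with a vanishing component belong to `U(p) × U(q)`. -/
lemma exists_kact_eq_refl (x : V p q) (hx : form x x ≠ 0) (h : x.1 = 0 ∨ x.2 = 0) (t : ℝ) :
    ∃ k : K p q, ∀ v, kact k v = (refl x hx t).1 v := by
  rcases h with h | h
  · have ha : x.2 ⬝ᵥ star x.2 ≠ 0 := by
      rw [form_eq_dotProduct, h, zero_dotProduct, zero_sub] at hx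
      exact neg_ne_zero.1 hx
    refine ⟨(1, reflMatrix x.2 ha _ (exp_mul_conj t x)), fun v => ?_⟩
    rw [refl_apply]
    refine Prod.ext ?_ ?_
    · simp [kact, h]
    · simp [kact, reflMatrix_mulVec, form_eq_dotProduct, h]
      rw [← neg_smul]
      congr 1
      ring
  · have ha : x.1 ⬝ᵥ star x.1 ≠ 0 := by
      rw [form_eq_dotProduct, h, zero_dotProduct, sub_zero] at hx
      exact hx
    refine ⟨(reflMatrix x.1 ha _ (exp_mul_conj t x), 1), fun v => ?_⟩
    rw [refl_apply]
    refine Prod.ext ?_ ?_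
    · simp [kact, reflMatrix_mulVec, form_eq_dotProduct, h]
    · simp [kact, h]

/-! ### Transitivity -/

/-- The number (x,x) is real and nonzero, so t = arg u / (x,x) produces the prescribed eigenvalue.
-/
lemma exists_refl_eq (x : V p q) (hx : form x x ≠ 0) (u : ℂ) (hu : u * conj u = 1) :
    ∃ t : ℝ, ∀ v, (refl x hx t).1 v = v + ((u - 1) / form x x * form v x) • x := by
  have hx' : (rz x - rw' x : ℝ) ≠ 0 := by
    rw [form_self] at hx; exact_mod_cast hx
  refine ⟨Complex.arg u / (rz x - rw' x), fun v => ?_⟩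
  have hnorm : ‖u‖ = 1 := by
    have : (Complex.normSq u : ℂ) = 1 := by rw [← Complex.mul_conj, hu]
    have : Complex.normSq u = 1 := by exact_mod_cast this
    rw [Complex.norm_def, this, Real.sqrt_one]
  have : Complex.exp (Complex.I * ((Complex.arg u / (rz x - rw' x) : ℝ) : ℂ) * form x x) = u := by
    rw [form_self]
    have h2 : Complex.I * ((Complex.arg u / (rz x - rw' x) : ℝ) : ℂ) * ((rz x - rw' x : ℝ) : ℂ) =
        Complex.arg u * Complex.I := by
      rw [mul_assoc, ← Complex.ofReal_mul, div_mul_cancel₀ _ hx', mul_comm]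
    rw [h2]
    have := Complex.norm_mul_exp_arg_mul_I u
    rwa [hnorm, Complex.ofReal_one, one_mul] at this
  rw [refl_apply, this]

/-- With x = v - e and d = (v,x), equality of norms gives (x,x) = d + conj d. The eigenvalue -conj d
/ d then makes the coefficient of x equal to -1, and v - x = e. -/
lemma exists_refl_of_form_ne {v e : V p q} (hve : form v v = form e e)
    (hx : form (v - e) (v - e) ≠ 0) : ∃ t : ℝ, (refl (v - e) hx t).1 v = e := by
  have hexp : form (v - e) (v - e) = 2 * form e e - form v e - form e v := by
    rw [sub_eq_add_neg, ← neg_one_smul ℂ e, form_add_left, form_add_right, form_add_right,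
      form_smul_left, form_smul_left, form_smul_right, form_smul_right, hve]
    simp
    ring
  have hvx : form v (v - e) = form e e - form v e := by
    rw [sub_eq_add_neg, ← neg_one_smul ℂ e, form_add_right, form_smul_right, hve]
    simp
    ring
  have hconj : conj (form v (v - e)) = form e e - form e v := by
    rw [hvx, map_sub, form_conj, form_conj]
  have hsum : form (v - e) (v - e) = form v (v - e) + conj (form v (v - e)) := by
    rw [hconj, hvx, hexp]; ring
  set d := form v (v - e) with hd
  have hd0 : d ≠ 0 := fun h => hx (by rw [hsum, h, map_zero, add_zero])
  have hcd0 : conj d ≠ 0 := (map_ne_zero _).2 hd0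
  obtain ⟨t, ht⟩ := exists_refl_eq (v - e) hx (-(conj d / d)) (by
    rw [map_neg, map_div₀, Complex.conj_conj]
    field_simp)
  refine ⟨t, ?_⟩
  have hdd : d + conj d ≠ 0 := hsum ▸ hx
  have : (-(conj d / d) - 1) / form (v - e) (v - e) * d = -1 := by
    rw [hsum]
    field_simp
    ring
  rw [ht, ← hd, this]
  simp

/-- Two vectors of equal nonzero norm are related by a product of two reflections in vectors of
their span. -/
lemma exists_refl_refl {v e : V p q} (hve : form v v = form e e) (he : form e e ≠ 0) :
    ∃ (x y : V p q) (hx : form x x ≠ 0) (hy : form y y ≠ 0) (s t : ℝ),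
      x ∈ Submodule.span ℂ {v, e} ∧ y ∈ Submodule.span ℂ {v, e} ∧
      (refl x hx s).1 ((refl y hy t).1 v) = e := by
  have hv0 : form v v ≠ 0 := hve ▸ he
  have hv : v ∈ Submodule.span ℂ {v, e} := Submodule.subset_span (by simp)
  have hes : e ∈ Submodule.span ℂ {v, e} := Submodule.subset_span (by simp)
  by_cases h : form (v - e) (v - e) = 0
  -- If v - e is isotropic, first send v to -v. The norms of -v - e and v - e add up to 4 (e,e), so
  -- -v - e is not isotropic.
  · obtain ⟨t, ht⟩ := exists_refl_eq v hv0 (-1) (by simp)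
    have hneg : (refl v hv0 t).1 v = -v := by
      rw [ht]
      have : (-1 - 1) / form v v * form v v = -2 := by field_simp; norm_num
      rw [this]
      module
    have h1 : form (-v - e) (-v - e) ≠ 0 := by
      have e1 : form (-v - e) (-v - e) + form (v - e) (v - e) = 4 * form e e := by
        rw [sub_eq_add_neg, sub_eq_add_neg, ← neg_one_smul ℂ e, ← neg_one_smul ℂ v]
        simp only [form_add_left, form_add_right, form_smul_left, form_smul_right, hve]
        simp
        ring
      rw [h, add_zero] at e1
      rw [e1]
      exact mul_ne_zero (by norm_num) he
    have h2 : form (-v) (-v) = form e e := by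
      rw [← neg_one_smul ℂ v, form_smul_left, form_smul_right, hve]; simp
    obtain ⟨s, hs⟩ := exists_refl_of_form_ne h2 h1
    exact ⟨-v - e, v, h1, hv0, s, t, Submodule.sub_mem _ (Submodule.neg_mem _ hv) hes, hv,
      by rw [hneg, hs]⟩
  · obtain ⟨s, hs⟩ := exists_refl_of_form_ne hve h
    exact ⟨v - e, v, h, hv0, s, 0, Submodule.sub_mem _ hv hes, hv, by rw [refl_zero]; exact hs⟩

/-- The mirrors lie in the span of v and e, hence in one component, and reflections in such vectors
are compact. -/
lemma exists_kact_eq {v e : V p q} (h : (v.1 = 0 ∧ e.1 = 0) ∨ (v.2 = 0 ∧ e.2 = 0))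
    (hve : form v v = form e e) (he : form e e ≠ 0) : ∃ k : K p q, kact k v = e := by
  obtain ⟨x, y, hx, hy, s, t, hxs, hys, hxy⟩ := exists_refl_refl hve he
  have key : ∀ x ∈ Submodule.span ℂ {v, e}, x.1 = 0 ∨ x.2 = 0 := by
    intro x hx
    rcases h with h | h
    · left
      have : Submodule.span ℂ {v, e} ≤ LinearMap.ker (LinearMap.fst ℂ (Fin p → ℂ) (Fin q → ℂ)) := by
        rw [Submodule.span_le]
        rintro w (rfl | rfl)
        exacts [h.1, h.2]
      exact this hx
    · right
      have : Submodule.span ℂ {v, e} ≤ LinearMap.ker (LinearMap.snd ℂ (Fin p → ℂ) (Fin q → ℂ)) := by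
        rw [Submodule.span_le]
        rintro w (rfl | rfl)
        exacts [h.1, h.2]
      exact this hx
  obtain ⟨k, hk⟩ := exists_kact_eq_refl x hx (key x hxs) s
  obtain ⟨l, hl⟩ := exists_kact_eq_refl y hy (key y hys) t
  exact ⟨k * l, by rw [kact_mul, hl, hk, hxy]⟩

/-! ### The base orbit -/

variable [NeZero p] [NeZero q]

/-- The image of the pair of first basis vectors. -/
def orb (k : K p q) : V p q := (fun i => k.1.1 i 0, fun j => k.2.1 j 0)

lemma orb_eq (k : K p q) : orb k = kact k (Pi.single 0 1, Pi.single 0 1) := by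
  simp [orb, kact, Matrix.col_def, funext_iff]

lemma orb_mul (k l : K p q) : orb (k * l) = kact k (orb l) := by
  rw [orb_eq, orb_eq, kact_mul]

lemma continuous_orb : Continuous (orb : K p q → V p q) :=
  (continuous_pi fun i => continuous_fst_entry i 0).prodMk
    (continuous_pi fun i => continuous_snd_entry i 0)

lemma rz_orb (k : K p q) : rz (orb k) = 1 := by
  rw [orb_eq, rz_kact, rz]
  simp [Pi.single_apply, apply_ite Complex.normSq]

lemma orb_mem (k : K p q) : orb k ∈ X0 p q := by
  have h : form (orb k) (orb k) = 0 := by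
    rw [orb_eq, form_kact]
    simp [form, Pi.single_apply]
  refine ⟨fun h0 => ?_, h⟩
  have := rz_orb k
  rw [h0, rz] at this
  simp at this

/-- The base orbit as a subset of the cone. -/
def orbX (k : K p q) : X0 p q := ⟨orb k, orb_mem k⟩

lemma rw'_orb (k : K p q) : rw' (orb k) = 1 := by
  exact (rz_eq_rw' (orbX k)).symm.trans (rz_orb k)

lemma orb_mem_Opn (k : K p q) : orb k ∈ Opn p q := mem_Opn (orbX k)

lemma continuous_orbX_comp {f : X0 p q → ℂ} (hf : IsSmooth f) :
    Continuous fun k : K p q => f (orbX k) := by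
  refine continuous_iff_continuousAt.2 fun k => ?_
  have h := (contDiffAt_zext_proj hf (orb_mem_Opn k)).continuousAt.comp
    (continuous_orb (p := p) (q := q)).continuousAt
  refine h.congr (Eventually.of_forall fun l => ?_)
  change zext f (proj (orb l)) = f (orbX l)
  rw [proj_eq_self (rz_orb l) (rw'_orb l)]
  exact zext_coe f (orbX l)

lemma rz_eq_form (v : V p q) : ((rz v : ℝ) : ℂ) = form (v.1, (0 : Fin q → ℂ)) (v.1, 0) := by
  simp [form, rz, Complex.mul_conj]

lemma rw'_eq_form (v : V p q) : ((rw' v : ℝ) : ℂ) = -form ((0 : Fin p → ℂ), v.2) (0, v.2) := by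
  simp [form, rw', Complex.mul_conj]

lemma exists_orb_eq {v : V p q} (h : rz v = 1) (h' : rw' v = 1) : ∃ k : K p q, orb k = v := by
  have e1 : form (v.1, (0 : Fin q → ℂ)) (v.1, 0) = 1 := by rw [← rz_eq_form, h, Complex.ofReal_one]
  have e2 : form ((0 : Fin p → ℂ), v.2) (0, v.2) = -1 := by
    rw [← neg_neg (form _ _), ← rw'_eq_form, h', Complex.ofReal_one]
  obtain ⟨k, hk⟩ := exists_kact_eq (v := ((Pi.single 0 1 : Fin p → ℂ), (0 : Fin q → ℂ)))
    (e := (v.1, 0)) (Or.inr ⟨rfl, rfl⟩)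
    (by rw [e1]; simp [form, Pi.single_apply]) (by rw [e1]; exact one_ne_zero)
  obtain ⟨l, hl⟩ := exists_kact_eq (v := ((0 : Fin p → ℂ), (Pi.single 0 1 : Fin q → ℂ)))
    (e := (0, v.2)) (Or.inl ⟨rfl, rfl⟩)
    (by rw [e2]; simp [form, Pi.single_apply]) (by rw [e2]; exact neg_ne_zero.2 one_ne_zero)
  refine ⟨show K p q from (k.1, l.2), ?_⟩
  rw [orb_eq]
  exact Prod.ext (congrArg Prod.fst hk :) (congrArg Prod.snd hl :)

lemma exists_orbX_eq (x : X0 p q) (h : rz x.1 = 1) : ∃ k : K p q, orbX k = x := by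
  obtain ⟨k, hk⟩ := exists_orb_eq h ((rz_eq_rw' x).symm.trans h)
  exact ⟨k, Subtype.ext hk⟩

lemma eq_zero_of_orbX {α β : ℂ} {f : X0 p q → ℂ} (hf : f ∈ S p q α β)
    (h : ∀ k : K p q, f (orbX k) = 0) : f = 0 := by
  funext x
  rw [← ext_coe hf x, ext]
  obtain ⟨k, hk⟩ := exists_orbX_eq ⟨proj x.1, proj_mem (mem_Opn x)⟩ (rz_proj (mem_Opn x))
  have := h k
  rw [hk, ← zext_coe f] at this
  rw [this, mul_zero]
  rfl

/-! ### Continuity of integrals over the base orbit -/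

lemma eventually_param {α β : ℂ} (f : S p q α β) {d : ℕ} (φ : SmoothParam p q d)
    {C : Set (EuclideanSpace ℝ (Fin d))} (hC : IsCompact C) {ε : ℝ} (hε : 0 < ε) :
    ∀ᶠ g in @nhds _ (smoothTopology p q α β) f, ∀ u ∈ C,
      ‖g.1 (φ.toFun u) - f.1 (φ.toFun u)‖ < ε := by
  have h1 : Tendsto id (@nhds _ (smoothTopology p q α β) f)
      (@nhds _ (smoothTopology p q α β) f) := tendsto_id
  rw [smoothTopology] at h1
  simp only [nhds_iInf, tendsto_iInf] at h1
  have h2 := h1 d φ 0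
  rw [nhds_induced, tendsto_comap_iff, UniformOnFun.tendsto_iff_tendstoUniformlyOn] at h2
  have h3 := Metric.tendstoUniformlyOn_iff.1 (h2 C hC) ε hε
  simp only [nhds_iInf]
  refine h3.mono fun g hg u hu => ?_
  have h4 : dist (iteratedFDeriv ℝ 0 (fun u => f.1 (φ.toFun u)) u)
      (iteratedFDeriv ℝ 0 (fun u => g.1 (φ.toFun u)) u) < ε := hg u hu
  rw [dist_comm] at h4
  simp only [iteratedFDeriv_zero_eq_comp, Function.comp_apply, dist_eq_norm] at h4
  rwa [← map_sub, LinearIsometryEquiv.norm_map] at h4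

/-- The topology tests only globally defined parametrizations. A bump function keeps the displaced
point inside the domain of `proj` for all u and is 1 near 0, so that the nearby part of the orbit is
still covered. -/
lemma exists_param_orb (k : K p q) : ∃ (d : ℕ) (φ : SmoothParam p q d)
    (C : Set (EuclideanSpace ℝ (Fin d))), IsCompact C ∧
      ∀ᶠ l in 𝓝 k, ∃ u ∈ C, φ.toFun u = orbX l := by
  let L : V p q ≃L[ℝ] EuclideanSpace ℝ (Fin (Module.finrank ℝ (V p q))) := toEuclidean
  have hO : L.symm ⁻¹' ((fun v => orb k + v) ⁻¹' Opn p q) ∈ 𝓝 0 := by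
    refine L.symm.continuous.continuousAt.preimage_mem_nhds ?_
    refine (continuous_const.add continuous_id).continuousAt.preimage_mem_nhds ?_
    simpa using isOpen_Opn.mem_nhds (orb_mem_Opn k)
  obtain ⟨r, hr, hrO⟩ := Metric.mem_nhds_iff.1 hO
  let b : ContDiffBump (0 : EuclideanSpace ℝ (Fin (Module.finrank ℝ (V p q)))) :=
    ⟨r / 4, r / 2, by positivity, by linarith⟩
  have hmem : ∀ u, orb k + L.symm (b u • u) ∈ Opn p q := by
    intro u
    refine hrO (?_ : b u • u ∈ _)
    rw [mem_ball_zero_iff, norm_smul, Real.norm_of_nonneg b.nonneg]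
    by_cases hu : ‖u‖ < r / 2
    · calc b u * ‖u‖ ≤ 1 * ‖u‖ := mul_le_mul_of_nonneg_right b.le_one (norm_nonneg _)
        _ < r := by linarith
    · rw [b.zero_of_le_dist (by rw [dist_zero_right]; exact not_lt.1 hu), zero_mul]
      exact hr
  refine ⟨_, ⟨fun u => ⟨proj (orb k + L.symm (b u • u)), proj_mem (hmem u)⟩, ?_⟩,
    Metric.closedBall 0 (r / 4), isCompact_closedBall _ _, ?_⟩
  · refine contDiff_iff_contDiffAt.2 fun u => ?_
    refine ContDiffAt.comp (g := proj) u (contDiffAt_proj (hmem u)) ?_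
    exact contDiffAt_const.add (L.symm.contDiff.contDiffAt.comp u
      ((b.contDiff.contDiffAt).smul contDiffAt_id))
  · have h1 : Tendsto (fun l : K p q => L (orb l - orb k)) (𝓝 k) (𝓝 0) := by
      have : Continuous fun l : K p q => L (orb l - orb k) :=
        L.continuous.comp (continuous_orb.sub continuous_const)
      simpa using this.tendsto k
    filter_upwards [h1 (Metric.closedBall_mem_nhds 0 (by positivity : 0 < r / 4))] with l hl
    refine ⟨L (orb l - orb k), hl, Subtype.ext ?_⟩
    have hb : b (L (orb l - orb k)) = 1 := b.one_of_mem_closedBall hl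
    change proj _ = orb l
    rw [hb, one_smul, L.symm_apply_apply, add_sub_cancel, proj_eq_self (rz_orb l) (rw'_orb l)]

/-- The orbit is compact, so finitely many of the local parametrizations control the supremum norm
on it. -/
lemma eventually_orbX_lt {α β : ℂ} (f : S p q α β) {ε : ℝ} (hε : 0 < ε) :
    ∀ᶠ g in @nhds _ (smoothTopology p q α β) f, ∀ k : K p q, ‖g.1 (orbX k) - f.1 (orbX k)‖ < ε := by
  have key : ∀ k : K p q, ∃ N ∈ 𝓝 k, ∀ᶠ g in @nhds _ (smoothTopology p q α β) f,
      ∀ l ∈ N, ‖g.1 (orbX l) - f.1 (orbX l)‖ < ε := by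
    intro k
    obtain ⟨d, φ, C, hC, hN⟩ := exists_param_orb k
    refine ⟨_, hN, (eventually_param f φ hC hε).mono fun g hg l => ?_⟩
    rintro ⟨u, hu, hul⟩
    rw [← hul]
    exact hg u hu
  choose N hN hNf using key
  obtain ⟨t, ht⟩ := isCompact_univ.elim_nhds_subcover N fun k _ => hN k
  have := (Filter.eventually_all_finset t).2 fun k _ => hNf k
  refine this.mono fun g hg k => ?_
  obtain ⟨k', hk', hkk'⟩ := Set.mem_iUnion₂.1 (ht.2 (Set.mem_univ k))
  exact hg k' hk' k hkk'

lemma integrable_K {F : K p q → ℂ} (hF : Continuous F) : Integrable F (haarK p q) :=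
  hF.integrable_of_hasCompactSupport (HasCompactSupport.of_compactSpace F)

lemma isClosed_of_eventually {X : Type*} (τ : TopologicalSpace X) {s : Set X}
    (h : ∀ x, x ∉ s → ∀ᶠ y in 𝓝 x, y ∉ s) : IsClosed s :=
  isOpen_compl_iff.1 (isOpen_iff_mem_nhds.2 h)

/-- Integration against a continuous function on the base orbit is continuous. -/
lemma isClosed_orthogonal {α β : ℂ} {u : K p q → ℂ} (hu : Continuous u) :
    IsClosed[smoothTopology p q α β]
      {f : S p q α β | ∫ k, f.1 (orbX k) * u k ∂haarK p q = 0} := by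
  obtain ⟨B, hB⟩ := isCompact_univ.exists_bound_of_continuousOn hu.continuousOn
  have hB' : ∀ k, ‖u k‖ ≤ |B| := fun k => (hB k trivial).trans (le_abs_self B)
  refine isClosed_of_eventually _ fun f hf => ?_
  have hf0 : 0 < ‖∫ k, f.1 (orbX k) * u k ∂haarK p q‖ := norm_pos_iff.2 hf
  set c := ‖∫ k, f.1 (orbX k) * u k ∂haarK p q‖
  refine (eventually_orbX_lt f (ε := c / (|B| + 1)) (by positivity)).mono fun g hg h0 => ?_
  rw [Set.mem_ofPred_eq] at h0
  have h1 : ‖∫ k, (g.1 (orbX k) * u k - f.1 (orbX k) * u k) ∂haarK p q‖ ≤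
      c / (|B| + 1) * |B| := by
    refine (norm_integral_le_of_norm_le_const (C := c / (|B| + 1) * |B|)
      (Eventually.of_forall fun k => ?_)).trans (by simp)
    rw [← sub_mul, norm_mul]
    exact mul_le_mul (hg k).le (hB' k) (norm_nonneg _) (by positivity)
  have hint : ∀ g : S p q α β, Integrable (fun k => g.1 (orbX k) * u k) (haarK p q) := fun g =>
    integrable_K ((continuous_orbX_comp g.2.1).mul hu)
  rw [integral_sub (hint g) (hint f), h0, zero_sub, norm_neg] at h1
  have h2 : c / (|B| + 1) * (|B| + 1) = c := by field_simp
  have h3 : 0 < c / (|B| + 1) := by positivity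
  change c ≤ _ at h1
  nlinarith

end LightCone

end

/-! ### The complexified Lie algebra in coordinates. -/

open scoped Topology ContDiff UniformConvergence ComplexConjugate

noncomputable section

namespace LightCone

open MeasureTheory Filter

variable {p q : ℕ}

/-! ### Coordinates and Wirtinger derivatives -/

/-- The index set of the coordinates. -/
abbrev Idx (p q : ℕ) : Type := Fin p ⊕ Fin q

/-- The coordinates. -/
def crd (a : Idx p q) (v : V p q) : ℂ := Sum.elim v.1 v.2 a

/-- The standard basis. -/
def bas : Idx p q → V p q :=
  Sum.elim (fun i => (Pi.single i 1, 0)) fun j => (0, Pi.single j 1)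

/-- The signs of the Hermitian form. -/
def sg : Idx p q → ℂ := Sum.elim (fun _ => 1) fun _ => -1

lemma sum_crd_bas (v : V p q) : ∑ a, crd a v • bas a = v := by
  rw [Fintype.sum_sum_type]
  refine Prod.ext ?_ ?_ <;> funext i <;>
  simp [crd, bas, Prod.fst_sum, Prod.snd_sum, Pi.single_apply]

lemma form_eq_sum (v w : V p q) : form v w = ∑ a, sg a * crd a v * conj (crd a w) := by
  rw [Fintype.sum_sum_type]
  simp [form, crd, sg, sub_eq_add_neg]

/-- A coordinate as a real linear map. -/
def crdL (a : Idx p q) : V p q →L[ℝ] ℂ :=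
  LinearMap.toContinuousLinearMap
    { toFun := crd a
      map_add' := fun v w => by rcases a with i | j <;> rfl
      map_smul' := fun c v => by rcases a with i | j <;> rfl }

lemma crdL_apply (a : Idx p q) (v : V p q) : crdL a v = crd a v := rfl

/-- The conjugate of a coordinate as a real linear map. -/
def crdbL (a : Idx p q) : V p q →L[ℝ] ℂ := Complex.conjCLE.toContinuousLinearMap.comp (crdL a)

lemma crdbL_apply (a : Idx p q) (v : V p q) : crdbL a v = conj (crd a v) := rfl

lemma crd_smul (a : Idx p q) (c : ℂ) (v : V p q) : crd a (c • v) = c * crd a v := by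
  rcases a with i | j <;> rfl

lemma crd_bas (a b : Idx p q) : crd a (bas b) = if a = b then 1 else 0 := by
  rcases a with i | i <;> rcases b with j | j <;> simp [crd, bas, Pi.single_apply]

/-- The holomorphic Wirtinger derivative. -/
def hd (a : Idx p q) (F : V p q → ℂ) (v : V p q) : ℂ :=
  (fderiv ℝ F v (bas a) - Complex.I * fderiv ℝ F v (Complex.I • bas a)) / 2

/-- The antiholomorphic Wirtinger derivative. -/
def bd (a : Idx p q) (F : V p q → ℂ) (v : V p q) : ℂ :=
  (fderiv ℝ F v (bas a) + Complex.I * fderiv ℝ F v (Complex.I • bas a)) / 2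

lemma fderiv_smul_bas (F : V p q → ℂ) (v : V p q) (a : Idx p q) (c : ℂ) :
    fderiv ℝ F v (c • bas a) = c * hd a F v + conj c * bd a F v := by
  have h : c • bas a = c.re • (bas a : V p q) + c.im • (Complex.I • bas a : V p q) := by
    conv_lhs => rw [← Complex.re_add_im c]
    rw [add_smul, mul_smul]
    rfl
  have hc : conj c = c.re - c.im * Complex.I := by
    apply Complex.ext <;> simp
  rw [h, map_add, map_smul, map_smul, hd, bd, hc, Complex.real_smul, Complex.real_smul]
  conv_rhs => rw [← Complex.re_add_im c]
  simp only [Complex.add_re, Complex.ofReal_re, Complex.mul_re, Complex.I_re, mul_zero,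
    Complex.ofReal_im, Complex.I_im, mul_one, sub_self, add_zero, Complex.add_im, Complex.mul_im,
    zero_add]
  linear_combination ((c.im : ℂ) * fderiv ℝ F v (Complex.I • bas a)) * Complex.I_mul_I

lemma fderiv_eq_sum (F : V p q → ℂ) (v u : V p q) :
    fderiv ℝ F v u = ∑ a, (crd a u * hd a F v + conj (crd a u) * bd a F v) := by
  conv_lhs => rw [← sum_crd_bas u]
  rw [map_sum]
  exact Finset.sum_congr rfl fun a _ => fderiv_smul_bas F v a _

lemma hd_mul (a : Idx p q) {F G : V p q → ℂ} {v : V p q} (hF : DifferentiableAt ℝ F v)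
    (hG : DifferentiableAt ℝ G v) :
    hd a (fun v => F v * G v) v = F v * hd a G v + hd a F v * G v := by
  simp only [hd, fderiv_fun_mul hF hG, _root_.add_apply,
    _root_.smul_apply, smul_eq_mul]
  ring

lemma bd_mul (a : Idx p q) {F G : V p q → ℂ} {v : V p q} (hF : DifferentiableAt ℝ F v)
    (hG : DifferentiableAt ℝ G v) :
    bd a (fun v => F v * G v) v = F v * bd a G v + bd a F v * G v := by
  simp only [bd, fderiv_fun_mul hF hG, _root_.add_apply,
    _root_.smul_apply, smul_eq_mul]
  ring

lemma hd_crdL (a b : Idx p q) (v : V p q) : hd a (crdL b) v = if a = b then 1 else 0 := by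
  simp only [hd, ContinuousLinearMap.fderiv, crdL_apply, crd_smul, crd_bas, eq_comm (a := b)]
  split_ifs <;> norm_num

lemma bd_crdL (a b : Idx p q) (v : V p q) : bd a (crdL b) v = 0 := by
  simp only [bd, ContinuousLinearMap.fderiv, crdL_apply, crd_smul, crd_bas, eq_comm (a := b)]
  split_ifs <;> norm_num

lemma hd_crdbL (a b : Idx p q) (v : V p q) : hd a (crdbL b) v = 0 := by
  simp only [hd, ContinuousLinearMap.fderiv, crdbL_apply, crd_smul, crd_bas, eq_comm (a := b)]
  split_ifs <;> norm_num

lemma bd_crdbL (a b : Idx p q) (v : V p q) : bd a (crdbL b) v = if a = b then 1 else 0 := by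
  simp only [bd, ContinuousLinearMap.fderiv, crdbL_apply, crd_smul, crd_bas, eq_comm (a := b)]
  split_ifs <;> norm_num

/-- The complexified infinitesimal action of the matrix units. -/
def lieE (a b : Idx p q) (F : V p q → ℂ) (v : V p q) : ℂ :=
  sg b * crd b v * hd a F v - sg a * conj (crd a v) * bd b F v

/-- The generator of a reflection is i times the rank-one Hermitian matrix with entries x_a
conj(x_b). Varying x and polarizing recovers each matrix unit operator `lieE` separately. -/
lemma fderiv_vf (F : V p q → ℂ) (x v : V p q) : fderiv ℝ F v (vf x v) =
    ∑ a, ∑ b, Complex.I * (crd a x * conj (crd b x)) * lieE a b F v := by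
  have hs : ∀ a : Idx p q, conj (sg a) = sg a := by rintro (i | j) <;> simp [sg]
  have h1 : fderiv ℝ F v (vf x v) = (∑ a, ∑ b, Complex.I * (crd a x * conj (crd b x)) *
      (sg b * crd b v * hd a F v)) - ∑ b, ∑ a, Complex.I * (crd a x * conj (crd b x)) *
      (sg a * conj (crd a v) * bd b F v) := by
    rw [fderiv_eq_sum, ← Finset.sum_sub_distrib]
    refine Finset.sum_congr rfl fun a _ => ?_
    rw [vf, crd_smul, form_eq_sum]
    simp only [map_mul, map_sum, Complex.conj_I, Complex.conj_conj, hs, Finset.mul_sum,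
      Finset.sum_mul]
    rw [sub_eq_add_neg, ← Finset.sum_neg_distrib]
    congr 1 <;> exact Finset.sum_congr rfl fun b _ => by ring
  rw [h1, Finset.sum_comm (γ := Idx p q) (α := Idx p q) (f := fun b a => Complex.I * (crd a x * conj (crd b x)) *
      (sg a * conj (crd a v) * bd b F v)), ← Finset.sum_sub_distrib]
  refine Finset.sum_congr rfl fun a _ => ?_
  rw [← Finset.sum_sub_distrib]
  exact Finset.sum_congr rfl fun b _ => by rw [lieE]; ring

end LightCone

end

open scoped Topology ContDiff UniformConvergence ComplexConjugate

noncomputable section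

namespace LightCone

set_option linter.unusedSectionVars false

open MeasureTheory Filter

variable {p q : ℕ}

/-! ### Integration by parts on the base orbit -/

section IBP

lemma lieE_mul (a b : Idx p q) {F G : V p q → ℂ} {v : V p q} (hF : DifferentiableAt ℝ F v)
    (hG : DifferentiableAt ℝ G v) :
    lieE a b (fun v => F v * G v) v = F v * lieE a b G v + lieE a b F v * G v := by
  rw [lieE, lieE, lieE, hd_mul a hF hG, bd_mul b hF hG]
  ring

lemma lieE_crdL (a b c : Idx p q) (v : V p q) :
    lieE a b (crdL c) v = if a = c then sg b * crd b v else 0 := by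
  rw [lieE, hd_crdL, bd_crdL]
  split_ifs <;> simp

lemma lieE_crdbL (a b c : Idx p q) (v : V p q) :
    lieE a b (crdbL c) v = if b = c then -(sg a * conj (crd a v)) else 0 := by
  rw [lieE, hd_crdbL, bd_crdbL]
  split_ifs <;> simp

variable [NeZero p] [NeZero q]

/-- Smoothness near the base orbit. -/
def SmoothOnOrb (F : V p q → ℂ) : Prop := ∀ k : K p q, ContDiffAt ℝ ∞ F (orb k)

lemma SmoothOnOrb.mul {F G : V p q → ℂ} (hF : SmoothOnOrb F) (hG : SmoothOnOrb G) :
    SmoothOnOrb fun v => F v * G v := fun k => (hF k).mul (hG k)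

lemma smoothOnOrb_crdL (a : Idx p q) : SmoothOnOrb (crdL a : V p q → ℂ) :=
  fun _ => (crdL a).contDiff.contDiffAt

lemma smoothOnOrb_crdbL (a : Idx p q) : SmoothOnOrb (crdbL a : V p q → ℂ) :=
  fun _ => (crdbL a).contDiff.contDiffAt

lemma SmoothOnOrb.differentiableAt {F : V p q → ℂ} (hF : SmoothOnOrb F) (k : K p q) :
    DifferentiableAt ℝ F (orb k) := (hF k).differentiableAt (by simp)

lemma SmoothOnOrb.continuous {F : V p q → ℂ} (hF : SmoothOnOrb F) :
    Continuous fun k : K p q => F (orb k) :=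
  continuous_iff_continuousAt.2 fun k => (hF k).continuousAt.comp continuous_orb.continuousAt

lemma SmoothOnOrb.continuous_fderiv {F : V p q → ℂ} (hF : SmoothOnOrb F) :
    Continuous fun k : K p q => fderiv ℝ F (orb k) :=
  continuous_iff_continuousAt.2 fun k => ContinuousAt.comp (f := orb)
    ((hF k).fderiv_right (m := ∞) (by simp)).continuousAt continuous_orb.continuousAt

lemma continuous_crd (a : Idx p q) : Continuous fun k : K p q => crd a (orb k) :=
  (smoothOnOrb_crdL a).continuous

lemma SmoothOnOrb.continuous_hd {F : V p q → ℂ} (hF : SmoothOnOrb F) (a : Idx p q) :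
    Continuous fun k : K p q => hd a F (orb k) := by
  have := hF.continuous_fderiv
  unfold hd
  fun_prop

lemma SmoothOnOrb.continuous_bd {F : V p q → ℂ} (hF : SmoothOnOrb F) (a : Idx p q) :
    Continuous fun k : K p q => bd a F (orb k) := by
  have := hF.continuous_fderiv
  unfold bd
  fun_prop

lemma SmoothOnOrb.continuous_lieE {F : V p q → ℂ} (hF : SmoothOnOrb F) (a b : Idx p q) :
    Continuous fun k : K p q => lieE a b F (orb k) := by
  have h1 := hF.continuous_hd a
  have h2 := hF.continuous_bd b
  have h3 := (Complex.continuous_conj.comp (continuous_crd (p := p) (q := q) a))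
  have h4 := continuous_crd (p := p) (q := q) b
  unfold lieE
  exact ((continuous_const.mul h4).mul h1).sub ((continuous_const.mul h3).mul h2)

lemma SmoothOnOrb.continuous_fderiv_vf {F : V p q → ℂ} (hF : SmoothOnOrb F) (x : V p q) :
    Continuous fun k : K p q => fderiv ℝ F (orb k) (vf x (orb k)) :=
  hF.continuous_fderiv.clm_apply ((contDiff_vf x).continuous.comp continuous_orb)

/-- The derivative along a compact reflection integrates to zero. -/
lemma integral_fderiv_vf_of_compact {F : V p q → ℂ} (hF : SmoothOnOrb F) (x : V p q)
    (hx : form x x ≠ 0) (h : x.1 = 0 ∨ x.2 = 0) :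
    ∫ k, fderiv ℝ F (orb k) (vf x (orb k)) ∂haarK p q = 0 := by
  have hr : ∀ t : ℝ, ∃ l : K p q, ∀ k : K p q, (refl x hx t).1 (orb k) = orb (l * k) := by
    intro t
    obtain ⟨l, hl⟩ := exists_kact_eq_refl x hx h t
    exact ⟨l, fun k => by rw [orb_mul, hl]⟩
  choose l hl using hr
  -- The reflection acts on the orbit as a left translation, so the integral does not depend on t;
  -- its derivative at 0 is the claim.
  have hconst : ∀ t : ℝ, ∫ k, F ((refl x hx t).1 (orb k)) ∂haarK p q
      = ∫ k, F (orb k) ∂haarK p q := by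
    intro t
    simp only [hl]
    exact integral_mul_left_eq_self (fun k => F (orb k)) (l t)
  obtain ⟨B, hB⟩ := isCompact_univ.exists_bound_of_continuousOn
    (hF.continuous_fderiv_vf x).continuousOn
  have hd := hasDerivAt_integral_of_dominated_loc_of_deriv_le (μ := haarK p q)
    (F := fun (t : ℝ) k => F ((refl x hx t).1 (orb k)))
    (F' := fun t k => fderiv ℝ F ((refl x hx t).1 (orb k)) (vf x ((refl x hx t).1 (orb k))))
    (x₀ := 0) (s := Set.univ) (bound := fun _ => B) Filter.univ_mem
    (Eventually.of_forall fun t => by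
      simp only [hl]
      exact (hF.continuous.comp (continuous_const.mul continuous_id)).aestronglyMeasurable)
    (by
      simp only [hl]
      exact integrable_K (hF.continuous.comp (continuous_const.mul continuous_id)))
    (by
      simp only [hl]
      exact ((hF.continuous_fderiv_vf x).comp
        (continuous_const.mul continuous_id)).aestronglyMeasurable)
    (Eventually.of_forall fun k t _ => by
      rw [hl]; exact hB _ trivial)
    (integrable_const B)
    (Eventually.of_forall fun k t _ => by
      refine hasDerivAt_refl_comp hx ?_
      rw [hl]; exact hF.differentiableAt _)
  have h2 := hd.2
  simp only [hconst] at h2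
  have h3 := h2.unique (hasDerivAt_const (0 : ℝ) _)
  simpa [refl_zero] using h3

/-- Two coordinates belong to the same component. -/
def SameSide : Idx p q → Idx p q → Prop
  | Sum.inl _, Sum.inl _ => True
  | Sum.inr _, Sum.inr _ => True
  | _, _ => False

lemma integral_lieE_sum {F : V p q → ℂ} (hF : SmoothOnOrb F) (x : V p q) :
    ∫ k, fderiv ℝ F (orb k) (vf x (orb k)) ∂haarK p q =
      ∑ a, ∑ b, Complex.I * (crd a x * conj (crd b x)) * ∫ k, lieE a b F (orb k) ∂haarK p q := by
  simp only [fderiv_vf]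
  rw [integral_finsetSum _ fun a _ => integrable_finsetSum _ fun b _ =>
    (integrable_K (hF.continuous_lieE a b)).const_mul _]
  refine Finset.sum_congr rfl fun a _ => ?_
  rw [integral_finsetSum _ fun b _ => (integrable_K (hF.continuous_lieE a b)).const_mul _]
  exact Finset.sum_congr rfl fun b _ => integral_const_mul _ _

lemma sum_two {n : Type*} [Fintype n] [DecidableEq n] {a b : n} (hab : a ≠ b) (s : ℂ)
    (M : n → n → ℂ) (c : n → ℂ) (hc : ∀ i, c i = if i = a then 1 else if i = b then s else 0) :
    ∑ i, ∑ j, Complex.I * (c i * conj (c j)) * M i j =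
      Complex.I * (M a a + s * conj s * M b b + conj s * M a b + s * M b a) := by
  have h : ∀ f : n → ℂ, (∀ i, i ≠ a → i ≠ b → f i = 0) → ∑ i, f i = f a + f b := by
    intro f hf
    rw [← Finset.sum_pair hab]
    symm
    refine Finset.sum_subset (Finset.subset_univ _) fun i _ hi => ?_
    simp only [Finset.mem_insert, Finset.mem_singleton, not_or] at hi
    exact hf i hi.1 hi.2
  have hca : c a = 1 := by simp [hc]
  have hcb : c b = s := by simp [hc, hab.symm]
  have hc0 : ∀ i, i ≠ a → i ≠ b → c i = 0 := fun i h1 h2 => by simp [hc, h1, h2]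
  rw [h _ fun i h1 h2 => by simp [hc0 i h1 h2], h _ fun i h1 h2 => by simp [hc0 i h1 h2],
    h _ fun i h1 h2 => by simp [hc0 i h1 h2], hca, hcb]
  simp
  ring

/-- Polarization inside one component: basis vectors give the diagonal entries, and e_a + s e_b with
s = 1 and s = i gives M a b + M b a = 0 and M a b = M b a. -/
lemma integral_lieE_same {F : V p q → ℂ} (hF : SmoothOnOrb F) {a b : Idx p q}
    (hab : SameSide a b) : ∫ k, lieE a b F (orb k) ∂haarK p q = 0 := by
  set M : Idx p q → Idx p q → ℂ := fun a b => ∫ k, lieE a b F (orb k) ∂haarK p q with hM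
  have hdiag : ∀ a, M a a = 0 := by
    intro a
    have h1 := integral_fderiv_vf_of_compact hF (bas a)
      (by rcases a with i | i <;> simp [form, bas, Pi.single_apply])
      (by rcases a with i | i <;> simp [bas])
    rw [integral_lieE_sum hF] at h1
    simpa [crd_bas] using h1
  by_cases hne : a = b
  · subst hne; exact hdiag a
  have key : ∀ s : ℂ, form (bas a + s • bas b) (bas a + s • bas b) ≠ 0 →
      conj s * M a b + s * M b a = 0 := by
    intro s hs
    have h1 := integral_fderiv_vf_of_compact hF (bas a + s • bas b) hs
      (by rcases a with i | i <;> rcases b with j | j <;> simp_all [bas, SameSide])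
    rw [integral_lieE_sum hF, sum_two hne s M (fun i => crd i (bas a + s • bas b)) (fun i => by
      have : crd i (bas a + s • bas b) = crd i (bas a) + s * crd i (bas b) := by
        rw [← crd_smul]; exact (crdL i).map_add _ _
      rw [this, crd_bas, crd_bas]
      by_cases h1 : i = a
      · subst h1; simp [hne]
      · simp [h1]), hdiag, hdiag] at h1
    simpa using h1
  have hform : ∀ s : ℂ, form (bas a + s • bas b : V p q) (bas a + s • bas b) =
      sg a * (1 + s * conj s) := by
    intro s
    rw [form_add_left, form_add_right, form_add_right, form_smul_left, form_smul_right,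
      form_smul_left, form_smul_right]
    clear key hdiag
    have hne' := fun h => hne (Eq.symm h)
    rcases a with i | i <;> rcases b with j | j <;> simp_all [form, bas, Pi.single_apply,
      SameSide, sg]
    ring
  have hsg : sg a ≠ 0 := by rcases a with i | i <;> simp [sg]
  have h1 := key 1 (by rw [hform]; simpa using hsg)
  have h2 := key Complex.I (by rw [hform]; simpa using hsg)
  simp only [map_one, one_mul, Complex.conj_I] at h1 h2
  have hI := Complex.I_ne_zero
  have h3 : M b a = M a b := by
    refine mul_left_cancel₀ hI ?_
    linear_combination h2
  rw [h3] at h1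
  linear_combination h1 / 2

lemma sum_fst_orb (k : K p q) :
    ∑ i : Fin p, crd (Sum.inl i) (orb k) * conj (crd (Sum.inl i) (orb k)) = 1 := by
  have := rz_orb k
  simp only [Complex.mul_conj, crd]
  exact_mod_cast this

lemma sum_snd_orb (k : K p q) :
    ∑ j : Fin q, crd (Sum.inr j) (orb k) * conj (crd (Sum.inr j) (orb k)) = 1 := by
  have := rw'_orb k
  simp only [Complex.mul_conj, crd]
  exact_mod_cast this

/-- The homogeneity under dilations of a density, to first order. -/
def IsDensity (F : V p q → ℂ) : Prop := ∀ k : K p q,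
  fderiv ℝ F (orb k) (orb k) = -(2 * (p + q - 1)) * F (orb k) ∧
  fderiv ℝ F (orb k) (Complex.I • orb k) = 0

lemma integral_sum_lieE_same {n : Type} [Fintype n] (G : n → V p q → ℂ) (a b : n → Idx p q)
    (hG : ∀ l, SmoothOnOrb (G l)) (hab : ∀ l, SameSide (a l) (b l)) :
    Integrable (fun k : K p q => ∑ l, lieE (a l) (b l) (G l) (orb k)) (haarK p q) ∧
      ∫ k, ∑ l, lieE (a l) (b l) (G l) (orb k) ∂haarK p q = 0 := by
  have h : ∀ l, Integrable (fun k : K p q => lieE (a l) (b l) (G l) (orb k)) (haarK p q) :=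
    fun l => integrable_K ((hG l).continuous_lieE _ _)
  refine ⟨integrable_finsetSum _ fun l _ => h l, ?_⟩
  rw [integral_finsetSum _ fun l _ => h l]
  exact Finset.sum_eq_zero fun l _ => integral_lieE_same (hG l) (hab l)

-- The direction is noncompact, but the sums of |z_l|² and of |w_l|² are both 1 on the orbit. This
-- allows E F to be rewritten as a combination of compact directions applied to the multiples z_i
-- conj(w_l) F and conj(w_j) z_l F. The terms without derivatives cancel exactly when F has the
-- degree of a density.
set_option maxHeartbeats 800000 in
lemma integral_lieE_inr_inl {F : V p q → ℂ} (hF : SmoothOnOrb F) (hd' : IsDensity F)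
    (i : Fin p) (j : Fin q) :
    ∫ k, lieE (Sum.inr j) (Sum.inl i) F (orb k) ∂haarK p q = 0 := by
  let G1 : Fin q → V p q → ℂ := fun l v => (crdL (Sum.inl i) v * crdbL (Sum.inr l) v) * F v
  let G2 : Fin p → V p q → ℂ := fun l v => (crdbL (Sum.inr j) v * crdL (Sum.inl l) v) * F v
  have hG1 : ∀ l, SmoothOnOrb (G1 l) := fun l =>
    ((smoothOnOrb_crdL _).mul (smoothOnOrb_crdbL _)).mul hF
  have hG2 : ∀ l, SmoothOnOrb (G2 l) := fun l =>
    ((smoothOnOrb_crdbL _).mul (smoothOnOrb_crdL _)).mul hF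
  have hpt : ∀ k : K p q, lieE (Sum.inr j) (Sum.inl i) F (orb k) =
      -(∑ l, lieE (Sum.inr j) (Sum.inr l) (G1 l) (orb k))
      - (∑ l, lieE (Sum.inl l) (Sum.inl i) (G2 l) (orb k))
      + ∑ l, lieE (Sum.inl l) (Sum.inl l) (G1 j) (orb k) := by
    intro k
    set v := orb k with hv
    have hFv : DifferentiableAt ℝ F v := hF.differentiableAt k
    have hLv : ∀ a, DifferentiableAt ℝ (crdL a) v := fun a => (crdL a).differentiableAt
    have hbv : ∀ a, DifferentiableAt ℝ (crdbL a) v := fun a => (crdbL a).differentiableAt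
    have e1 : ∀ a b l, lieE a b (G1 l) v = crd (Sum.inl i) v * conj (crd (Sum.inr l) v) *
        lieE a b F v + (crd (Sum.inl i) v * lieE a b (crdbL (Sum.inr l)) v +
          lieE a b (crdL (Sum.inl i)) v * conj (crd (Sum.inr l) v)) * F v := by
      intro a b l
      rw [lieE_mul (F := fun v => crdL (Sum.inl i) v * crdbL (Sum.inr l) v) a b
        ((hLv _).mul (hbv _)) hFv, lieE_mul a b (hLv _) (hbv _)]
      rfl
    have e2 : ∀ a b l, lieE a b (G2 l) v = conj (crd (Sum.inr j) v) * crd (Sum.inl l) v *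
        lieE a b F v + (conj (crd (Sum.inr j) v) * lieE a b (crdL (Sum.inl l)) v +
          lieE a b (crdbL (Sum.inr j)) v * crd (Sum.inl l) v) * F v := by
      intro a b l
      rw [lieE_mul (F := fun v => crdbL (Sum.inr j) v * crdL (Sum.inl l) v) a b
        ((hbv _).mul (hLv _)) hFv, lieE_mul a b (hbv _) (hLv _)]
      rfl
    have s1 := sum_fst_orb k
    have s2 := sum_snd_orb k
    rw [← hv] at s1 s2
    obtain ⟨d1, d2⟩ := hd' k
    rw [← hv, fderiv_eq_sum] at d1 d2
    simp only [crd_smul, map_mul, Complex.conj_I] at d2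
    rw [Finset.sum_add_distrib] at d1 d2
    simp only [mul_assoc] at d2
    rw [← Finset.mul_sum, ← Finset.mul_sum] at d2
    -- Invariance under phases makes the holomorphic and antiholomorphic Euler terms equal, so each
    -- is half of the real Euler identity.
    have d3 : ∑ a, conj (crd a v) * bd a F v = -(p + q - 1) * F v := by
      have hI := Complex.I_ne_zero
      have : ∑ a, crd a v * hd a F v = ∑ a, conj (crd a v) * bd a F v :=
        mul_left_cancel₀ hI (by linear_combination d2)
      rw [this] at d1
      linear_combination d1 / 2
    rw [Fintype.sum_sum_type] at d3
    simp only [e1, e2, lieE_crdL, lieE_crdbL]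
    simp only [reduceCtorEq, if_false, Sum.inl.injEq, mul_zero, zero_mul,
      add_zero, zero_add, ite_mul, Finset.sum_add_distrib, if_true,
      Finset.sum_ite_eq', Finset.mem_univ, Finset.sum_const, Finset.card_univ,
      Fintype.card_fin, nsmul_eq_mul]
    simp only [lieE, sg, Sum.elim_inl, Sum.elim_inr]
    have t1 : ∑ l, crd (Sum.inl i) v * conj (crd (Sum.inr l) v) * (-1 * crd (Sum.inr l) v *
        hd (Sum.inr j) F v - -1 * conj (crd (Sum.inr j) v) * bd (Sum.inr l) F v) =
        -crd (Sum.inl i) v * hd (Sum.inr j) F v * ∑ l, crd (Sum.inr l) v * conj (crd (Sum.inr l) v)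
        + crd (Sum.inl i) v * conj (crd (Sum.inr j) v) *
          ∑ l, conj (crd (Sum.inr l) v) * bd (Sum.inr l) F v := by
      rw [Finset.mul_sum, Finset.mul_sum, ← Finset.sum_add_distrib]
      exact Finset.sum_congr rfl fun l _ => by ring
    have t2 : ∑ l, conj (crd (Sum.inr j) v) * crd (Sum.inl l) v * (1 * crd (Sum.inl i) v *
        hd (Sum.inl l) F v - 1 * conj (crd (Sum.inl l) v) * bd (Sum.inl i) F v) =
        conj (crd (Sum.inr j) v) * crd (Sum.inl i) v * ∑ l, crd (Sum.inl l) v * hd (Sum.inl l) F v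
        - conj (crd (Sum.inr j) v) * bd (Sum.inl i) F v *
          ∑ l, crd (Sum.inl l) v * conj (crd (Sum.inl l) v) := by
      rw [Finset.mul_sum, Finset.mul_sum, ← Finset.sum_sub_distrib]
      exact Finset.sum_congr rfl fun l _ => by ring
    have t3 : ∑ l, crd (Sum.inl i) v * conj (crd (Sum.inr j) v) * (1 * crd (Sum.inl l) v *
        hd (Sum.inl l) F v - 1 * conj (crd (Sum.inl l) v) * bd (Sum.inl l) F v) =
        crd (Sum.inl i) v * conj (crd (Sum.inr j) v) * ((∑ l, crd (Sum.inl l) v *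
          hd (Sum.inl l) F v) - ∑ l, conj (crd (Sum.inl l) v) * bd (Sum.inl l) F v) := by
      rw [← Finset.sum_sub_distrib, Finset.mul_sum]
      exact Finset.sum_congr rfl fun l _ => by ring
    rw [t1, t2, t3, s1, s2]
    linear_combination (crd (Sum.inl i) v * conj (crd (Sum.inr j) v)) * d3
  obtain ⟨i1, z1⟩ := integral_sum_lieE_same G1 (fun _ => Sum.inr j) Sum.inr hG1 fun _ => trivial
  obtain ⟨i2, z2⟩ := integral_sum_lieE_same G2 Sum.inl (fun _ => Sum.inl i) hG2 fun _ => trivial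
  obtain ⟨i3, z3⟩ := integral_sum_lieE_same (fun _ : Fin p => G1 j) Sum.inl Sum.inl
    (fun _ => hG1 j) fun _ => trivial
  rw [integral_congr_ae (Eventually.of_forall hpt)]
  refine (integral_add (i1.neg.sub i2) i3).trans ?_
  refine (congrArg₂ (· + ·) ((integral_sub i1.neg i2).trans (congrArg₂ (· - ·)
    ((integral_neg _).trans (congrArg Neg.neg z1)) z2)) z3).trans ?_
  simp

lemma fderiv_conj (F : V p q → ℂ) (v u : V p q) :
    fderiv ℝ (fun v => conj (F v)) v u = conj (fderiv ℝ F v u) := by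
  have : (fun v => conj (F v)) = Complex.conjCLE ∘ F := rfl
  rw [this, Complex.conjCLE.comp_fderiv]
  rfl

lemma hd_conj (a : Idx p q) (F : V p q → ℂ) (v : V p q) :
    hd a (fun v => conj (F v)) v = conj (bd a F v) := by
  simp only [hd, bd, fderiv_conj, map_div₀, map_add, map_mul, Complex.conj_I]
  simp [sub_eq_add_neg, map_ofNat (starRingEnd ℂ) 2]

lemma bd_conj (a : Idx p q) (F : V p q → ℂ) (v : V p q) :
    bd a (fun v => conj (F v)) v = conj (hd a F v) := by
  simp only [hd, bd, fderiv_conj, map_div₀, map_sub, map_mul, Complex.conj_I]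
  simp [sub_eq_add_neg, map_ofNat (starRingEnd ℂ) 2]

lemma integral_lieE {F : V p q → ℂ} (hF : SmoothOnOrb F) (hd' : IsDensity F) (a b : Idx p q) :
    ∫ k, lieE a b F (orb k) ∂haarK p q = 0 := by
  rcases a with i | j <;> rcases b with i' | j'
  · exact integral_lieE_same hF trivial
  -- Conjugation preserves densities and exchanges the two kinds of noncompact directions up to
  -- sign.
  · have h1 : SmoothOnOrb fun v => conj (F v) := fun k =>
      Complex.conjCLE.contDiff.contDiffAt.comp _ (hF k)
    have h2 : IsDensity fun v => conj (F v) := fun k => by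
      rw [fderiv_conj, fderiv_conj, (hd' k).1, (hd' k).2]
      simp [map_ofNat (starRingEnd ℂ) 2]
    have h3 := integral_lieE_inr_inl h1 h2 i j'
    have h4 : ∀ v, lieE (Sum.inr j') (Sum.inl i) (fun v => conj (F v)) v =
        -conj (lieE (Sum.inl i) (Sum.inr j') F v) := by
      intro v
      simp only [lieE, hd_conj, bd_conj, sg, Sum.elim_inl, Sum.elim_inr, map_sub, map_mul,
        Complex.conj_conj, map_neg, map_one]
      ring
    simp only [h4] at h3
    rw [integral_neg, integral_conj, neg_eq_zero, map_eq_zero] at h3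
    exact h3
  · exact integral_lieE_inr_inl hF hd' i' j
  · exact integral_lieE_same hF trivial

/-- Integration by parts for densities. -/
lemma integral_fderiv_vf {F : V p q → ℂ} (hF : SmoothOnOrb F) (hd' : IsDensity F) (x : V p q) :
    ∫ k, fderiv ℝ F (orb k) (vf x (orb k)) ∂haarK p q = 0 := by
  rw [integral_lieE_sum hF]
  simp [integral_lieE hF hd']

end IBP

end LightCone

end

/-! ### The invariant pairing of homogeneous functions. -/

open scoped Topology ContDiff UniformConvergence ComplexConjugate

noncomputable section

namespace LightCone

set_option linter.unusedSectionVars false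

open MeasureTheory Filter

variable {p q : ℕ}

/-! ### Products and conjugates of homogeneous functions -/

section Algebra

lemma norm_units_pos (t : ℂˣ) : 0 < ‖(t : ℂ)‖ := norm_pos_iff.2 t.ne_zero

lemma psi_mul_psi (α β α' β' : ℂ) (t : ℂˣ) :
    psi α β t * psi α' β' t = psi (α + α') (β + β') t := by
  have h1 : (‖(t : ℂ)‖ : ℂ) ≠ 0 := by exact_mod_cast (norm_units_pos t).ne'
  have h2 : (t : ℂ) / (‖(t : ℂ)‖ : ℂ) ≠ 0 := div_ne_zero t.ne_zero h1
  rw [psi, psi, psi, add_add_add_comm α α' β β', add_sub_add_comm, Complex.cpow_add (α + β) _ h1,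
    Complex.cpow_add _ _ h2]
  ring

lemma psi_eq {α β : ℂ} {n : ℤ} (hn : α - β = n) (t : ℂˣ) : psi α β t =
    Complex.exp ((α + β) * (Real.log ‖(t : ℂ)‖ : ℂ)) * ((t : ℂ) / (‖(t : ℂ)‖ : ℂ)) ^ n := by
  have h1 : (‖(t : ℂ)‖ : ℂ) ≠ 0 := by exact_mod_cast (norm_units_pos t).ne'
  rw [psi, hn, Complex.cpow_intCast, Complex.cpow_def_of_ne_zero h1,
    Complex.ofReal_log (norm_nonneg _), mul_comm (α + β)]

lemma psi_conj {α β : ℂ} {n : ℤ} (hn : α - β = n) (t : ℂˣ) :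
    conj (psi α β t) = psi (conj β) (conj α) t := by
  have hn' : conj β - conj α = ((-n : ℤ) : ℂ) := by
    rw [← map_sub, ← neg_sub α β, hn]; simp
  have h1 : (‖(t : ℂ)‖ : ℂ) ≠ 0 := by exact_mod_cast (norm_units_pos t).ne'
  rw [psi_eq hn, psi_eq hn', map_mul, ← Complex.exp_conj, map_zpow₀, zpow_neg, ← inv_zpow]
  congr 2
  · simp [add_comm]
  · rw [map_div₀, Complex.conj_ofReal, inv_div, div_eq_div_iff h1 t.ne_zero, mul_comm,
      Complex.mul_conj, Complex.normSq_eq_norm_sq]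
    push_cast
    ring

lemma psi_exp_I {α β : ℂ} {n : ℤ} (hn : α - β = n) (θ : ℝ) (t : ℂˣ)
    (ht : (t : ℂ) = Complex.exp (θ * Complex.I)) : psi α β t = Complex.exp (θ * Complex.I) ^ n := by
  rw [psi_eq hn, ht, Complex.norm_exp_ofReal_mul_I]
  simp

lemma IsSmooth.mul {f g : X0 p q → ℂ} (hf : IsSmooth f) (hg : IsSmooth g) :
    IsSmooth fun x => f x * g x := by
  intro x
  obtain ⟨O, F, hO, hx, hF, hfF⟩ := hf x
  obtain ⟨O', G, hO', hx', hG, hgG⟩ := hg x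
  exact ⟨O ∩ O', fun v => F v * G v, hO.inter hO', ⟨hx, hx'⟩,
    (hF.mono Set.inter_subset_left).mul (hG.mono Set.inter_subset_right), fun y hy =>
      congrArg₂ (· * ·) (hfF y hy.1) (hgG y hy.2)⟩

lemma IsSmooth.conj {f : X0 p q → ℂ} (hf : IsSmooth f) : IsSmooth fun x => conj (f x) := by
  intro x
  obtain ⟨O, F, hO, hx, hF, hfF⟩ := hf x
  exact ⟨O, fun v => (starRingEnd ℂ) (F v), hO, hx,
    Complex.conjCLE.contDiff.comp_contDiffOn hF, fun y hy =>
      congrArg (starRingEnd ℂ) (hfF y hy)⟩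

lemma mul_mem_S {α β α' β' : ℂ} {f g : X0 p q → ℂ} (hf : f ∈ S p q α β) (hg : g ∈ S p q α' β') :
    (fun x => f x * g x) ∈ S p q (α + α') (β + β') := by
  refine ⟨hf.1.mul hg.1, fun t x => ?_⟩
  simp only [hf.2, hg.2, ← psi_mul_psi]
  ring

lemma conj_mem_S {α β : ℂ} {n : ℤ} (hn : α - β = n) {f : X0 p q → ℂ} (hf : f ∈ S p q α β) :
    (fun x => conj (f x)) ∈ S p q (conj β) (conj α) := by
  refine ⟨hf.1.conj, fun t x => ?_⟩
  simp only [hf.2, map_mul, psi_conj hn]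

lemma lieFun_mul {α β α' β' : ℂ} {f g : X0 p q → ℂ} (hf : f ∈ S p q α β) (hg : g ∈ S p q α' β')
    {x : V p q} (hx : form x x ≠ 0) (η : X0 p q) :
    lieFun (α + α') (β + β') x (fun x => f x * g x) η =
      lieFun α β x f η * g η + f η * lieFun α' β' x g η := by
  refine lieFun_eq (f' := fun η => lieFun α β x f η * g η + f η * lieFun α' β' x g η)
    (mul_mem_S hf hg) hx ?_
  have := (hasDerivAt_act hf hx η 0).mul (hasDerivAt_act hg hx η 0)
  rw [refl_zero, act_one] at this
  exact this

lemma lieFun_conj {α β : ℂ} {n : ℤ} (hn : α - β = n) {f : X0 p q → ℂ} (hf : f ∈ S p q α β)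
    {x : V p q} (hx : form x x ≠ 0) (η : X0 p q) :
    lieFun (conj β) (conj α) x (fun x => conj (f x)) η = conj (lieFun α β x f η) := by
  refine lieFun_eq (f' := fun η => conj (lieFun α β x f η)) (conj_mem_S hn hf) hx ?_
  have := Complex.conjCLE.toContinuousLinearMap.hasFDerivAt.comp_hasDerivAt (0 : ℝ)
    (hasDerivAt_act hf hx η 0)
  rw [refl_zero, act_one] at this
  exact this

variable [NeZero p] [NeZero q]

lemma smoothOnOrb_ext {α β : ℂ} {f : X0 p q → ℂ} (hf : f ∈ S p q α β) :
    SmoothOnOrb (ext α β f : V p q → ℂ) := fun k => contDiffAt_ext hf.1 (orb_mem_Opn k)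

/-- Differentiate the homogeneity relation at t = 0 along the scalar curves exp(t) and exp(it),
which stay on the cone. -/
lemma isDensity_ext {α : ℂ} (hα : α = -(p + q - 1)) {f : X0 p q → ℂ} (hf : f ∈ S p q α α) :
    IsDensity (ext α α f : V p q → ℂ) := by
  intro k
  -- The zero branch is never reached, since c has no zeros; it appears only because `psi` takes a
  -- unit as argument.
  have hext : ∀ c : ℝ → ℂ, ∀ c' : ℂ, ∀ m : ℂ, c 0 = 1 → HasDerivAt c c' 0 → (∀ t, c t ≠ 0) →
      HasDerivAt (fun t => if h : c t = 0 then 0 else psi α α (Units.mk0 (c t) h)) m 0 →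
      fderiv ℝ (ext α α f) (orb k) (c' • orb k) = m * ext α α f (orb k) := by
    intro c c' m h0 hc hc0 hm
    have h1 : HasDerivAt (fun t => c t • orb k) (c' • orb k) 0 := hc.smul_const (orb k)
    have h2 : HasFDerivAt (ext α α f) (fderiv ℝ (ext α α f) (orb k)) (c 0 • orb k) := by
      rw [h0, one_smul]; exact ((smoothOnOrb_ext hf).differentiableAt k).hasFDerivAt
    have h3 := h2.comp_hasDerivAt (0 : ℝ) h1
    refine h3.unique ((hm.mul_const (ext α α f (orb k))).congr_of_eventuallyEq
      (Eventually.of_forall fun t => ?_))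
    have h4 := ext_coe hf (dilate (Units.mk0 (c t) (hc0 t)) (orbX k))
    rw [hf.2, ← ext_coe hf (orbX k)] at h4
    change ext α α f (c t • orb k) = _
    simp only [dif_neg (hc0 t)]
    exact h4
  have hn : α - α = ((0 : ℤ) : ℂ) := by simp
  constructor
  · have hc : HasDerivAt (fun t : ℝ => Complex.exp t) 1 0 := by
      simpa using (Complex.ofRealCLM.hasDerivAt (x := 0)).cexp
    have hm : HasDerivAt (fun t : ℝ => Complex.exp ((α + α) * t)) (α + α) 0 := by
      simpa using ((Complex.ofRealCLM.hasDerivAt (x := 0)).const_mul (α + α)).cexp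
    have := hext _ 1 (α + α) (by simp) hc (fun t => Complex.exp_ne_zero _)
      (hm.congr_of_eventuallyEq (Eventually.of_forall fun t => by
        dsimp only
        rw [dif_neg (Complex.exp_ne_zero _), psi_eq hn]
        simp [Complex.norm_exp]))
    rw [one_smul] at this
    rw [this, hα]
    ring
  · have hc : HasDerivAt (fun t : ℝ => Complex.exp (t * Complex.I)) Complex.I 0 := by
      simpa using ((Complex.ofRealCLM.hasDerivAt (x := 0)).mul_const Complex.I).cexp
    have := hext _ Complex.I 0 (by simp) hc (fun t => Complex.exp_ne_zero _)
      ((hasDerivAt_const (0 : ℝ) (1 : ℂ)).congr_of_eventuallyEq (Eventually.of_forall fun t => by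
        dsimp only
        rw [dif_neg (Complex.exp_ne_zero _), psi_exp_I hn t _ rfl]
        simp))
    rw [this, zero_mul]

lemma integral_lieFun {α β : ℂ} (hα : α = -(p + q - 1)) (hβ : β = -(p + q - 1)) {f : X0 p q → ℂ}
    (hf : f ∈ S p q α β) (x : V p q) :
    ∫ k, lieFun α β x f (orbX k) ∂haarK p q = 0 := by
  obtain rfl : β = α := by rw [hα, hβ]
  exact integral_fderiv_vf (smoothOnOrb_ext hf) (isDensity_ext hα hf) x

/-- The invariant pairing turns Lie derivatives into their negatives. -/
lemma integral_lieFun_mul {α β α' β' : ℂ} (hα : α + α' = -(p + q - 1))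
    (hβ : β + β' = -(p + q - 1)) {f g : X0 p q → ℂ} (hf : f ∈ S p q α β) (hg : g ∈ S p q α' β')
    {x : V p q} (hx : form x x ≠ 0) :
    ∫ k, lieFun α β x f (orbX k) * g (orbX k) ∂haarK p q =
      -∫ k, f (orbX k) * lieFun α' β' x g (orbX k) ∂haarK p q := by
  have h := integral_lieFun hα hβ (mul_mem_S hf hg) x
  simp only [lieFun_mul hf hg hx] at h
  exact eq_neg_of_add_eq_zero_left ((integral_add (integrable_K ((continuous_orbX_comp
    (lieFun_mem hf hx).1).mul (continuous_orbX_comp hg.1))) (integrable_K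
    ((continuous_orbX_comp hf.1).mul (continuous_orbX_comp (lieFun_mem hg hx).1)))).symm.trans h)

end Algebra

end LightCone

end

/-! ### Polynomials times powers of |z|², and their membership in Lie stable subspaces. -/

open scoped Topology ContDiff UniformConvergence ComplexConjugate

noncomputable section

namespace LightCone

set_option linter.unusedSectionVars false

open MeasureTheory Filter

variable {p q : ℕ}

/-! ### Functions of polynomial type -/

section Polynomials

/-- Polynomials in the coordinates and their conjugates. -/
abbrev Ply (p q : ℕ) : Type := MvPolynomial (Idx p q ⊕ Idx p q) ℂ

/-- A coordinate as a polynomial. -/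
def cX (a : Idx p q) : Ply p q := MvPolynomial.X (Sum.inl a)

/-- The conjugate of a coordinate as a polynomial. -/
def cY (a : Idx p q) : Ply p q := MvPolynomial.X (Sum.inr a)

/-- The formal derivative with respect to a coordinate. -/
def dX (a : Idx p q) : Derivation ℂ (Ply p q) (Ply p q) := MvPolynomial.pderiv (Sum.inl a)

/-- The formal derivative with respect to the conjugate of a coordinate. -/
def dY (a : Idx p q) : Derivation ℂ (Ply p q) (Ply p q) := MvPolynomial.pderiv (Sum.inr a)

/-- Evaluation of a polynomial in the coordinates and their conjugates. -/
def ev (v : V p q) : Ply p q →ₐ[ℂ] ℂ :=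
  MvPolynomial.aeval (Sum.elim (fun a => crd a v) fun a => conj (crd a v))

lemma ev_cX (v : V p q) (a : Idx p q) : ev v (cX a) = crd a v := by simp [ev, cX]

lemma ev_cY (v : V p q) (a : Idx p q) : ev v (cY a) = conj (crd a v) := by simp [ev, cY]

lemma dX_cX (a b : Idx p q) : dX a (cX b) = if a = b then 1 else 0 := by
  rw [dX, cX, MvPolynomial.pderiv_X, Pi.single_apply]
  simp [eq_comm]

lemma dX_cY (a b : Idx p q) : dX a (cY b) = 0 := by
  rw [dX, cY, MvPolynomial.pderiv_X, Pi.single_apply]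
  simp

lemma dY_cX (a b : Idx p q) : dY a (cX b) = 0 := by
  rw [dY, cX, MvPolynomial.pderiv_X, Pi.single_apply]
  simp

lemma dY_cY (a b : Idx p q) : dY a (cY b) = if a = b then 1 else 0 := by
  rw [dY, cY, MvPolynomial.pderiv_X, Pi.single_apply]
  simp [eq_comm]

lemma contDiff_ev (P : Ply p q) : ContDiff ℝ ∞ fun v : V p q => ev v P := by
  induction P using MvPolynomial.induction_on with
  | C c => simpa [ev] using contDiff_const
  | add P Q hP hQ => simpa using hP.add hQ
  | mul_X P a hP =>
    rcases a with a | a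
    · rw [← cX]
      simp only [map_mul, ev_cX]
      exact hP.mul (crdL a).contDiff
    · rw [← cY]
      simp only [map_mul, ev_cY]
      exact hP.mul (crdbL a).contDiff

lemma differentiable_ev (P : Ply p q) (v : V p q) : DifferentiableAt ℝ (fun v => ev v P) v :=
  (contDiff_ev P).contDiffAt.differentiableAt (by simp)

lemma hd_const (a : Idx p q) (c : ℂ) (v : V p q) : hd a (fun _ => c) v = 0 := by simp [hd]

lemma bd_const (a : Idx p q) (c : ℂ) (v : V p q) : bd a (fun _ => c) v = 0 := by simp [bd]

lemma hd_add (a : Idx p q) {F G : V p q → ℂ} {v : V p q} (hF : DifferentiableAt ℝ F v)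
    (hG : DifferentiableAt ℝ G v) : hd a (fun v => F v + G v) v = hd a F v + hd a G v := by
  simp only [hd, fderiv_fun_add hF hG, _root_.add_apply]
  ring

lemma bd_add (a : Idx p q) {F G : V p q → ℂ} {v : V p q} (hF : DifferentiableAt ℝ F v)
    (hG : DifferentiableAt ℝ G v) : bd a (fun v => F v + G v) v = bd a F v + bd a G v := by
  simp only [bd, fderiv_fun_add hF hG, _root_.add_apply]
  ring

lemma hd_bd_ev (a : Idx p q) (P : Ply p q) (v : V p q) :
    hd a (fun v => ev v P) v = ev v (dX a P) ∧ bd a (fun v => ev v P) v = ev v (dY a P) := by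
  induction P using MvPolynomial.induction_on with
  | C c =>
    have h : (fun v : V p q => ev v (MvPolynomial.C c)) = fun _ => c := by
      funext v; simp [ev]
    rw [h, hd_const, bd_const]
    simp [dX, dY]
  | add P Q hP hQ =>
    simp only [map_add]
    rw [hd_add a (differentiable_ev P v) (differentiable_ev Q v),
      bd_add a (differentiable_ev P v) (differentiable_ev Q v), hP.1, hP.2, hQ.1, hQ.2]
    exact ⟨rfl, rfl⟩
  | mul_X P b hP =>
    simp only [map_mul]
    rcases b with b | b
    · rw [← cX]
      have h : (fun v : V p q => ev v P * ev v (cX b)) = fun v => ev v P * crdL b v := by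
        funext v; rw [ev_cX, crdL_apply]
      rw [h, hd_mul a (differentiable_ev P v) (crdL b).differentiableAt,
        bd_mul a (differentiable_ev P v) (crdL b).differentiableAt, hP.1, hP.2, hd_crdL, bd_crdL,
        Derivation.leibniz, Derivation.leibniz, dX_cX, dY_cX]
      simp only [smul_eq_mul, map_add, map_mul, ev_cX, crdL_apply]
      constructor
      · split_ifs <;> simp <;> ring
      · simp; ring
    · rw [← cY]
      have h : (fun v : V p q => ev v P * ev v (cY b)) = fun v => ev v P * crdbL b v := by
        funext v; rw [ev_cY, crdbL_apply]
      rw [h, hd_mul a (differentiable_ev P v) (crdbL b).differentiableAt,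
        bd_mul a (differentiable_ev P v) (crdbL b).differentiableAt, hP.1, hP.2, hd_crdbL, bd_crdbL,
        Derivation.leibniz, Derivation.leibniz, dX_cY, dY_cY]
      simp only [smul_eq_mul, map_add, map_mul, ev_cY, crdbL_apply]
      constructor
      · simp; ring
      · split_ifs <;> simp <;> ring

/-- The formal counterpart of `lieE`. -/
def fE (a b : Idx p q) : Derivation ℂ (Ply p q) (Ply p q) :=
  (sg b • cX b) • dX a - (sg a • cY a) • dY b

lemma fE_apply (a b : Idx p q) (P : Ply p q) :
    fE a b P = sg b • (cX b * dX a P) - sg a • (cY a * dY b P) := by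
  simp [fE]

lemma lieE_ev (a b : Idx p q) (P : Ply p q) (v : V p q) :
    lieE a b (fun v => ev v P) v = ev v (fE a b P) := by
  rw [lieE, (hd_bd_ev a P v).1, (hd_bd_ev b P v).2, fE_apply, map_sub, map_smul, map_smul, map_mul,
    map_mul, ev_cX, ev_cY, smul_eq_mul, smul_eq_mul]
  ring

/-- The squared norm of the first component as a polynomial. -/
def rhoZ (p q : ℕ) : Ply p q := ∑ i : Fin p, cX (Sum.inl i) * cY (Sum.inl i)

/-- The squared norm of the second component as a polynomial. -/
def rhoW (p q : ℕ) : Ply p q := ∑ j : Fin q, cX (Sum.inr j) * cY (Sum.inr j)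

lemma ev_rhoZ (v : V p q) : ev v (rhoZ p q) = (rz v : ℂ) := by
  simp [rhoZ, ev_cX, ev_cY, crd, rz, Complex.mul_conj]

lemma ev_rhoW (v : V p q) : ev v (rhoW p q) = (rw' v : ℂ) := by
  simp [rhoW, ev_cX, ev_cY, crd, rw', Complex.mul_conj]

lemma hasFDerivAt_pw (s : ℂ) {v : V p q} (hv : 0 < rz v) :
    HasFDerivAt (pw s) ((s * pw (s - 1) v) • fderiv ℝ (fun v => ev v (rhoZ p q)) v) v := by
  have h0 : HasFDerivAt (rz : V p q → ℝ) (fderiv ℝ rz v) v :=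
    (contDiff_rz.contDiffAt.differentiableAt (by simp)).hasFDerivAt
  have h1 := Complex.ofRealCLM.hasFDerivAt.comp v (h0.log hv.ne')
  have h2 := (h1.const_mul s).cexp
  have h3 : fderiv ℝ (fun v => ev v (rhoZ p q)) v = Complex.ofRealCLM.comp (fderiv ℝ rz v) := by
    simp only [ev_rhoZ]
    exact (Complex.ofRealCLM.hasFDerivAt.comp v h0).fderiv
  rw [h3]
  refine h2.congr_fderiv ?_
  refine ContinuousLinearMap.ext fun u => ?_
  have h4 : pw s v = pw (s - 1) v * (rz v : ℂ) := by
    rw [← pw_one hv, ← pw_add, sub_add_cancel]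
  have h5 : (rz v : ℂ) ≠ 0 := by exact_mod_cast hv.ne'
  change pw s v * (s * ((((rz v)⁻¹ * fderiv ℝ rz v u : ℝ)) : ℂ)) =
    s * pw (s - 1) v * ((fderiv ℝ rz v u : ℝ) : ℂ)
  rw [h4]
  push_cast
  field_simp

lemma lieE_pw (a b : Idx p q) (s : ℂ) {v : V p q} (hv : 0 < rz v) :
    lieE a b (pw s) v = s * pw (s - 1) v * ev v (fE a b (rhoZ p q)) := by
  rw [← lieE_ev]
  simp only [lieE, hd, bd, (hasFDerivAt_pw s hv).fderiv, _root_.smul_apply, smul_eq_mul]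
  ring

/-- Factoring out the power s - 1 keeps the result of the form polynomial times power, so the Lie
algebra acts on pairs (P, s) by polynomial formulas. -/
lemma lieE_ev_pw (a b : Idx p q) (P : Ply p q) (s : ℂ) {v : V p q} (hv : 0 < rz v) :
    lieE a b (fun v => ev v P * pw s v) v =
      ev v (rhoZ p q * fE a b P + s • (P * fE a b (rhoZ p q))) * pw (s - 1) v := by
  have h4 : pw s v = (rz v : ℂ) * pw (s - 1) v := by
    rw [← pw_one hv, ← pw_add]; ring_nf
  rw [lieE_mul a b (differentiable_ev P v) ((contDiffAt_pw s hv).differentiableAt (by simp)),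
    lieE_pw a b s hv, lieE_ev, h4, map_add, map_smul, map_mul, map_mul, ev_rhoZ, smul_eq_mul]
  ring

end Polynomials

/-! ### Membership of functions of polynomial type in submodules -/

section Membership

variable {α β : ℂ}

/-- The function of polynomial type given by `P` and `s` belongs to `L`. -/
def InL (L : Submodule ℂ (S p q α β)) (P : Ply p q) (s : ℂ) : Prop :=
  ∃ f ∈ L, ∀ η : X0 p q, f.1 η = ev η.1 P * pw s η.1

variable {L : Submodule ℂ (S p q α β)} {P Q : Ply p q} {s : ℂ}

lemma InL.add (hP : InL L P s) (hQ : InL L Q s) : InL L (P + Q) s := by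
  obtain ⟨f, hf, hf'⟩ := hP
  obtain ⟨g, hg, hg'⟩ := hQ
  refine ⟨f + g, L.add_mem hf hg, fun η => ?_⟩
  change f.1 η + g.1 η = _
  rw [hf', hg', map_add, add_mul]

lemma InL.smul (c : ℂ) (hP : InL L P s) : InL L (c • P) s := by
  obtain ⟨f, hf, hf'⟩ := hP
  refine ⟨c • f, L.smul_mem c hf, fun η => ?_⟩
  change c * f.1 η = _
  rw [hf', map_smul, smul_eq_mul, mul_assoc]

lemma InL.zero : InL L 0 s := ⟨0, L.zero_mem, fun η => by simp⟩

lemma InL.sub (hP : InL L P s) (hQ : InL L Q s) : InL L (P - Q) s := by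
  have := hP.add (hQ.smul (-1))
  rwa [neg_one_smul, ← sub_eq_add_neg] at this

lemma InL.sum {n : Type*} (t : Finset n) {P : n → Ply p q} (h : ∀ i ∈ t, InL L (P i) s) :
    InL L (∑ i ∈ t, P i) s :=
  Finset.sum_induction _ (fun P => InL L P s) (fun _ _ => InL.add) InL.zero h

lemma InL.of_smul {c : ℂ} (hc : c ≠ 0) (hP : InL L (c • P) s) : InL L P s := by
  have := hP.smul c⁻¹
  rwa [smul_smul, inv_mul_cancel₀ hc, one_smul] at this

lemma InL.congr {t : ℂ} (hP : InL L P s)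
    (h : ∀ η : X0 p q, ev η.1 P * pw s η.1 = ev η.1 Q * pw t η.1) : InL L Q t := by
  obtain ⟨f, hf, hf'⟩ := hP
  exact ⟨f, hf, fun η => (hf' η).trans (h η)⟩

lemma inL_rhoZ_iff : InL L (rhoZ p q * P) (s - 1) ↔ InL L P s := by
  have h : ∀ η : X0 p q, ev η.1 (rhoZ p q * P) * pw (s - 1) η.1 = ev η.1 P * pw s η.1 := by
    intro η
    have h4 : pw s η.1 = (rz η.1 : ℂ) * pw (s - 1) η.1 := by
      rw [← pw_one (rz_pos η), ← pw_add]; ring_nf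
    rw [map_mul, ev_rhoZ, h4]
    ring
  exact ⟨fun hP => hP.congr h, fun hP => hP.congr fun η => (h η).symm⟩

/-- The polynomials `rhoZ` and `rhoW` differ but agree on the cone, so either may be traded for one
unit of the exponent. -/
lemma inL_rhoW_iff : InL L (rhoW p q * P) (s - 1) ↔ InL L P s := by
  rw [← inL_rhoZ_iff (P := P) (s := s)]
  have h : ∀ η : X0 p q, ev η.1 (rhoW p q * P) * pw (s - 1) η.1 =
      ev η.1 (rhoZ p q * P) * pw (s - 1) η.1 := by
    intro η
    rw [map_mul, map_mul, ev_rhoW, ev_rhoZ, rz_eq_rw']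
  exact ⟨fun hP => hP.congr h, fun hP => hP.congr fun η => (h η).symm⟩

lemma lieFun_eq_of_eq {f : X0 p q → ℂ} (hf : f ∈ S p q α β) {F : V p q → ℂ}
    (hF : ∀ η : X0 p q, DifferentiableAt ℝ F η.1) (h : ∀ η : X0 p q, f η = F η.1) {x : V p q}
    (hx : form x x ≠ 0) (η : X0 p q) : lieFun α β x f η = fderiv ℝ F η.1 (vf x η.1) := by
  refine lieFun_eq (f' := fun η => fderiv ℝ F η.1 (vf x η.1)) hf hx ?_
  simp only [h]
  have h1 := hasDerivAt_refl_comp (F := F) hx (v := η.1) (t := 0)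
    (by rw [refl_zero]; exact hF η)
  rw [refl_zero] at h1
  exact h1

/-- A Lie stable submodule is stable under the complexified Lie algebra. -/
lemma LieStable.exists_lieE (hL : LieStable L) {f : S p q α β} (hf : f ∈ L) {F : V p q → ℂ}
    (hF : ∀ η : X0 p q, DifferentiableAt ℝ F η.1) (h : ∀ η : X0 p q, f.1 η = F η.1)
    (a b : Idx p q) : ∃ g ∈ L, ∀ η : X0 p q, g.1 η = lieE a b F η.1 := by
  let A : Submodule ℂ (X0 p q → ℂ) := L.map (S p q α β).subtype
  suffices hA : (fun η : X0 p q => lieE a b F η.1) ∈ A by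
    obtain ⟨g, hg, hg'⟩ := hA
    exact ⟨g, hg, fun η => congrFun hg' η⟩
  let M : Idx p q → Idx p q → X0 p q → ℂ := fun a b η => lieE a b F η.1
  have key : ∀ x : V p q, form x x ≠ 0 →
      (fun η : X0 p q => fderiv ℝ F η.1 (vf x η.1)) ∈ A := fun x hx =>
    ⟨_, hL x hx f hf, funext fun η => lieFun_eq_of_eq f.2 hF h hx η⟩
  have hdiag : ∀ a, M a a ∈ A := by
    intro a
    have h1 := key (bas a) (by rcases a with i | i <;> simp [form, bas, Pi.single_apply])
    have h2 : (fun η : X0 p q => fderiv ℝ F η.1 (vf (bas a) η.1)) = Complex.I • M a a := by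
      funext η
      rw [fderiv_vf]
      simp [crd_bas, M]
    rw [h2] at h1
    exact (A.smul_mem_iff Complex.I_ne_zero).1 h1
  by_cases hab : a = b
  · subst hab; exact hdiag a
  -- The modulus of s is 2 so that e_a + s e_b has norm ±1 ± 4, nonzero for every choice of signs,
  -- compact or not.
  have key2 : ∀ s : ℂ, s * conj s = 4 → conj s • M a b + s • M b a ∈ A := by
    intro s hs
    have hne' := fun h => hab (Eq.symm h)
    have hf : form (bas a + s • bas b : V p q) (bas a + s • bas b) ≠ 0 := by
      have : form (bas a + s • bas b : V p q) (bas a + s • bas b) = sg a + sg b * (s * conj s) := by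
        rw [form_add_left, form_add_right, form_add_right, form_smul_left, form_smul_right,
          form_smul_left, form_smul_right]
        rcases a with i | i <;> rcases b with j | j <;> simp_all [form, bas, Pi.single_apply, sg]
      rw [this, hs]
      rcases a with i | i <;> rcases b with j | j <;> simp [sg] <;> norm_num
    have h1 := key _ hf
    have h2 : (fun η : X0 p q => fderiv ℝ F η.1 (vf (bas a + s • bas b) η.1)) =
        Complex.I • (M a a + (s * conj s) • M b b + (conj s • M a b + s • M b a)) := by
      funext η
      rw [fderiv_vf, sum_two hab s (fun a b => lieE a b F η.1)
        (fun i => crd i (bas a + s • bas b)) (fun i => by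
        have : crd i (bas a + s • bas b) = crd i (bas a) + s * crd i (bas b) := by
          rw [← crd_smul]; exact (crdL i).map_add _ _
        rw [this, crd_bas, crd_bas]
        by_cases h1 : i = a
        · subst h1; simp [hab]
        · simp [h1])]
      simp only [M, Pi.smul_apply, Pi.add_apply, smul_eq_mul]
      ring
    rw [h2] at h1
    have h3 := (A.smul_mem_iff Complex.I_ne_zero).1 h1
    exact (Submodule.add_mem_iff_right A (A.add_mem (hdiag a) (A.smul_mem _ (hdiag b)))).1 h3
  have e1 := key2 2 (by rw [map_ofNat]; norm_num)
  have e2 := key2 (2 * Complex.I) (by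
    rw [map_mul, map_ofNat, Complex.conj_I]; linear_combination -4 * Complex.I_mul_I)
  -- The values s = 2 and s = 2i give two independent combinations; this solves them for one entry.
  have e3 : M a b = (1 / 4 : ℂ) • (conj (2 : ℂ) • M a b + (2 : ℂ) • M b a) +
      (Complex.I / 4) • (conj (2 * Complex.I) • M a b + (2 * Complex.I) • M b a) := by
    funext η
    simp only [Pi.smul_apply, Pi.add_apply, smul_eq_mul, map_mul, map_ofNat, Complex.conj_I]
    linear_combination (-(M b a η) / 2 + (M a b η) / 2) * Complex.I_mul_I
  change M a b ∈ A
  rw [e3]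
  exact A.add_mem (A.smul_mem _ e1) (A.smul_mem _ e2)

lemma InL.lie (hL : LieStable L) (hP : InL L P s) (a b : Idx p q) :
    InL L (rhoZ p q * fE a b P + s • (P * fE a b (rhoZ p q))) (s - 1) := by
  obtain ⟨f, hf, hf'⟩ := hP
  obtain ⟨g, hg, hg'⟩ := hL.exists_lieE hf (F := fun v => ev v P * pw s v)
    (fun η => (differentiable_ev P _).mul ((contDiffAt_pw s (rz_pos η)).differentiableAt (by simp)))
    hf' a b
  exact ⟨g, hg, fun η => (hg' η).trans (lieE_ev_pw a b P s (rz_pos η))⟩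

end Membership

end LightCone

end

/-! ### Bidegrees, and the passage to higher bidegree for nonintegral exponents. -/

open scoped Topology ContDiff UniformConvergence ComplexConjugate

noncomputable section

namespace LightCone

set_option linter.unusedSectionVars false

open MeasureTheory Filter

variable {p q : ℕ}

/-! ### Bihomogeneous polynomials -/

section Bidegree

/-- Exponents of monomials. -/
abbrev Expo (p q : ℕ) : Type := (Idx p q ⊕ Idx p q) →₀ ℕ

/-- A monomial. -/
def mo (d : Expo p q) : Ply p q := MvPolynomial.monomial d 1

/-- The degree in the coordinates. -/
def degX (d : Expo p q) : ℕ := ∑ a, d (Sum.inl a)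

/-- The degree in the conjugates of the coordinates. -/
def degY (d : Expo p q) : ℕ := ∑ a, d (Sum.inr a)

/-- The exponent of a coordinate. -/
def eX (a : Idx p q) : Expo p q := Finsupp.single (Sum.inl a) 1

/-- The exponent of the conjugate of a coordinate. -/
def eY (a : Idx p q) : Expo p q := Finsupp.single (Sum.inr a) 1

lemma cX_mul_mo (a : Idx p q) (d : Expo p q) : cX a * mo d = mo (d + eX a) := by
  rw [cX, mo, mo, eX, MvPolynomial.X, MvPolynomial.monomial_mul, one_mul, add_comm]

lemma cY_mul_mo (a : Idx p q) (d : Expo p q) : cY a * mo d = mo (d + eY a) := by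
  rw [cY, mo, mo, eY, MvPolynomial.X, MvPolynomial.monomial_mul, one_mul, add_comm]

lemma dX_mo (a : Idx p q) (d : Expo p q) : dX a (mo d) = (d (Sum.inl a) : ℂ) • mo (d - eX a) := by
  rw [dX, mo, mo, MvPolynomial.pderiv_monomial, eX, MvPolynomial.smul_monomial]
  simp

lemma dY_mo (a : Idx p q) (d : Expo p q) : dY a (mo d) = (d (Sum.inr a) : ℂ) • mo (d - eY a) := by
  rw [dY, mo, mo, MvPolynomial.pderiv_monomial, eY, MvPolynomial.smul_monomial]
  simp

lemma degX_add (d e : Expo p q) : degX (d + e) = degX d + degX e := Finset.sum_add_distrib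

lemma degY_add (d e : Expo p q) : degY (d + e) = degY d + degY e := Finset.sum_add_distrib

lemma degX_eX (a : Idx p q) : degX (eX a) = 1 := by simp [degX, eX, Finsupp.single_apply]

lemma degY_eX (a : Idx p q) : degY (eX a) = 0 := by simp [degY, eX]

lemma degX_eY (a : Idx p q) : degX (eY a) = 0 := by simp [degX, eY]

lemma degY_eY (a : Idx p q) : degY (eY a) = 1 := by simp [degY, eY, Finsupp.single_apply]

lemma exists_eq_add_eX {d : Expo p q} {a : Idx p q} (h : d (Sum.inl a) ≠ 0) :
    ∃ e, d = e + eX a :=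
  ⟨d - eX a, (tsub_add_cancel_of_le (by
    rw [eX, Finsupp.single_le_iff]; omega)).symm⟩

lemma exists_eq_add_eY {d : Expo p q} {a : Idx p q} (h : d (Sum.inr a) ≠ 0) :
    ∃ e, d = e + eY a :=
  ⟨d - eY a, (tsub_add_cancel_of_le (by
    rw [eY, Finsupp.single_le_iff]; omega)).symm⟩

/-- Bihomogeneous polynomials. -/
def Bi (p q k l : ℕ) : Submodule ℂ (Ply p q) :=
  Submodule.span ℂ {P | ∃ d : Expo p q, degX d = k ∧ degY d = l ∧ P = mo d}

variable {k l : ℕ} {P : Ply p q}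

lemma mo_mem_Bi (d : Expo p q) : mo d ∈ Bi p q (degX d) (degY d) :=
  Submodule.subset_span ⟨d, rfl, rfl, rfl⟩

lemma map_mem_of_mo (T : Ply p q →ₗ[ℂ] Ply p q) (A : Submodule ℂ (Ply p q))
    (h : ∀ d, degX d = k → degY d = l → T (mo d) ∈ A) (hP : P ∈ Bi p q k l) : T P ∈ A := by
  have h1 : Bi p q k l ≤ A.comap T := by
    refine Submodule.span_le.2 ?_
    rintro _ ⟨d, h1, h2, rfl⟩
    exact h d h1 h2
  exact h1 hP

lemma cX_mul_mem (a : Idx p q) (hP : P ∈ Bi p q k l) : cX a * P ∈ Bi p q (k + 1) l := by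
  refine map_mem_of_mo (LinearMap.mulLeft ℂ (cX a)) _ (fun d h1 h2 => ?_) hP
  rw [LinearMap.mulLeft_apply, cX_mul_mo]
  convert mo_mem_Bi (d + eX a)
  · rw [degX_add, degX_eX, h1]
  · rw [degY_add, degY_eX, h2, add_zero]

lemma cY_mul_mem (a : Idx p q) (hP : P ∈ Bi p q k l) : cY a * P ∈ Bi p q k (l + 1) := by
  refine map_mem_of_mo (LinearMap.mulLeft ℂ (cY a)) _ (fun d h1 h2 => ?_) hP
  rw [LinearMap.mulLeft_apply, cY_mul_mo]
  convert mo_mem_Bi (d + eY a)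
  · rw [degX_add, degX_eY, h1, add_zero]
  · rw [degY_add, degY_eY, h2]

lemma dX_mem (a : Idx p q) (hP : P ∈ Bi p q (k + 1) l) : dX a P ∈ Bi p q k l := by
  refine map_mem_of_mo (dX a).toLinearMap _ (fun d h1 h2 => ?_) hP
  change dX a (mo d) ∈ _
  rw [dX_mo]
  by_cases h : d (Sum.inl a) = 0
  · rw [h, Nat.cast_zero, zero_smul]; exact zero_mem _
  obtain ⟨e, rfl⟩ := exists_eq_add_eX h
  rw [degX_add, degX_eX] at h1
  rw [degY_add, degY_eX, add_zero] at h2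
  rw [add_tsub_cancel_right, ← Nat.succ.inj h1, ← h2]
  exact Submodule.smul_mem _ _ (mo_mem_Bi e)

lemma dY_mem (a : Idx p q) (hP : P ∈ Bi p q k (l + 1)) : dY a P ∈ Bi p q k l := by
  refine map_mem_of_mo (dY a).toLinearMap _ (fun d h1 h2 => ?_) hP
  change dY a (mo d) ∈ _
  rw [dY_mo]
  by_cases h : d (Sum.inr a) = 0
  · rw [h, Nat.cast_zero, zero_smul]; exact zero_mem _
  obtain ⟨e, rfl⟩ := exists_eq_add_eY h
  rw [degY_add, degY_eY] at h2
  rw [degX_add, degX_eY, add_zero] at h1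
  rw [add_tsub_cancel_right, ← Nat.succ.inj h2, ← h1]
  exact Submodule.smul_mem _ _ (mo_mem_Bi e)

lemma dX_eq_zero (a : Idx p q) (hP : P ∈ Bi p q 0 l) : dX a P = 0 := by
  refine (Submodule.mem_bot ℂ).1 (map_mem_of_mo (dX a).toLinearMap ⊥ (fun d h1 _ => ?_) hP)
  change dX a (mo d) ∈ _
  have : d (Sum.inl a) = 0 := Finset.sum_eq_zero_iff.1 h1 a (Finset.mem_univ a)
  rw [dX_mo, this, Nat.cast_zero, zero_smul]
  exact zero_mem _

lemma dY_eq_zero (a : Idx p q) (hP : P ∈ Bi p q k 0) : dY a P = 0 := by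
  refine (Submodule.mem_bot ℂ).1 (map_mem_of_mo (dY a).toLinearMap ⊥ (fun d _ h1 => ?_) hP)
  change dY a (mo d) ∈ _
  have : d (Sum.inr a) = 0 := Finset.sum_eq_zero_iff.1 h1 a (Finset.mem_univ a)
  rw [dY_mo, this, Nat.cast_zero, zero_smul]
  exact zero_mem _

lemma cX_mul_dX_mem (a b : Idx p q) (hP : P ∈ Bi p q k l) : cX b * dX a P ∈ Bi p q k l := by
  rcases k with _ | k
  · rw [dX_eq_zero a hP, mul_zero]; exact zero_mem _
  · exact cX_mul_mem b (dX_mem a hP)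

lemma cY_mul_dY_mem (a b : Idx p q) (hP : P ∈ Bi p q k l) : cY b * dY a P ∈ Bi p q k l := by
  rcases l with _ | l
  · rw [dY_eq_zero a hP, mul_zero]; exact zero_mem _
  · exact cY_mul_mem b (dY_mem a hP)

lemma fE_mem (a b : Idx p q) (hP : P ∈ Bi p q k l) : fE a b P ∈ Bi p q k l := by
  rw [fE_apply]
  exact sub_mem (Submodule.smul_mem _ _ (cX_mul_dX_mem a b hP))
    (Submodule.smul_mem _ _ (cY_mul_dY_mem b a hP))

lemma ev_smul (t : ℂ) (v : V p q) (hP : P ∈ Bi p q k l) :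
    ev (t • v) P = t ^ k * conj t ^ l * ev v P := by
  have h1 : Bi p q k l ≤ LinearMap.ker ((ev (t • v)).toLinearMap -
      (t ^ k * conj t ^ l) • (ev v).toLinearMap) := by
    refine Submodule.span_le.2 ?_
    rintro _ ⟨d, rfl, rfl, rfl⟩
    rw [SetLike.mem_coe, LinearMap.mem_ker]
    have h2 : ∀ v : V p q, ev v (mo d) = (∏ a, crd a v ^ d (Sum.inl a)) *
        ∏ a, conj (crd a v) ^ d (Sum.inr a) := by
      intro v
      rw [ev, mo, MvPolynomial.aeval_monomial, Finsupp.prod_fintype _ _ fun i => pow_zero _,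
        Fintype.prod_sum_type]
      simp
    change ev (t • v) (mo d) - (t ^ degX d * conj t ^ degY d) * ev v (mo d) = 0
    rw [h2, h2]
    simp only [crd_smul, map_mul, mul_pow, Finset.prod_mul_distrib, Finset.prod_pow_eq_pow_sum]
    rw [degX, degY]
    ring
  have := h1 hP
  rw [LinearMap.mem_ker] at this
  exact sub_eq_zero.1 this

lemma pw_smul (s : ℂ) {t : ℂ} (ht : t ≠ 0) {v : V p q} (hv : 0 < rz v) :
    pw s (t • v) = Complex.exp (2 * s * (Real.log ‖t‖ : ℂ)) * pw s v := by
  have h1 : rz (t • v) = ‖t‖ ^ 2 * rz v := by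
    simp only [rz, Prod.smul_fst, Pi.smul_apply, smul_eq_mul, map_mul, Finset.mul_sum,
      Complex.normSq_eq_norm_sq]
  rw [pw, pw, ← Complex.exp_add, h1, Real.log_mul (pow_ne_zero 2 (norm_ne_zero_iff.2 ht)) hv.ne',
    Real.log_pow]
  congr 1
  push_cast
  ring

/-- The function of polynomial type given by a bihomogeneous polynomial. -/
lemma ev_mul_pw_mem_S (hP : P ∈ Bi p q k l) {α β s : ℂ} (hα : α = k + s) (hβ : β = l + s) :
    (fun η : X0 p q => ev η.1 P * pw s η.1) ∈ S p q α β := by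
  refine ⟨fun η => ⟨Opn p q, fun v => ev v P * pw s v, isOpen_Opn, mem_Opn η, fun v hv =>
    ((contDiff_ev P).contDiffAt.mul (contDiffAt_pw s hv.1)).contDiffWithinAt, fun _ _ => rfl⟩,
    fun t η => ?_⟩
  change ev ((t : ℂ) • η.1) P * pw s ((t : ℂ) • η.1) = _
  have hn : α - β = ((k - l : ℤ) : ℂ) := by rw [hα, hβ]; push_cast; ring
  have ht := norm_units_pos t
  have ht' : (‖(t : ℂ)‖ : ℂ) ≠ 0 := by exact_mod_cast ht.ne'
  rw [ev_smul _ _ hP, pw_smul s t.ne_zero (rz_pos η), psi_eq hn, hα, hβ]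
  have h1 : Complex.exp ((k + s + (l + s)) * (Real.log ‖(t : ℂ)‖ : ℂ)) =
      (‖(t : ℂ)‖ : ℂ) ^ (k + l) * Complex.exp (2 * s * (Real.log ‖(t : ℂ)‖ : ℂ)) := by
    have : (‖(t : ℂ)‖ : ℂ) = Complex.exp (Real.log ‖(t : ℂ)‖ : ℂ) := by
      rw [← Complex.ofReal_exp, Real.exp_log ht]
    conv_rhs => rw [this]
    rw [← Complex.exp_nat_mul, ← Complex.exp_add]
    congr 1
    push_cast
    ring
  have h2 : conj (t : ℂ) = (‖(t : ℂ)‖ : ℂ) ^ 2 / t := by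
    rw [eq_div_iff t.ne_zero, mul_comm, Complex.mul_conj, Complex.normSq_eq_norm_sq]
    push_cast; rfl
  rw [h1, h2, zpow_sub₀ (div_ne_zero t.ne_zero ht'), zpow_natCast, zpow_natCast]
  have h5 : ∀ x r : ℂ, x ≠ 0 → r ≠ 0 →
      x ^ k * (r ^ 2 / x) ^ l = r ^ (k + l) * ((x / r) ^ k / (x / r) ^ l) := by
    intro x r hx hr
    rw [div_pow, div_pow, div_pow, div_div_div_eq, mul_div_assoc', mul_div_assoc',
      div_eq_div_iff (pow_ne_zero _ hx) (mul_ne_zero (pow_ne_zero _ hr) (pow_ne_zero _ hx))]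
    ring
  linear_combination (Complex.exp (2 * s * (Real.log ‖(t : ℂ)‖ : ℂ)) * pw s η.1 *
    ev η.1 P) * h5 t ‖(t : ℂ)‖ t.ne_zero ht'

end Bidegree

/-! ### Generation of all functions of polynomial type -/

section Generation

variable {α β : ℂ} {L : Submodule ℂ (S p q α β)} {s : ℂ}

lemma dX_rhoZ_inl (i : Fin p) : dX (Sum.inl i) (rhoZ p q) = cY (Sum.inl i) := by
  simp [rhoZ, Derivation.leibniz, dX_cX, dX_cY]

lemma dY_rhoZ_inl (i : Fin p) : dY (Sum.inl i) (rhoZ p q) = cX (Sum.inl i) := by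
  simp [rhoZ, Derivation.leibniz, dY_cX, dY_cY]

lemma dX_rhoZ_inr (j : Fin q) : dX (Sum.inr j) (rhoZ p q) = 0 := by
  simp [rhoZ, Derivation.leibniz, dX_cX, dX_cY]

lemma dY_rhoZ_inr (j : Fin q) : dY (Sum.inr j) (rhoZ p q) = 0 := by
  simp [rhoZ, Derivation.leibniz, dY_cX, dY_cY]

lemma fE_rhoZ_same {a b : Idx p q} (h : SameSide a b) : fE a b (rhoZ p q) = 0 := by
  rcases a with i | i <;> rcases b with j | j
  · rw [fE_apply, dX_rhoZ_inl, dY_rhoZ_inl]; simp [sg, mul_comm]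
  · exact h.elim
  · exact h.elim
  · rw [fE_apply, dX_rhoZ_inr, dY_rhoZ_inr]; simp

lemma InL.lie_same (hL : LieStable L) {P : Ply p q} (hP : InL L P s) {a b : Idx p q}
    (h : SameSide a b) : InL L (fE a b P) s := by
  have := hP.lie hL a b
  rwa [fE_rhoZ_same h, mul_zero, smul_zero, add_zero, inL_rhoZ_iff] at this

/-- If E P is already in L, then subtracting it from the Lie derivative of P |z|^(2s) leaves s P
E(|z|²). Since E(|z|²) = z_i conj(w_j), division by s is multiplication by this mixed product. -/
lemma InL.raise (hL : LieStable L) {P : Ply p q} (hP : InL L P s) (i : Fin p) (j : Fin q)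
    (hE : InL L (fE (Sum.inr j) (Sum.inl i) P) s) (hs : s ≠ 0) :
    InL L (P * (cX (Sum.inl i) * cY (Sum.inr j))) (s - 1) := by
  have h1 := (hP.lie hL (Sum.inr j) (Sum.inl i)).sub (inL_rhoZ_iff.2 hE)
  rw [add_sub_cancel_left] at h1
  have h2 := h1.of_smul hs
  rw [fE_apply, dX_rhoZ_inr, dY_rhoZ_inl] at h2
  convert h2 using 2
  simp [sg, mul_comm]

lemma InL.raise' (hL : LieStable L) {P : Ply p q} (hP : InL L P s) (i : Fin p) (j : Fin q)
    (hE : InL L (fE (Sum.inl i) (Sum.inr j) P) s) (hs : s ≠ 0) :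
    InL L (P * (cX (Sum.inr j) * cY (Sum.inl i))) (s - 1) := by
  have h1 := (hP.lie hL (Sum.inl i) (Sum.inr j)).sub (inL_rhoZ_iff.2 hE)
  rw [add_sub_cancel_left] at h1
  have h2 := (h1.of_smul hs).smul (-1)
  rw [fE_apply, dY_rhoZ_inr, dX_rhoZ_inl] at h2
  convert h2 using 2
  simp [sg]

/-- Passage from bidegree `(k, l)` to bidegree `(k + 1, l + 1)`. -/
lemma inL_succ (hL : LieStable L) {k l : ℕ} (hs : ∀ m : ℤ, s ≠ m)
    (h : ∀ P ∈ Bi p q k l, InL L P s) :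
    ∀ P ∈ Bi p q (k + 1) (l + 1), InL L P (s - 1) := by
  have hs0 : s ≠ 0 := by simpa using hs 0
  -- Mixed products z conj(w) and w conj(z) come directly from raising; the pure products need a
  -- further Lie derivative.
  have mix : ∀ (i : Fin p) (j : Fin q), ∀ P ∈ Bi p q k l,
      InL L (cX (Sum.inl i) * (cY (Sum.inr j) * P)) (s - 1) := by
    intro i j P hP
    convert (h P hP).raise hL i j (h _ (fE_mem _ _ hP)) hs0 using 1
    ring
  have mix' : ∀ (i : Fin p) (j : Fin q), ∀ P ∈ Bi p q k l,
      InL L (cX (Sum.inr j) * (cY (Sum.inl i) * P)) (s - 1) := by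
    intro i j P hP
    convert (h P hP).raise' hL i j (h _ (fE_mem _ _ hP)) hs0 using 1
    ring
  -- Apply E to the known elements w_j conj(z_i') P and sum over j. When P contains no w, the sum of
  -- w_j conj(w_j) collapses to |w|² = |z|², and the wanted element appears with the factor q + s -
  -- 1, nonzero because s is not an integer.
  have pureZ : ∀ (i i' : Fin p), ∀ P ∈ Bi p q k l, (∀ j, dX (Sum.inr j) P = 0) →
      InL L (cX (Sum.inl i) * (cY (Sum.inl i') * P)) (s - 1) := by
    intro i i' P hP hdP
    set Q := cY (Sum.inl i') * P with hQ
    have hQB : Q ∈ Bi p q k (l + 1) := cY_mul_mem _ hP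
    have hdQ : ∀ j, dX (Sum.inr j) Q = 0 := by
      intro j
      rw [hQ, Derivation.leibniz, hdP, dX_cY, smul_zero, smul_zero, add_zero]
    have h1 := InL.sum Finset.univ fun j (_ : j ∈ Finset.univ) =>
      (mix' i' j P hP).lie hL (Sum.inr j) (Sum.inl i)
    have h2 : ∑ j : Fin q, (rhoZ p q * fE (Sum.inr j) (Sum.inl i) (cX (Sum.inr j) * Q) +
        (s - 1) • (cX (Sum.inr j) * Q * fE (Sum.inr j) (Sum.inl i) (rhoZ p q))) =
        (q : ℂ) • (rhoZ p q * (cX (Sum.inl i) * Q)) +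
        (rhoZ p q * (rhoW p q * dY (Sum.inl i) Q) +
          (s - 1) • (rhoW p q * (cX (Sum.inl i) * Q))) := by
      have h3 : ∀ j : Fin q, rhoZ p q * fE (Sum.inr j) (Sum.inl i) (cX (Sum.inr j) * Q) +
        (s - 1) • (cX (Sum.inr j) * Q * fE (Sum.inr j) (Sum.inl i) (rhoZ p q)) =
          rhoZ p q * (cX (Sum.inl i) * Q) + ((cX (Sum.inr j) * cY (Sum.inr j)) *
            (rhoZ p q * dY (Sum.inl i) Q) + (cX (Sum.inr j) * cY (Sum.inr j)) *
            ((s - 1) • (cX (Sum.inl i) * Q))) := by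
        intro j
        simp only [fE_apply, Derivation.leibniz, dX_rhoZ_inr, dY_rhoZ_inl, hdQ, dX_cX, dY_cX,
          smul_eq_mul, sg, Sum.elim_inl, Sum.elim_inr, MvPolynomial.smul_eq_C_mul, map_neg,
          map_one, if_true]
        ring
      rw [Finset.sum_congr rfl fun j _ => h3 j, Finset.sum_add_distrib, Finset.sum_add_distrib,
        Finset.sum_const, Finset.card_univ, Fintype.card_fin, Nat.cast_smul_eq_nsmul,
        ← Finset.sum_mul, ← Finset.sum_mul, ← rhoW]
      simp only [MvPolynomial.smul_eq_C_mul]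
      ring
    rw [h2] at h1
    have h3 : InL L (rhoZ p q * (rhoW p q * dY (Sum.inl i) Q)) (s - 1 - 1) :=
      inL_rhoZ_iff.2 (inL_rhoW_iff.2 (h _ (dY_mem _ hQB)))
    have h4 : InL L ((q : ℂ) • (rhoZ p q * (cX (Sum.inl i) * Q)) +
          (s - 1) • (rhoW p q * (cX (Sum.inl i) * Q))) (s - 1 - 1) := by
      convert h1.sub h3 using 1
      ring
    refine InL.of_smul (c := q + (s - 1)) ?_ (inL_rhoZ_iff.1 (h4.congr fun η => ?_))
    · intro h0
      refine hs (1 - q) ?_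
      push_cast
      linear_combination h0
    · simp only [map_add, map_smul, map_mul, ev_rhoZ, ev_rhoW, rz_eq_rw', smul_eq_mul]
      ring
  have pureW : ∀ (j j' : Fin q), ∀ P ∈ Bi p q k l, (∀ i, dX (Sum.inl i) P = 0) →
      InL L (cX (Sum.inr j) * (cY (Sum.inr j') * P)) (s - 1) := by
    intro j j' P hP hdP
    set Q := cY (Sum.inr j') * P with hQ
    have hQB : Q ∈ Bi p q k (l + 1) := cY_mul_mem _ hP
    have hdQ : ∀ i, dX (Sum.inl i) Q = 0 := by
      intro i
      rw [hQ, Derivation.leibniz, hdP, dX_cY, smul_zero, smul_zero, add_zero]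
    have h1 := InL.sum Finset.univ fun i (_ : i ∈ Finset.univ) =>
      (mix i j' P hP).lie hL (Sum.inl i) (Sum.inr j)
    have h2 : ∑ i : Fin p, (rhoZ p q * fE (Sum.inl i) (Sum.inr j) (cX (Sum.inl i) * Q) +
        (s - 1) • (cX (Sum.inl i) * Q * fE (Sum.inl i) (Sum.inr j) (rhoZ p q))) =
        (-1 : ℂ) • ((p : ℂ) • (rhoZ p q * (cX (Sum.inr j) * Q)) +
        (rhoZ p q * (rhoZ p q * dY (Sum.inr j) Q) +
          (s - 1) • (rhoZ p q * (cX (Sum.inr j) * Q)))) := by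
      have h3 : ∀ i : Fin p, rhoZ p q * fE (Sum.inl i) (Sum.inr j) (cX (Sum.inl i) * Q) +
        (s - 1) • (cX (Sum.inl i) * Q * fE (Sum.inl i) (Sum.inr j) (rhoZ p q)) =
          -(rhoZ p q * (cX (Sum.inr j) * Q)) - ((cX (Sum.inl i) * cY (Sum.inl i)) *
            (rhoZ p q * dY (Sum.inr j) Q) + (cX (Sum.inl i) * cY (Sum.inl i)) *
            ((s - 1) • (cX (Sum.inr j) * Q))) := by
        intro i
        simp only [fE_apply, Derivation.leibniz, dY_rhoZ_inr, dX_rhoZ_inl, hdQ, dX_cX, dY_cX,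
          smul_eq_mul, sg, Sum.elim_inl, Sum.elim_inr, MvPolynomial.smul_eq_C_mul, map_neg,
          map_one, if_true]
        ring
      rw [Finset.sum_congr rfl fun j _ => h3 j, Finset.sum_sub_distrib, Finset.sum_add_distrib,
        ← Finset.sum_mul, ← Finset.sum_mul, ← rhoZ, Finset.sum_const, Finset.card_univ,
        Fintype.card_fin, Nat.cast_smul_eq_nsmul]
      simp only [MvPolynomial.smul_eq_C_mul, map_neg, map_one, nsmul_eq_mul]
      ring
    rw [h2] at h1
    have h3 : InL L (rhoZ p q * (rhoZ p q * dY (Sum.inr j) Q)) (s - 1 - 1) :=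
      inL_rhoZ_iff.2 (inL_rhoZ_iff.2 (h _ (dY_mem _ hQB)))
    have h4 : InL L ((p : ℂ) • (rhoZ p q * (cX (Sum.inr j) * Q)) +
          (s - 1) • (rhoZ p q * (cX (Sum.inr j) * Q))) (s - 1 - 1) := by
      convert (h1.smul (-1)).sub h3 using 1
      rw [smul_smul]
      norm_num
      ring
    rw [← add_smul] at h4
    refine inL_rhoZ_iff.1 (InL.of_smul (c := p + (s - 1)) ?_ h4)
    intro h0
    refine hs (1 - p) ?_
    push_cast
    linear_combination h0
  intro P hP
  let A : Submodule ℂ (Ply p q) :=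
    { carrier := {P | InL L P (s - 1)}
      add_mem' := fun h1 h2 => InL.add h1 h2
      zero_mem' := InL.zero
      smul_mem' := fun c _ h1 => InL.smul c h1 }
  refine map_mem_of_mo LinearMap.id A (fun d h1 h2 => ?_) hP
  change InL L (mo d) (s - 1)
  have exX : ∃ a, d (Sum.inl a) ≠ 0 := by
    by_contra! h0
    rw [degX, Finset.sum_eq_zero fun a _ => h0 a] at h1
    omega
  have exY : ∃ a, d (Sum.inr a) ≠ 0 := by
    by_contra! h0
    rw [degY, Finset.sum_eq_zero fun a _ => h0 a] at h2
    omega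
  have split : ∀ a b : Idx p q, d (Sum.inl a) ≠ 0 → d (Sum.inr b) ≠ 0 →
      ∃ e, degX e = k ∧ degY e = l ∧ d = e + eY b + eX a := by
    intro a b ha hb
    obtain ⟨e, rfl⟩ := exists_eq_add_eX ha
    obtain ⟨e', rfl⟩ := exists_eq_add_eY (d := e) (a := b) (by simpa [eX] using hb)
    refine ⟨e', ?_, ?_, rfl⟩
    · simpa [degX_add, degX_eX, degX_eY] using h1
    · simpa [degY_add, degY_eX, degY_eY] using h2
  have conv : ∀ (a b : Idx p q) (e : Expo p q), mo (e + eY b + eX a) = cX a * (cY b * mo e) := by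
    intro a b e
    rw [cY_mul_mo, cX_mul_mo]
  have memB : ∀ e : Expo p q, degX e = k → degY e = l → mo e ∈ Bi p q k l := by
    rintro e rfl rfl; exact mo_mem_Bi e
  by_cases c1 : ∃ i j, d (Sum.inl (Sum.inl i)) ≠ 0 ∧ d (Sum.inr (Sum.inr j)) ≠ 0
  · obtain ⟨i, j, hi, hj⟩ := c1
    obtain ⟨e, he1, he2, rfl⟩ := split _ _ hi hj
    rw [conv]
    exact mix i j _ (memB e he1 he2)
  by_cases c2 : ∃ i j, d (Sum.inl (Sum.inr j)) ≠ 0 ∧ d (Sum.inr (Sum.inl i)) ≠ 0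
  · obtain ⟨i, j, hi, hj⟩ := c2
    obtain ⟨e, he1, he2, rfl⟩ := split _ _ hi hj
    rw [conv]
    exact mix' i j _ (memB e he1 he2)
  -- Without mixed products, all holomorphic and antiholomorphic factors lie in a single component.
  -- The remaining monomial therefore meets the condition of `pureZ` or `pureW`.
  push Not at c1 c2
  obtain ⟨a, ha⟩ := exX
  obtain ⟨b, hb⟩ := exY
  obtain ⟨e, he1, he2, rfl⟩ := split _ _ ha hb
  rw [conv]
  rcases a with i | j <;> rcases b with i' | j'
  · refine pureZ i i' _ (memB e he1 he2) fun j => ?_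
    have h0 : e (Sum.inl (Sum.inr j)) = 0 := by
      by_contra h0
      exact hb (c2 i' j (by simp [h0]))
    rw [dX_mo, h0, Nat.cast_zero, zero_smul]
  · exact absurd (c1 i j' ha) hb
  · exact absurd (c2 i' j ha) hb
  · refine pureW j j' _ (memB e he1 he2) fun i => ?_
    have h0 : e (Sum.inl (Sum.inl i)) = 0 := by
      by_contra h0
      exact hb (c1 i j' (by simp [h0]))
    rw [dX_mo, h0, Nat.cast_zero, zero_smul]

end Generation

end LightCone

end

/-! ### From the highest weight vector to all bidegrees. -/

open scoped Topology ContDiff UniformConvergence ComplexConjugate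

noncomputable section

namespace LightCone

set_option linter.unusedSectionVars false

open MeasureTheory Filter

variable {p q : ℕ} {α β : ℂ} {L : Submodule ℂ (S p q α β)} {s : ℂ}

lemma dY_dX (a b : Idx p q) (P : Ply p q) : dY a (dX b P) = dX b (dY a P) := by
  have h : ⁅dY (p := p) (q := q) a, dX b⁆ = 0 := by
    refine MvPolynomial.derivation_ext fun i => ?_
    rw [Derivation.commutator_apply]
    rcases i with i | i
    · change dY a (dX b (cX i)) - dX b (dY a (cX i)) = 0
      rw [dX_cX, dY_cX]
      split_ifs <;> simp
    · change dY a (dX b (cY i)) - dX b (dY a (cY i)) = 0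
      rw [dX_cY, dY_cY]
      split_ifs <;> simp
  have h2 := congrArg (fun D => D P) h
  rw [Derivation.commutator_apply] at h2
  exact sub_eq_zero.1 h2

/-- For replacing a factor z_k by w_j in a holomorphic polynomial. The noncompact operator also
produces an unwanted term P w_j conj(z_i). Applying rotations among the z variables and summing
gives a second relation with the same unwanted term, which can then be eliminated. -/
lemma inL_cross (hL : LieStable L) (hs : ∀ m : ℤ, s ≠ m) {P : Ply p q} (hP : InL L P s)
    (hY : ∀ a, dY a P = 0) {m : ℕ}
    (hE : ∑ i : Fin p, cX (Sum.inl i) * dX (Sum.inl i) P = (m : ℂ) • P) (k : Fin p) (j : Fin q) :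
    InL L (cX (Sum.inr j) * dX (Sum.inl k) P) s := by
  set G : Fin p → Ply p q := fun i => rhoZ p q * (cX (Sum.inr j) * dX (Sum.inl i) P) +
    s • (P * (cX (Sum.inr j) * cY (Sum.inl i))) with hG
  have hGL : ∀ i, InL L (G i) (s - 1) := by
    intro i
    have h1 := (hP.lie hL (Sum.inl i) (Sum.inr j)).smul (-1)
    convert h1 using 1
    simp only [hG, fE_apply, dX_rhoZ_inl, dY_rhoZ_inr, hY, sg, Sum.elim_inl, Sum.elim_inr,
      MvPolynomial.smul_eq_C_mul, map_neg, map_one]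
    ring
  have hcomm : ∀ i, cX (Sum.inl i) * dX (Sum.inl k) (dX (Sum.inl i) P) =
      dX (Sum.inl k) (cX (Sum.inl i) * dX (Sum.inl i) P) -
        if k = i then dX (Sum.inl i) P else 0 := by
    intro i
    rw [Derivation.leibniz, dX_cX]
    simp only [smul_eq_mul, Sum.inl.injEq]
    split_ifs <;> ring
  have hsum : ∑ i : Fin p, cX (Sum.inl i) * dX (Sum.inl k) (dX (Sum.inl i) P) =
      (m : ℂ) • dX (Sum.inl k) P - dX (Sum.inl k) P := by
    rw [Finset.sum_congr rfl fun i _ => hcomm i, Finset.sum_sub_distrib, ← map_sum, hE,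
      Derivation.map_smul]
    simp
  have hYd : ∀ a i, dY a (dX (Sum.inl i) P) = 0 := by
    intro a i
    rw [dY_dX, hY, map_zero]
  have hfE : ∀ i, fE (Sum.inl k) (Sum.inl i) (G i) =
      rhoZ p q * (cX (Sum.inr j) * (cX (Sum.inl i) * dX (Sum.inl k) (dX (Sum.inl i) P))) +
      (s • ((cX (Sum.inl i) * cY (Sum.inl i)) * (cX (Sum.inr j) * dX (Sum.inl k) P)) -
        s • (P * (cX (Sum.inr j) * cY (Sum.inl k)))) := by
    intro i
    have h0 : fE (Sum.inl k) (Sum.inl i) (rhoZ p q) = 0 := fE_rhoZ_same trivial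
    rw [hG, map_add, Derivation.leibniz, h0, Derivation.map_smul]
    simp only [fE_apply, Derivation.leibniz, hY, hYd, dX_cX, dY_cX, dX_cY, dY_cY, smul_eq_mul, sg,
      Sum.elim_inl, MvPolynomial.smul_eq_C_mul, map_one, reduceCtorEq, if_true, if_false]
    ring
  have h1 := InL.sum Finset.univ fun i (_ : i ∈ Finset.univ) =>
    (hGL i).lie_same hL (a := Sum.inl k) (b := Sum.inl i) trivial
  rw [Finset.sum_congr rfl fun i _ => hfE i, Finset.sum_add_distrib, Finset.sum_sub_distrib,
    Finset.sum_const, Finset.card_univ, Fintype.card_fin, ← Finset.smul_sum, ← Finset.sum_mul,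
    ← rhoZ, ← Finset.mul_sum, ← Finset.mul_sum, hsum] at h1
  -- Adding p copies of `G k` cancels the terms in conj(z_k); the total coefficient (m - 1) + s + p
  -- is not zero because s is not an integer.
  have h2 := h1.add ((hGL k).smul p)
  refine inL_rhoZ_iff.1 (InL.of_smul (c := s + m + p - 1) ?_ ?_)
  · intro h0
    refine hs (1 - m - p) ?_
    push_cast
    linear_combination h0
  · convert h2 using 1
    simp only [hG, ← Nat.cast_smul_eq_nsmul ℂ, MvPolynomial.smul_eq_C_mul, map_add, map_sub,
      map_one]
    ring

lemma dX_mo_add (a : Idx p q) (e : Expo p q) :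
    dX a (mo (e + eX a)) = ((e (Sum.inl a) + 1 : ℕ) : ℂ) • mo e := by
  rw [dX_mo, add_tsub_cancel_right]
  simp [eX]

/-- Induction on the number r of factors different from z_{i0}. One such factor is obtained from
z_{i0} by a compact rotation if it is another z, and by `inL_cross` if it is a w. -/
lemma inL_base (hL : LieStable L) (hs : ∀ m : ℤ, s ≠ m) {n : ℕ} (i0 : Fin p)
    (h0 : InL L (mo (n • eX (Sum.inl i0))) s) (r : ℕ) :
    ∀ d : Expo p q, degX d = n → degY d = 0 → d (Sum.inl (Sum.inl i0)) + r = n →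
      InL L (mo d) s := by
  induction r with
  | zero =>
    intro d h1 h2 h3
    have : d = n • eX (Sum.inl i0) := by
      ext x
      rcases x with a | a
      · by_cases ha : a = Sum.inl i0
        · subst ha
          simpa [eX] using h3
        · have h4 : d (Sum.inl (Sum.inl i0)) + d (Sum.inl a) ≤ degX d := by
            rw [degX, ← Finset.sum_pair (f := fun a => d (Sum.inl a)) (Ne.symm ha)]
            exact Finset.sum_le_sum_of_subset (Finset.subset_univ _)
          have : d (Sum.inl a) = 0 := by omega
          rw [this]
          simp [eX, Ne.symm ha]
      · have : d (Sum.inr a) = 0 := Finset.sum_eq_zero_iff.1 h2 a (Finset.mem_univ a)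
        rw [this]
        simp [eX]
    rw [this]
    exact h0
  | succ r ih =>
    intro d h1 h2 h3
    obtain ⟨a, ha, hda⟩ : ∃ a, a ≠ Sum.inl i0 ∧ d (Sum.inl a) ≠ 0 := by
      by_contra! hc
      rw [degX, Finset.sum_eq_single (Sum.inl i0) (fun a _ ha => hc a ha) (by simp)] at h1
      omega
    obtain ⟨e, rfl⟩ := exists_eq_add_eX hda
    rw [degX_add, degX_eX] at h1
    rw [degY_add, degY_eX, add_zero] at h2
    have hea : (e + eX a) (Sum.inl (Sum.inl i0)) = e (Sum.inl (Sum.inl i0)) := by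
      simp [eX, ha]
    rw [hea] at h3
    have h4 : InL L (mo (e + eX (Sum.inl i0))) s := by
      refine ih _ ?_ ?_ ?_
      · rw [degX_add, degX_eX, h1]
      · rw [degY_add, degY_eX, h2]
      · simp [eX]; omega
    have hY : ∀ b, dY b (mo (e + eX (Sum.inl i0))) = 0 := by
      intro b
      have : e (Sum.inr b) = 0 := Finset.sum_eq_zero_iff.1 h2 b (Finset.mem_univ b)
      rw [dY_mo]
      simp [eX, this]
    have hne : ((e (Sum.inl (Sum.inl i0)) + 1 : ℕ) : ℂ) ≠ 0 := Nat.cast_ne_zero.2 (by omega)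
    refine InL.of_smul hne ?_
    rw [← cX_mul_mo, ← mul_smul_comm, ← dX_mo_add]
    rcases a with i | j
    · have h5 := h4.lie_same hL (a := Sum.inl i0) (b := Sum.inl i) trivial
      rw [fE_apply, hY] at h5
      simpa [sg] using h5
    · set d' : Expo p q := e + eX (Sum.inl i0)
      refine inL_cross hL hs h4 hY
        (m := ∑ i : Fin p, d' (Sum.inl (Sum.inl i))) ?_ i0 j
      rw [Nat.cast_sum, Finset.sum_smul]
      refine Finset.sum_congr rfl fun i _ => ?_
      rw [dX_mo, mul_smul_comm, cX_mul_mo]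
      by_cases hz : d' (Sum.inl (Sum.inl i)) = 0
      · rw [hz]; simp
      · obtain ⟨e', he'⟩ := exists_eq_add_eX hz
        rw [he', add_tsub_cancel_right]

/-- A Lie stable submodule containing the highest weight vector contains all functions of
polynomial type. -/
lemma inL_of_inL_pow (hL : LieStable L) (hα : ∀ m : ℤ, α ≠ m) {n : ℕ} (i0 : Fin p)
    (h0 : InL L (mo (n • eX (Sum.inl i0))) (α - n)) (l : ℕ) :
    ∀ P ∈ Bi p q (l + n) l, InL L P (α - ((l + n : ℕ) : ℂ)) := by
  have hs : ∀ r : ℕ, ∀ m : ℤ, α - (r : ℂ) ≠ m := by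
    intro r m hm
    refine hα (m + r) ?_
    push_cast
    linear_combination hm
  induction l with
  | zero =>
    intro P hP
    let A : Submodule ℂ (Ply p q) :=
      { carrier := {P | InL L P (α - ((0 + n : ℕ) : ℂ))}
        add_mem' := fun h1 h2 => InL.add h1 h2
        zero_mem' := InL.zero
        smul_mem' := fun c _ h1 => InL.smul c h1 }
    refine map_mem_of_mo LinearMap.id A (fun d h1 h2 => ?_) hP
    change InL L (mo d) (α - ((0 + n : ℕ) : ℂ))
    rw [zero_add] at h1 ⊢
    have hle : d (Sum.inl (Sum.inl i0)) ≤ n := by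
      rw [← h1, degX]
      exact Finset.single_le_sum (f := fun a => d (Sum.inl a)) (fun _ _ => Nat.zero_le _)
        (Finset.mem_univ (Sum.inl i0))
    exact inL_base hL (hs n) i0 h0 (n - d (Sum.inl (Sum.inl i0))) d h1 h2 (by omega)
  | succ l ih =>
    have h1 := inL_succ hL (hs (l + n)) ih
    intro P hP
    rw [show l + 1 + n = l + n + 1 by ring] at hP
    convert h1 P hP using 1
    push_cast
    ring

end LightCone

end

/-! ### Projection onto the highest weight vector by averaging. -/

open scoped Topology ContDiff UniformConvergence ComplexConjugate

noncomputable section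

namespace LightCone

set_option linter.unusedSectionVars false

open MeasureTheory Filter

variable {p q : ℕ}

/-! ### Averages over the maximal compact subgroup -/

section Averaging

variable {α β : ℂ}

instance : TopologicalSpace.SeparableSpace (K p q) := inferInstance

lemma smoothFamily_act {f : X0 p q → ℂ} (hf : f ∈ S p q α β) {d : ℕ} (φ : SmoothParam p q d) :
    SmoothFamily fun (k : K p q) u => f (act (toU k) (φ.toFun u)) := by
  refine smoothFamily_comp hf (e := entries) continuous_entries
    (ψ := fun x => ((fun i => ∑ j, x.1.1 i j * (φ.toFun x.2).1.1 j : Fin p → ℂ),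
      (fun i => ∑ j, x.1.2 i j * (φ.toFun x.2).1.2 j : Fin q → ℂ))) (fun k u => ?_)
    fun k u => rfl
  have hφ : ContDiff ℝ ∞ fun u => (φ.toFun u).1 := φ.contDiff
  refine ContDiff.contDiffAt (ContDiff.prodMk ?_ ?_)
  · refine contDiff_pi.2 fun i => ContDiff.sum fun j _ => ContDiff.mul ?_ ?_
    · exact ((ContinuousLinearMap.proj (R := ℝ) (φ := fun _ : Fin p => ℂ) j).comp
        (ContinuousLinearMap.proj (R := ℝ) (φ := fun _ : Fin p => Fin p → ℂ) i)).contDiff.comp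
        (contDiff_fst.comp contDiff_fst)
    · exact (ContinuousLinearMap.proj (R := ℝ) (φ := fun _ : Fin p => ℂ) j).contDiff.comp
        (contDiff_fst.comp (hφ.comp contDiff_snd))
  · refine contDiff_pi.2 fun i => ContDiff.sum fun j _ => ContDiff.mul ?_ ?_
    · exact ((ContinuousLinearMap.proj (R := ℝ) (φ := fun _ : Fin q => ℂ) j).comp
        (ContinuousLinearMap.proj (R := ℝ) (φ := fun _ : Fin q => Fin q → ℂ) i)).contDiff.comp
        (contDiff_snd.comp contDiff_fst)
    · exact (ContinuousLinearMap.proj (R := ℝ) (φ := fun _ : Fin q => ℂ) j).contDiff.comp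
        (contDiff_snd.comp (hφ.comp contDiff_snd))

/-- Closed invariant submodules are stable under averaging over `U(p) × U(q)`. -/
lemma mem_of_average {W : Submodule ℂ (S p q α β)}
    (hW : IsClosed[smoothTopology p q α β] (W : Set (S p q α β)))
    (hinv : ∀ g : U p q, ∀ f ∈ W, rho p q α β g f ∈ W) {f : S p q α β} (hf : f ∈ W)
    {Φ : K p q → ℂ} (hΦ : Continuous Φ) {g : S p q α β}
    (hg : ∀ η, ∫ k, Φ k * f.1 (act (toU k) η) ∂haarK p q = g.1 η) : g ∈ W := by
  obtain ⟨B, hB⟩ := isCompact_univ.exists_bound_of_continuousOn hΦ.continuousOn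
  have hB' : ∀ k, ‖Φ k‖ ≤ B := fun k => hB k trivial
  -- Approximating the identity of the group by simple functions turns the average into finite
  -- combinations of translates, which lie in W; they converge in the smooth topology.
  let σ : ℕ → SimpleFunc (K p q) (K p q) :=
    SimpleFunc.approxOn id measurable_id Set.univ 1 trivial
  have hσ : ∀ k, Tendsto (fun n => σ n k) atTop (𝓝 k) := fun k =>
    SimpleFunc.tendsto_approxOn (f := id) (s := Set.univ) measurable_id trivial (by simp)
  have hrho : ∀ k : K p q, (⟨fun η => f.1 (act (toU k) η), comp_act_mem _ f.2⟩ : S p q α β) ∈ W := by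
    intro k
    have h := hinv (toU k)⁻¹ f hf
    have h2 : rho p q α β (toU k)⁻¹ f = ⟨fun η => f.1 (act (toU k) η), comp_act_mem _ f.2⟩ := by
      refine Subtype.ext (funext fun η => ?_)
      change f.1 (act (toU k)⁻¹⁻¹ η) = _
      rw [inv_inv]
    rwa [h2] at h
  let F : ℕ → S p q α β := fun n => ∑ r ∈ (σ n).range,
    (∫ k, (σ n ⁻¹' {r}).indicator Φ k ∂haarK p q) •
      (⟨fun η => f.1 (act (toU r) η), comp_act_mem _ f.2⟩ : S p q α β)
  have hF : ∀ n, F n ∈ W := fun n => W.sum_mem fun r _ => W.smul_mem _ (hrho r)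
  have hF' : ∀ n η, (F n).1 η = ∫ k, Φ k • f.1 (act (toU (σ n k)) η) ∂haarK p q := by
    intro n η
    have h1 : (F n).1 η = ∑ r ∈ (σ n).range,
        (∫ k, (σ n ⁻¹' {r}).indicator Φ k ∂haarK p q) * f.1 (act (toU r) η) := by
      simp [F, Finset.sum_apply]
    have h2 : ∀ k, Φ k • f.1 (act (toU (σ n k)) η) = ∑ r ∈ (σ n).range,
        (σ n ⁻¹' {r}).indicator Φ k * f.1 (act (toU r) η) := by
      intro k
      rw [Finset.sum_eq_single (σ n k)]
      · simp
      · intro r _ hr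
        rw [Set.indicator_of_notMem, zero_mul]
        exact fun h => hr (Eq.symm h)
      · exact fun h => absurd ((σ n).mem_range_self k) h
    rw [h1, integral_congr_ae (Eventually.of_forall h2), integral_finsetSum]
    · exact Finset.sum_congr rfl fun r _ => (integral_mul_const _ _).symm
    · exact fun r _ => ((hΦ.integrable_of_hasCompactSupport
        (HasCompactSupport.of_compactSpace Φ)).indicator
        ((σ n).measurableSet_preimage _)).mul_const _
  refine mem_of_tendsto_smoothTopology hW (l := atTop) (f := F) (Eventually.of_forall hF)
    fun d φ k C hC => ?_
  have hconv := tendstoUniformlyOn_average (smoothFamily_act f.2 φ) (l := atTop)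
    (ν := fun _ : ℕ => haarK p q) (b := 1) (fun _ => by simp) hΦ.stronglyMeasurable hB'
    (σ := fun n => σ n) (fun n => (σ n).measurable) (τ := id) measurable_id
    (tendstoInMeasure_iff_measureReal_dist.1 (tendstoInMeasure_of_tendsto_ae
      (fun n => (σ n).stronglyMeasurable.aestronglyMeasurable)
      (Eventually.of_forall fun k => hσ k)))
    (g := fun u => g.1 (φ.toFun u)) (fun _ u => hg _) k hC
  refine hconv.congr (Eventually.of_forall fun n u _ => ?_)
  simp only [hF']

variable [NeZero p] [NeZero q]

lemma exists_dilate_orbX (η : X0 p q) : ∃ (t : ℂˣ) (k : K p q), dilate t (orbX k) = η := by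
  have hr := Real.sqrt_pos.2 (rz_pos η)
  have hr' : ((√(rz η.1) : ℝ) : ℂ) ≠ 0 := by exact_mod_cast hr.ne'
  obtain ⟨k, hk⟩ := exists_orbX_eq ⟨proj η.1, proj_mem (mem_Opn η)⟩ (rz_proj (mem_Opn η))
  refine ⟨Units.mk0 _ hr', k, ?_⟩
  rw [hk]
  refine Subtype.ext ?_
  change ((√(rz η.1) : ℝ) : ℂ) • proj η.1 = η.1
  rw [proj, ← rz_eq_rw' η]
  refine Prod.ext ?_ ?_
  · change ((√(rz η.1) : ℝ) : ℂ) • ((√(rz η.1))⁻¹ • η.1.1) = η.1.1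
    rw [Complex.coe_smul, smul_smul, mul_inv_cancel₀ hr.ne', one_smul]
  · change ((√(rz η.1) : ℝ) : ℂ) • ((√(rz η.1))⁻¹ • η.1.2) = η.1.2
    rw [Complex.coe_smul, smul_smul, mul_inv_cancel₀ hr.ne', one_smul]

/-- A diagonal element of `U(p)` fixing the first basis vector. -/
def diagK (u : ℂ) (hu : u * conj u = 1) : K p q :=
  (⟨Matrix.diagonal fun i => if i = 0 then 1 else u, by
    rw [Matrix.mem_unitaryGroup_iff, Matrix.star_eq_conjTranspose, Matrix.diagonal_conjTranspose,
      Matrix.diagonal_mul_diagonal, ← Matrix.diagonal_one]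
    congr 1
    funext i
    by_cases hi : i = 0 <;> simp [hi, hu]⟩, 1)

lemma orb_mul_diagK (k : K p q) (u : ℂ) (hu : u * conj u = 1) :
    orb (k * diagK u hu) = orb k := by
  refine Prod.ext ?_ ?_
  · funext i
    change (k.1.1 * Matrix.diagonal (fun i => if i = 0 then 1 else u) : Matrix _ _ ℂ) i 0 =
      k.1.1 i 0
    simp [Matrix.mul_diagonal]
  · funext j
    change (k.2 * 1).1 j 0 = k.2.1 j 0
    rw [mul_one]

/-- The points exp(in) are distinct because π is irrational. -/
lemma infinite_circle : {u : ℂ | u * conj u = 1}.Infinite := by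
  have h2 : Set.Infinite (Set.range fun n : ℕ => Complex.exp ((n : ℂ) * Complex.I)) := by
    refine Set.infinite_range_of_injective fun m n hmn => ?_
    simp only [Complex.exp_eq_exp_iff_exists_int] at hmn
    obtain ⟨z, hz⟩ := hmn
    have h3 : (m : ℂ) = n + z * (2 * Real.pi) := by
      refine mul_right_cancel₀ Complex.I_ne_zero ?_
      rw [hz]; ring
    have h4 : (m : ℝ) = n + z * (2 * Real.pi) := by exact_mod_cast h3
    by_cases hz0 : z = 0
    · rw [hz0] at h4
      simpa using h4
    · exfalso
      refine irrational_pi ⟨(m - n) / (2 * z), ?_⟩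
      have : (z : ℝ) ≠ 0 := by exact_mod_cast hz0
      push_cast
      field_simp
      linear_combination h4
  refine h2.mono ?_
  rintro _ ⟨n, rfl⟩
  change Complex.exp (n * Complex.I) * conj (Complex.exp (n * Complex.I)) = 1
  rw [← Complex.exp_conj, map_mul, Complex.conj_I, Complex.conj_natCast, ← Complex.exp_add]
  simp

lemma polynomial_eq_of_circle {P Q : Polynomial ℂ}
    (h : ∀ u : ℂ, u * conj u = 1 → P.eval u = Q.eval u) : P = Q :=
  Polynomial.eq_of_infinite_eval_eq P Q (infinite_circle.mono fun u hu => h u hu)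

/-- Invariance under a circle of group elements is converted into an evaluation at the centre u = 0,
where only the leading term of a binomial survives. -/
lemma polynomial_eq_of_const {P : Polynomial ℂ} {c : ℂ}
    (h : ∀ u : ℂ, u * conj u = 1 → P.eval u = c) : P.eval 0 = c := by
  rw [polynomial_eq_of_circle (P := P) (Q := Polynomial.C c) fun u hu => by
    rw [h u hu, Polynomial.eval_C], Polynomial.eval_C]

lemma eval_integral_pow {a b F : K p q → ℂ} (ha : Continuous a) (hb : Continuous b)
    (hF : Continuous F) (n : ℕ) : ∃ P : Polynomial ℂ, ∀ u : ℂ,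
      P.eval u = ∫ k, (a k + u * b k) ^ n * F k ∂haarK p q := by
  refine ⟨∑ m ∈ Finset.range (n + 1), Polynomial.C
    (∫ k, a k ^ (n - m) * b k ^ m * (n.choose m) * F k ∂haarK p q) * Polynomial.X ^ m, fun u => ?_⟩
  have h1 : ∀ k, (a k + u * b k) ^ n * F k = ∑ m ∈ Finset.range (n + 1),
      (a k ^ (n - m) * b k ^ m * (n.choose m) * F k) * u ^ m := by
    intro k
    rw [add_comm, add_pow, Finset.sum_mul]
    exact Finset.sum_congr rfl fun m _ => by ring
  simp only [h1]
  rw [integral_finsetSum]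
  · rw [Polynomial.eval_finsetSum]
    refine Finset.sum_congr rfl fun m _ => ?_
    rw [integral_mul_const]
    simp
  · exact fun m _ => integrable_K (by fun_prop)

lemma act_toU_orbX (k l : K p q) : act (toU k) (orbX l) = orbX (k * l) :=
  Subtype.ext (orb_mul k l).symm

/-- Convolution with a power of a matrix coefficient. -/
lemma average_orbX {f : X0 p q → ℂ} (hf : IsSmooth f) (n : ℕ) (l : K p q) :
    ∫ k, conj (k.1.1 0 0) ^ n * f (orbX (k * l)) ∂haarK p q =
      (l.1.1 0 0) ^ n * ∫ k, conj (k.1.1 0 0) ^ n * f (orbX k) ∂haarK p q := by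
  have hfc := continuous_orbX_comp (p := p) (q := q) hf
  have h1 : ∫ k, conj (k.1.1 0 0) ^ n * f (orbX (k * l)) ∂haarK p q =
      ∫ k, (∑ j, conj (k.1.1 0 j) * l.1.1 0 j) ^ n * f (orbX k) ∂haarK p q := by
    rw [← integral_mul_right_eq_self (μ := haarK p q) _ l⁻¹]
    refine integral_congr_ae (Eventually.of_forall fun k => ?_)
    have : (k * l⁻¹).1.1 0 0 = ∑ j, k.1.1 0 j * conj (l.1.1 0 j) := by
      change (k.1.1 * star l.1.1) 0 0 = _
      rw [Matrix.mul_apply]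
      rfl
    simp only [inv_mul_cancel_right, this, map_sum, map_mul, Complex.conj_conj]
  -- The part a carries the first matrix column, which the orbit point sees; b collects the other
  -- columns and has to be shown to contribute nothing.
  set a : K p q → ℂ := fun k => conj (k.1.1 0 0) * l.1.1 0 0
  set b : K p q → ℂ := fun k => ∑ j ∈ Finset.univ.erase 0, conj (k.1.1 0 j) * l.1.1 0 j
  have ha : Continuous a :=
    (Complex.continuous_conj.comp (continuous_fst_entry 0 0)).mul continuous_const
  have hb : Continuous b := continuous_finsetSum _ fun j _ =>
    (Complex.continuous_conj.comp (continuous_fst_entry 0 j)).mul continuous_const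
  have hab : ∀ k : K p q, ∑ j, conj (k.1.1 0 j) * l.1.1 0 j = a k + b k := fun k =>
    (Finset.add_sum_erase _ _ (Finset.mem_univ 0)).symm
  obtain ⟨P, hP⟩ := eval_integral_pow ha hb hfc n
  -- Right translation by diag(1, conj u, ..., conj u) fixes the orbit point and replaces b by u b,
  -- so the integral is a polynomial in u that is constant on the circle.
  have h2 : ∀ u : ℂ, u * conj u = 1 →
      P.eval u = ∫ k, (∑ j, conj (k.1.1 0 j) * l.1.1 0 j) ^ n * f (orbX k) ∂haarK p q := by
    intro u hu
    have hu' : conj u * conj (conj u) = 1 := by rw [Complex.conj_conj, mul_comm, hu]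
    rw [hP, ← integral_mul_right_eq_self (μ := haarK p q)
      (fun k => (∑ j, conj (k.1.1 0 j) * l.1.1 0 j) ^ n * f (orbX k)) (diagK (conj u) hu')]
    refine integral_congr_ae (Eventually.of_forall fun k => ?_)
    have h3 : orbX (k * diagK (conj u) hu') = orbX k := Subtype.ext (orb_mul_diagK k _ hu')
    have h4 : ∀ j, (k * diagK (conj u) hu').1.1 0 j = k.1.1 0 j * if j = 0 then 1 else conj u := by
      intro j
      change (k.1.1 * Matrix.diagonal (fun i => if i = 0 then 1 else conj u) : Matrix _ _ ℂ) 0 j = _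
      rw [Matrix.mul_diagonal]
    dsimp only
    rw [h3]
    congr 2
    rw [← Finset.add_sum_erase _ _ (Finset.mem_univ (0 : Fin p)), h4, if_pos rfl, mul_one,
      Finset.mul_sum]
    congr 1
    refine Finset.sum_congr rfl fun j hj => ?_
    rw [h4, if_neg (Finset.ne_of_mem_erase hj), map_mul, Complex.conj_conj]
    ring
  rw [h1, ← polynomial_eq_of_const h2, hP, ← integral_const_mul]
  refine integral_congr_ae (Eventually.of_forall fun k => ?_)
  simp only [a, zero_mul, add_zero, mul_pow]
  ring

lemma ev_mo_pow_orb (n : ℕ) (k : K p q) :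
    ev (orb k) (mo (n • eX (Sum.inl 0))) = k.1.1 0 0 ^ n := by
  have h : mo (n • eX (Sum.inl (0 : Fin p))) = (cX (Sum.inl 0) : Ply p q) ^ n := by
    induction n with
    | zero => simp [mo]
    | succ n ih => rw [succ_nsmul, ← cX_mul_mo, ih, pow_succ, mul_comm]
  rw [h, map_pow, ev_cX]
  rfl

lemma mo_pow_mem (n : ℕ) : mo (n • eX (Sum.inl (0 : Fin p))) ∈ Bi p q n 0 := by
  convert mo_mem_Bi (n • eX (Sum.inl (0 : Fin p)) : Expo p q)
  · simp [degX, eX, Finsupp.single_apply]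
  · simp [degY, eX]

/-- A closed invariant submodule with a vector having a nonzero highest weight coefficient
contains the highest weight vector. -/
lemma inL_pow_of_integral_ne {W : Submodule ℂ (S p q α β)}
    (hW : IsClosed[smoothTopology p q α β] (W : Set (S p q α β)))
    (hinv : ∀ g : U p q, ∀ f ∈ W, rho p q α β g f ∈ W) {n : ℕ} (hn : α - β = n)
    {f : S p q α β} (hf : f ∈ W)
    (hc : ∫ k, f.1 (orbX k) * conj (k.1.1 0 0 ^ n) ∂haarK p q ≠ 0) :
    InL W (mo (n • eX (Sum.inl 0))) β := by
  set c := ∫ k, f.1 (orbX k) * conj (k.1.1 0 0 ^ n) ∂haarK p q with hcdef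
  have hmem := ev_mul_pw_mem_S (mo_pow_mem (p := p) (q := q) n) (α := α) (β := β) (s := β)
    (by rw [← hn]; ring) (by simp)
  let g : S p q α β := c • ⟨_, hmem⟩
  have hg : g ∈ W := by
    -- Convolution with this matrix coefficient has rank one: it returns z_0^n multiplied by the
    -- coefficient c.
    refine mem_of_average hW hinv hf (Φ := fun k => conj (k.1.1 0 0) ^ n)
      ((Complex.continuous_conj.comp (continuous_fst_entry 0 0)).pow n) fun η => ?_
    obtain ⟨t, l, rfl⟩ := exists_dilate_orbX η
    have h1 : ∀ k : K p q, act (toU k) (dilate t (orbX l)) = dilate t (orbX (k * l)) := by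
      intro k
      rw [← act_toU_orbX]
      exact Subtype.ext ((toU k).1.map_smul (t : ℂ) (orb l))
    simp only [h1, f.2.2]
    rw [g.2.2]
    have h2 : ∀ k : K p q, conj (k.1.1 0 0) ^ n * (psi α β t * f.1 (orbX (k * l))) =
        psi α β t * (conj (k.1.1 0 0) ^ n * f.1 (orbX (k * l))) := fun k => by ring
    simp only [h2]
    rw [integral_const_mul, average_orbX f.2.1]
    congr 1
    change _ = c * (ev (orb l) _ * pw β (orb l))
    rw [ev_mo_pow_orb, pw_of_rz_eq_one _ (rz_orb l), mul_one, mul_comm, hcdef]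
    congr 1
    exact integral_congr_ae (Eventually.of_forall fun k => by simp only [map_pow]; ring)
  refine ⟨_, (W.smul_mem_iff hc).1 hg, fun η => rfl⟩

end Averaging

end LightCone

end

/-! ### Polynomial approximate identities on a ball. -/

open scoped Topology ContDiff UniformConvergence ComplexConjugate

noncomputable section

namespace LightCone

set_option linter.unusedSectionVars false

open MeasureTheory Filter

variable {p q : ℕ}

/-! ### Density of functions of polynomial type -/

section Density

instance (n : ℕ) : (volume : Measure (Fin n → ℂ)).IsAddHaarMeasure :=
  inferInstanceAs (Measure.pi fun _ : Fin n => (volume : Measure ℂ)).IsAddHaarMeasure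

instance : (volume : Measure (V p q)).IsAddHaarMeasure :=
  inferInstanceAs (((volume : Measure (Fin p → ℂ)).prod (volume : Measure (Fin q → ℂ)))
    ).IsAddHaarMeasure

/-- The squared Euclidean norm. -/
def nn (v : V p q) : ℝ := rz v + rw' v

lemma continuous_nn : Continuous (nn : V p q → ℝ) :=
  contDiff_rz.continuous.add contDiff_rw'.continuous

lemma nn_nonneg (v : V p q) : 0 ≤ nn v := add_nonneg (rz_nonneg v) (rw'_nonneg v)

lemma nn_zero : nn (0 : V p q) = 0 := by simp [nn, rz, rw']

lemma nn_eq_zero {v : V p q} (h : nn v = 0) : v = 0 := by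
  have h1 : rz v = 0 := le_antisymm (by have := rw'_nonneg v; rw [nn] at h; linarith) (rz_nonneg v)
  have h2 : rw' v = 0 := by rw [nn, h1, zero_add] at h; exact h
  exact Prod.ext (rz_eq_zero.1 h1) (rw'_eq_zero.1 h2)

lemma normSq_sub_le (a b : ℂ) :
    Complex.normSq (a - b) ≤ 2 * Complex.normSq a + 2 * Complex.normSq b := by
  simp only [Complex.normSq_apply, Complex.sub_re, Complex.sub_im]
  nlinarith [sq_nonneg (a.re + b.re), sq_nonneg (a.im + b.im)]

lemma nn_sub_le (v w : V p q) : nn (v - w) ≤ 2 * nn v + 2 * nn w := by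
  have h1 : rz (v - w) ≤ 2 * rz v + 2 * rz w := by
    rw [rz, rz, rz, Finset.mul_sum, Finset.mul_sum, ← Finset.sum_add_distrib]
    exact Finset.sum_le_sum fun i _ => normSq_sub_le _ _
  have h2 : rw' (v - w) ≤ 2 * rw' v + 2 * rw' w := by
    rw [rw', rw', rw', Finset.mul_sum, Finset.mul_sum, ← Finset.sum_add_distrib]
    exact Finset.sum_le_sum fun i _ => normSq_sub_le _ _
  rw [nn, nn, nn]; linarith

/-- A compact Euclidean ball. -/
def Ball20 (p q : ℕ) : Set (V p q) := {v | nn v ≤ 20}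

lemma isCompact_Ball20 : IsCompact (Ball20 p q) := by
  refine Metric.isCompact_of_isClosed_isBounded (isClosed_le continuous_nn continuous_const) ?_
  refine isBounded_iff_forall_norm_le.2 ⟨5, fun v hv => ?_⟩
  have hc : ∀ c : ℂ, Complex.normSq c ≤ 20 → ‖c‖ ≤ 5 := by
    intro c hc
    rw [Complex.normSq_eq_norm_sq] at hc
    nlinarith [norm_nonneg c]
  have h1 : rz v ≤ 20 := by
    have := rw'_nonneg v
    change rz v + rw' v ≤ 20 at hv
    linarith
  have h2 : rw' v ≤ 20 := by
    have := rz_nonneg v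
    change rz v + rw' v ≤ 20 at hv
    linarith
  rw [Prod.norm_def]
  refine max_le ((pi_norm_le_iff_of_nonneg (by norm_num)).2 fun i => hc _ ?_)
    ((pi_norm_le_iff_of_nonneg (by norm_num)).2 fun i => hc _ ?_)
  · exact (Finset.single_le_sum (f := fun i => Complex.normSq (v.1 i))
      (fun i _ => Complex.normSq_nonneg _) (Finset.mem_univ i)).trans h1
  · exact (Finset.single_le_sum (f := fun i => Complex.normSq (v.2 i))
      (fun i _ => Complex.normSq_nonneg _) (Finset.mem_univ i)).trans h2

instance : CompactSpace (Ball20 p q) := isCompact_iff_compactSpace.1 isCompact_Ball20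

/-- The base of the polynomial kernels. -/
def ker20 (v : V p q) : ℝ := 1 - nn v / 20

lemma continuous_ker20 : Continuous (ker20 : V p q → ℝ) :=
  continuous_const.sub (continuous_nn.div_const 20)

lemma ker20_nonneg {v : V p q} (hv : v ∈ Ball20 p q) : 0 ≤ ker20 v := by
  change nn v ≤ 20 at hv
  rw [ker20]; linarith

lemma zero_mem_Ball20 : (0 : V p q) ∈ Ball20 p q := by
  change nn 0 ≤ 20
  rw [nn_zero]; norm_num

/-- The mass of the unnormalized kernel. -/
def mass20 (p q m : ℕ) : ℝ := ∫ y in Ball20 p q, ker20 y ^ m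

lemma mass20_pos (m : ℕ) : 0 < mass20 p q m := by
  rw [mass20, setIntegral_pos_iff_support_of_nonneg_ae]
  · have h1 : {v : V p q | nn v < 20} ⊆ (Function.support fun y => ker20 y ^ m) ∩ Ball20 p q := by
      intro v hv
      change nn v < 20 at hv
      refine ⟨pow_ne_zero _ ?_, hv.le⟩
      rw [ker20]
      linarith
    exact ((isOpen_lt continuous_nn continuous_const).measure_pos volume
      ⟨0, by rw [Set.mem_ofPred_eq, nn_zero]; norm_num⟩).trans_le (measure_mono h1)
  · exact (ae_restrict_iff' isCompact_Ball20.measurableSet).2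
      (Eventually.of_forall fun v hv => pow_nonneg (ker20_nonneg hv) m)
  · exact ((continuous_ker20.pow m).continuousOn).integrableOn_compact isCompact_Ball20

/-- The probability measures given by the polynomial kernels. -/
def nu20 (p q m : ℕ) : Measure (V p q) :=
  (volume.restrict (Ball20 p q)).withDensity
    fun y => (Real.toNNReal ((mass20 p q m)⁻¹ * ker20 y ^ m) : NNReal)

lemma integral_nu20 {E : Type} [NormedAddCommGroup E] [NormedSpace ℝ E] (m : ℕ) (h : V p q → E) :
    ∫ y, h y ∂nu20 p q m = (mass20 p q m)⁻¹ • ∫ y in Ball20 p q, ker20 y ^ m • h y := by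
  rw [nu20, integral_withDensity_eq_integral_smul
    (f := fun y => Real.toNNReal ((mass20 p q m)⁻¹ * ker20 y ^ m))
    (continuous_const.mul (continuous_ker20.pow m)).measurable.real_toNNReal, ← integral_smul]
  refine setIntegral_congr_fun isCompact_Ball20.measurableSet fun y hy => ?_
  rw [NNReal.smul_def, Real.coe_toNNReal _ (mul_nonneg (inv_nonneg.2 (mass20_pos m).le)
    (pow_nonneg (ker20_nonneg hy) m)), mul_smul]

instance (m : ℕ) : IsFiniteMeasure (nu20 p q m) := by
  refine isFiniteMeasure_withDensity_ofReal ?_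
  exact (((continuous_const.mul (continuous_ker20.pow m)).continuousOn).integrableOn_compact
    isCompact_Ball20).2

lemma nu20_univ (m : ℕ) : (nu20 p q m).real Set.univ = 1 := by
  have h := integral_nu20 (p := p) (q := q) m (fun _ => (1 : ℝ))
  rw [integral_const, smul_eq_mul, mul_one] at h
  rw [h, smul_eq_mul]
  simp only [smul_eq_mul, mul_one]
  exact inv_mul_cancel₀ (mass20_pos m).ne'

/-- The base of the kernel has a strict maximum at 0, so its normalized powers concentrate there.
The mean of the norm tends to 0, and the tail bound is Markov's inequality. -/
lemma tendsto_nu20 {δ : ℝ} (hδ : 0 < δ) :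
    Tendsto (fun m => (nu20 p q m).real {y | δ ≤ ‖y‖}) atTop (𝓝 0) := by
  have h1 : Tendsto (fun m => ∫ y, ‖y‖ / δ ∂nu20 p q m) atTop (𝓝 (‖(0 : V p q)‖ / δ)) := by
    simp only [integral_nu20]
    refine tendsto_setIntegral_pow_smul_of_unique_maximum_of_isCompact_of_continuousOn
      isCompact_Ball20 continuous_ker20.continuousOn (fun y _ hy0 => ?_)
      (fun y hy => ker20_nonneg hy) ?_ ?_ (by fun_prop)
    · have : 0 < nn y := lt_of_le_of_ne (nn_nonneg y) fun h => hy0 (nn_eq_zero h.symm)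
      rw [ker20, ker20, nn_zero]; linarith
    · rw [ker20, nn_zero]; norm_num
    · refine subset_closure (mem_interior_iff_mem_nhds.2 ?_)
      exact mem_of_superset ((isOpen_lt continuous_nn continuous_const).mem_nhds
        (show nn (0 : V p q) < 20 by rw [nn_zero]; norm_num)) fun v (hv : nn v < 20) => hv.le
  rw [norm_zero, zero_div] at h1
  refine squeeze_zero (fun _ => measureReal_nonneg) (fun m => ?_) h1
  have hmeas : MeasurableSet {y : V p q | δ ≤ ‖y‖} :=
    (isClosed_le continuous_const continuous_norm).measurableSet
  rw [← integral_indicator_one hmeas, integral_nu20, integral_nu20]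
  refine smul_le_smul_of_nonneg_left ?_ (inv_nonneg.2 (mass20_pos m).le)
  refine setIntegral_mono_on ?_ ?_ isCompact_Ball20.measurableSet fun y hy => ?_
  · have h2 : IntegrableOn (fun y : V p q => ker20 y ^ m) (Ball20 p q) :=
      ((continuous_ker20.pow m).continuousOn).integrableOn_compact isCompact_Ball20
    refine (h2.indicator hmeas).congr (Eventually.of_forall fun y => ?_)
    by_cases hy : y ∈ {y : V p q | δ ≤ ‖y‖} <;> simp [Set.indicator, hy]
  · exact ContinuousOn.integrableOn_compact isCompact_Ball20
      ((continuous_ker20.pow m).smul (continuous_norm.div_const δ)).continuousOn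
  · refine smul_le_smul_of_nonneg_left ?_ (pow_nonneg (ker20_nonneg hy) m)
    by_cases hy' : δ ≤ ‖y‖
    · simpa [Set.indicator, hy'] using (one_le_div hδ).2 hy'
    · simp only [Set.indicator, Set.mem_ofPred_eq, hy', if_false]; positivity

/-- The polynomial whose values are the kernel. -/
def kerP (p q : ℕ) : Ply p q := 1 - (1 / 20 : ℂ) • (rhoZ p q + rhoW p q)

lemma ev_kerP (v : V p q) : ev v (kerP p q) = (ker20 v : ℂ) := by
  rw [kerP, map_sub, map_one, map_smul, map_add, ev_rhoZ, ev_rhoW, ker20, nn, smul_eq_mul]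
  push_cast
  ring

/-- Convolutions of compactly supported functions with polynomials are polynomials. -/
lemma exists_convolution_eq (P : Ply p q) : ∀ F : V p q → ℂ, Continuous F → HasCompactSupport F →
    ∃ Q : Ply p q, ∀ x, ∫ y, F y * ev (x - y) P = ev x Q := by
  induction P using MvPolynomial.induction_on with
  | C c =>
    intro F _ _
    exact ⟨MvPolynomial.C (∫ y, F y * c), fun x => by simp [ev]⟩
  | add P P' hP hP' =>
    intro F hF hF'
    obtain ⟨Q, hQ⟩ := hP F hF hF'
    obtain ⟨Q', hQ'⟩ := hP' F hF hF'
    refine ⟨Q + Q', fun x => ?_⟩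
    rw [map_add, ← hQ, ← hQ', ← integral_add]
    · exact integral_congr_ae (Eventually.of_forall fun y => by simp only [map_add, mul_add])
    · exact (hF.mul ((contDiff_ev P).continuous.comp (continuous_const.sub continuous_id))
        ).integrable_of_hasCompactSupport hF'.mul_right
    · exact (hF.mul ((contDiff_ev P').continuous.comp (continuous_const.sub continuous_id))
        ).integrable_of_hasCompactSupport hF'.mul_right
  | mul_X P a hP =>
    intro F hF hF'
    have key : ∀ (X : V p q →L[ℝ] ℂ) (Y : Ply p q), (∀ v, ev v Y = X v) →
        ∃ Q : Ply p q, ∀ x, ∫ y, F y * ev (x - y) (P * Y) = ev x Q := by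
      intro X Y hXY
      obtain ⟨Q, hQ⟩ := hP F hF hF'
      -- A coordinate is additive, X(x - y) = X(x) - X(y): the first term leaves the integral and
      -- the second is absorbed into F. This is why F varies in the induction.
      obtain ⟨Q', hQ'⟩ := hP (fun y => F y * X y) (hF.mul X.continuous) hF'.mul_right
      refine ⟨Q * Y - Q', fun x => ?_⟩
      rw [map_sub, map_mul, ← hQ, ← hQ', hXY, ← integral_mul_const, ← integral_sub]
      · refine integral_congr_ae (Eventually.of_forall fun y => ?_)
        simp only [map_mul, hXY, map_sub]
        ring
      · exact ((hF.mul ((contDiff_ev P).continuous.comp (continuous_const.sub continuous_id))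
          ).integrable_of_hasCompactSupport hF'.mul_right).mul_const _
      · exact ((hF.mul X.continuous).mul ((contDiff_ev P).continuous.comp
          (continuous_const.sub continuous_id))).integrable_of_hasCompactSupport
          hF'.mul_right.mul_right
    rcases a with a | a
    · exact key (crdL a) (cX a) fun v => by rw [ev_cX, crdL_apply]
    · exact key (crdbL a) (cY a) fun v => by rw [ev_cY, crdbL_apply]

/-- The part of a polynomial that is homogeneous of degree `n` under the circle. -/
lemma exists_type_part (P : Ply p q) (n : ℕ) : ∃ t : Finset (Expo p q),
    (∀ d ∈ t, degX d = degY d + n) ∧ ∀ x : V p q,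
      (∀ u : ℂ, u * conj u = 1 → ev (u • x) P = u ^ n * ev x P) →
      ev x P = ∑ d ∈ t, P.coeff d * ev x (mo d) := by
  refine ⟨P.support.filter fun d => degX d = degY d + n, fun d hd => (Finset.mem_filter.1 hd).2,
    fun x hx => ?_⟩
  have hP : ∀ v : V p q, ev v P = ∑ d ∈ P.support, P.coeff d * ev v (mo d) := by
    intro v
    conv_lhs => rw [P.as_sum]
    rw [map_sum]
    refine Finset.sum_congr rfl fun d _ => ?_
    rw [← smul_eq_mul, ← map_smul, mo, MvPolynomial.smul_monomial, smul_eq_mul, mul_one]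
  set M := P.support.sup degY
  have hM : ∀ d ∈ P.support, degY d ≤ M := fun d hd => Finset.le_sup hd
  -- On the circle conj u is the inverse of u, so multiplication by u^M clears the negative powers.
  -- Comparing coefficients of u^(n+M) selects the monomials with degX - degY = n.
  have h1 : (∑ d ∈ P.support, Polynomial.C (P.coeff d * ev x (mo d)) *
      Polynomial.X ^ (degX d + (M - degY d)) : Polynomial ℂ) =
      Polynomial.C (ev x P) * Polynomial.X ^ (n + M) := by
    refine polynomial_eq_of_circle fun u hu => ?_
    rw [Polynomial.eval_finsetSum]
    have h2 := hx u hu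
    rw [hP (u • x)] at h2
    simp only [Polynomial.eval_mul, Polynomial.eval_C, Polynomial.eval_pow, Polynomial.eval_X]
    rw [show ev x P * u ^ (n + M) = u ^ n * ev x P * u ^ M by ring, ← h2, Finset.sum_mul]
    refine Finset.sum_congr rfl fun d hd => ?_
    rw [ev_smul u x (mo_mem_Bi d)]
    have h3 : conj u ^ degY d * u ^ M = u ^ (M - degY d) := by
      conv_lhs => rw [← Nat.add_sub_cancel' (hM d hd), pow_add, ← mul_assoc, ← mul_pow,
        mul_comm (conj u), hu, one_pow, one_mul]
    rw [pow_add, ← h3]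
    ring
  have h4 := congrArg (fun A => A.coeff (n + M)) h1
  simp only [Polynomial.finsetSum_coeff, Polynomial.coeff_C_mul, Polynomial.coeff_X_pow,
    if_true, mul_one] at h4
  rw [← h4, Finset.sum_filter]
  refine Finset.sum_congr rfl fun d hd => ?_
  have := hM d hd
  by_cases hd' : degX d = degY d + n
  · rw [if_pos hd', if_pos (by omega), mul_one]
  · rw [if_neg hd', if_neg (by omega), mul_zero]

end Density

end LightCone

end

/-! ### Density in the smooth topology. -/

open scoped Topology ContDiff UniformConvergence ComplexConjugate

noncomputable section

namespace LightCone

set_option linter.unusedSectionVars false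

open MeasureTheory Filter

variable {p q : ℕ} {α β : ℂ}

section Cutoff

/-- A smooth cutoff function around `1`. -/
def bump1 : ContDiffBump (1 : ℝ) := ⟨1 / 4, 1 / 2, by norm_num, by norm_num⟩

/-- A compactly supported extension of a homogeneous function restricted to the product of the
unit spheres. -/
def cutExt (α β : ℂ) (f : X0 p q → ℂ) (v : V p q) : ℂ :=
  ((bump1 (rz v) * bump1 (rw' v) : ℝ) : ℂ) * ext α β f v

lemma cutExt_eq_zero {f : X0 p q → ℂ} {v : V p q}
    (h : ¬(1 / 2 < rz v ∧ rz v < 3 / 2 ∧ 1 / 2 < rw' v ∧ rw' v < 3 / 2)) : cutExt α β f v = 0 := by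
  have key : ∀ x : ℝ, ¬(1 / 2 < x ∧ x < 3 / 2) → bump1 x = 0 := by
    intro x hx
    refine bump1.zero_of_le_dist ?_
    change 1 / 2 ≤ dist x 1
    rw [Real.dist_eq]
    by_contra! hlt
    rw [abs_lt] at hlt
    exact hx ⟨by linarith, by linarith⟩
  rw [cutExt]
  by_cases h1 : 1 / 2 < rz v ∧ rz v < 3 / 2
  · rw [key (rw' v) fun h2 => h ⟨h1.1, h1.2, h2⟩]; simp
  · rw [key (rz v) h1]; simp

lemma contDiff_cutExt {f : X0 p q → ℂ} (hf : IsSmooth f) : ContDiff ℝ ∞ (cutExt α β f) := by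
  refine contDiff_iff_contDiffAt.2 fun v => ?_
  by_cases hv : v ∈ Opn p q
  · refine ContDiffAt.mul ?_ (contDiffAt_ext hf hv)
    refine Complex.ofRealCLM.contDiff.contDiffAt.comp v ?_
    exact (bump1.contDiff.comp contDiff_rz).contDiffAt.mul
      (bump1.contDiff.comp contDiff_rw').contDiffAt
  · refine (contDiffAt_const (c := (0 : ℂ))).congr_of_eventuallyEq ?_
    have h1 : rz v < 1 / 2 ∨ rw' v < 1 / 2 := by
      by_contra! hc
      exact hv ⟨by linarith [hc.1], by linarith [hc.2]⟩
    rcases h1 with h1 | h1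
    · filter_upwards [(isOpen_lt contDiff_rz.continuous continuous_const).mem_nhds h1] with w hw
      exact cutExt_eq_zero fun h => lt_asymm h.1 hw
    · filter_upwards [(isOpen_lt contDiff_rw'.continuous continuous_const).mem_nhds h1] with w hw
      exact cutExt_eq_zero fun h => lt_asymm h.2.2.1 hw

lemma nn_le_of_cutExt_ne {f : X0 p q → ℂ} {v : V p q} (h : cutExt α β f v ≠ 0) : nn v ≤ 3 := by
  by_contra! hc
  refine h (cutExt_eq_zero fun h => ?_)
  rw [nn] at hc
  linarith [h.2.1, h.2.2.2]

lemma hasCompactSupport_cutExt {f : X0 p q → ℂ} : HasCompactSupport (cutExt α β f) :=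
  HasCompactSupport.intro isCompact_Ball20 fun v hv => by
    by_contra h
    exact hv ((nn_le_of_cutExt_ne h).trans (by norm_num))

lemma cutExt_proj {f : X0 p q → ℂ} {v : V p q} (hv : v ∈ Opn p q) :
    cutExt α β f (proj v) = zext f (proj v) := by
  have h1 : bump1 1 = 1 := bump1.one_of_mem_closedBall (by simp [bump1])
  rw [cutExt, rz_proj hv, rw'_proj hv, h1, ext, pw_of_rz_eq_one _ (rz_proj hv),
    proj_eq_self (rz_proj hv) (rw'_proj hv)]
  simp

lemma rz_circle {u : ℂ} (hu : u * conj u = 1) (v : V p q) : rz (u • v) = rz v := by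
  have h : Complex.normSq u = 1 := by
    rw [Complex.mul_conj] at hu; exact_mod_cast hu
  simp [rz, h]

lemma rw'_circle {u : ℂ} (hu : u * conj u = 1) (v : V p q) : rw' (u • v) = rw' v := by
  have h : Complex.normSq u = 1 := by
    rw [Complex.mul_conj] at hu; exact_mod_cast hu
  simp [rw', h]

lemma norm_circle {u : ℂ} (hu : u * conj u = 1) : ‖u‖ = 1 := by
  rw [Complex.mul_conj, Complex.normSq_eq_norm_sq] at hu
  have h2 : ‖u‖ ^ 2 = 1 := by exact_mod_cast hu
  exact (pow_eq_one_iff_of_nonneg (norm_nonneg _) two_ne_zero).1 h2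

lemma psi_circle {n : ℕ} (hn : α - β = n) {t : ℂˣ} (ht : (t : ℂ) * conj (t : ℂ) = 1) :
    psi α β t = (t : ℂ) ^ n := by
  rw [psi_eq (n := n) (by rw [hn]; simp), norm_circle ht]
  simp

lemma cutExt_circle {n : ℕ} (hn : α - β = n) {f : X0 p q → ℂ} (hf : f ∈ S p q α β) {u : ℂ}
    (hu : u * conj u = 1) (v : V p q) : cutExt α β f (u • v) = u ^ n * cutExt α β f v := by
  by_cases hv : v ∈ Opn p q
  · have hu0 : u ≠ 0 := fun h => by simp [h] at hu
    have h1 : proj (u • v) = u • proj v := by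
      rw [proj, rz_circle hu, rw'_circle hu]
      exact Prod.ext (smul_comm _ _ _) (smul_comm _ _ _)
    have h2 : zext f (u • proj v) = u ^ n * zext f (proj v) := by
      have h3 := hf.2 (Units.mk0 u hu0) ⟨proj v, proj_mem hv⟩
      rw [psi_circle hn (t := Units.mk0 u hu0) hu, ← zext_coe f, ← zext_coe f] at h3
      exact h3
    rw [cutExt, cutExt, rz_circle hu, rw'_circle hu, ext, ext, h1, h2, pw, pw, rz_circle hu]
    ring
  · rw [cutExt_eq_zero, cutExt_eq_zero, mul_zero]
    · exact fun h => hv ⟨by linarith [h.1], by linarith [h.2.2.1]⟩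
    · rw [rz_circle hu, rw'_circle hu]
      exact fun h => hv ⟨by linarith [h.1], by linarith [h.2.2.1]⟩

lemma measurePreserving_circle {u : ℂ} (hu : u * conj u = 1) :
    MeasurePreserving (fun v : V p q => u • v) volume volume := by
  have h1 : MeasurePreserving (fun z : ℂ => u * z) volume volume := by
    have hu' : u ∈ Submonoid.unitSphere ℂ := mem_sphere_zero_iff_norm.2 (norm_circle hu)
    exact (rotation ⟨u, hu'⟩).measurePreserving
  exact (volume_preserving_pi fun _ : Fin p => h1).prod (volume_preserving_pi fun _ : Fin q => h1)

instance : (volume : Measure (V p q)).IsNegInvariant := ⟨by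
  have h := measurePreserving_circle (p := p) (q := q) (u := -1) (by simp)
  simp only [neg_one_smul] at h
  exact h.map_eq⟩

end Cutoff

/-- The functions of polynomial type are dense. -/
theorem eq_top_of_inL {n : ℕ} (hn : α - β = n) {W : Submodule ℂ (S p q α β)}
    (hW : IsClosed[smoothTopology p q α β] (W : Set (S p q α β)))
    (h : ∀ l : ℕ, ∀ P ∈ Bi p q (l + n) l, InL W P (α - ((l + n : ℕ) : ℂ))) : W = ⊤ := by
  refine eq_top_iff.2 fun f _ => ?_
  set F := cutExt α β f.1 with hFdef
  have hF : ContDiff ℝ ∞ F := contDiff_cutExt f.2.1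
  have hF' : HasCompactSupport F := hasCompactSupport_cutExt
  set γ := (α + β) / 2 with hγ
  -- the convolution is a polynomial
  have hpoly : ∀ m : ℕ, ∃ P : Ply p q, ∀ x : V p q, nn x = 2 →
      ∫ y, F (x - y) ∂nu20 p q m = ev x P := by
    intro m
    obtain ⟨Q, hQ⟩ := exists_convolution_eq (kerP p q ^ m) F hF.continuous hF'
    refine ⟨((mass20 p q m)⁻¹ : ℂ) • Q, fun x hx => ?_⟩
    rw [integral_nu20, map_smul, ← hQ]
    -- For a point of squared norm 2 and a support of squared norm at most 3, y = x - (x - y) has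
    -- squared norm at most 2·2 + 2·3 = 10. The truncation at 20 therefore loses nothing.
    have h1 : ∫ y in Ball20 p q, ker20 y ^ m • F (x - y) = ∫ y, ker20 y ^ m • F (x - y) := by
      refine setIntegral_eq_integral_of_forall_compl_eq_zero fun y hy => ?_
      by_cases hc : F (x - y) = 0
      · rw [hc, smul_zero]
      · exfalso
        have h2 := nn_le_of_cutExt_ne hc
        have h3 := nn_sub_le x (x - y)
        rw [sub_sub_cancel] at h3
        refine hy ?_
        change nn y ≤ 20
        linarith
    have h2 : ∫ y, ker20 y ^ m • F (x - y) = ∫ y, F y * ev (x - y) (kerP p q ^ m) := by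
      rw [← integral_sub_left_eq_self _ volume x]
      refine integral_congr_ae (Eventually.of_forall fun y => ?_)
      simp only [sub_sub_cancel, map_pow, ev_kerP, Complex.real_smul]
      push_cast
      ring
    rw [h1, h2, Complex.real_smul, smul_eq_mul]
    push_cast
    rfl
  choose P hP using hpoly
  -- Kernel, ball and Lebesgue measure are invariant under phases, so the convolution inherits the
  -- phase behaviour u^n of f, and only bidegrees (l + n, l) remain.
  have hcirc : ∀ m (x : V p q), nn x = 2 → ∀ u : ℂ, u * conj u = 1 →
      ev (u • x) (P m) = u ^ n * ev x (P m) := by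
    intro m x hx u hu
    have hux : nn (u • x) = 2 := by rw [nn, rz_circle hu, rw'_circle hu]; exact hx
    rw [← hP m x hx, ← hP m _ hux, integral_nu20, integral_nu20, mul_smul_comm,
      ← integral_const_mul, ← integral_indicator isCompact_Ball20.measurableSet,
      ← integral_indicator isCompact_Ball20.measurableSet]
    have hmp := (measurePreserving_circle (p := p) (q := q) hu)
    have hu0 : u ≠ 0 := fun h => by simp [h] at hu
    have hemb : MeasurableEmbedding fun v : V p q => u • v :=
      (Homeomorph.smulOfNeZero u hu0).measurableEmbedding
    rw [← hmp.integral_comp hemb]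
    congr 1
    refine integral_congr_ae (Eventually.of_forall fun y => ?_)
    have hk : ker20 (u • y) = ker20 y := by rw [ker20, ker20, nn, nn, rz_circle hu, rw'_circle hu]
    have hmem : u • y ∈ Ball20 p q ↔ y ∈ Ball20 p q := by
      change nn (u • y) ≤ 20 ↔ nn y ≤ 20
      rw [nn, nn, rz_circle hu, rw'_circle hu]
    dsimp only
    by_cases hy : y ∈ Ball20 p q
    · rw [Set.indicator_of_mem (hmem.2 hy), Set.indicator_of_mem hy, hk, ← smul_sub, hFdef,
        cutExt_circle hn f.2 hu, mul_smul_comm]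
    · rw [Set.indicator_of_notMem (mt hmem.1 hy), Set.indicator_of_notMem hy]
  choose t ht ht' using fun m => exists_type_part (P m) n
  -- the approximating functions
  have hnnproj : ∀ η : X0 p q, nn (proj η.1) = 2 := by
    intro η
    rw [nn, rz_proj (mem_Opn η), rw'_proj (mem_Opn η)]; norm_num
  have happ : ∀ m, ∃ g ∈ W, ∀ η : X0 p q, g.1 η = pw γ η.1 * ∫ y, F (proj η.1 - y) ∂nu20 p q m := by
    intro m
    have hmono : ∀ d ∈ t m, InL W (mo d) (α - (degX d : ℂ)) := by
      intro d hd
      have := h (degY d) (mo d) (by rw [← ht m d hd]; exact mo_mem_Bi d)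
      rwa [← ht m d hd] at this
    choose! g hg hg' using hmono
    refine ⟨∑ d ∈ t m, (P m).coeff d • g d, W.sum_mem fun d hd => W.smul_mem _ (hg d hd),
      fun η => ?_⟩
    rw [hP m _ (hnnproj η), ht' m (proj η.1) (hcirc m _ (hnnproj η)), Finset.mul_sum]
    have h1 : (∑ d ∈ t m, (P m).coeff d • g d : S p q α β).1 η =
        ∑ d ∈ t m, (P m).coeff d * (g d).1 η := by simp [Finset.sum_apply]
    rw [h1]
    refine Finset.sum_congr rfl fun d hd => ?_
    rw [hg' d hd]
    have hr := rz_pos η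
    -- On the cone the projection is a scalar dilation, so a monomial evaluated there is the same
    -- monomial at η times a power of |z|². Together with `pw γ` the exponent becomes α - degX d.
    have hproj : proj η.1 = (((√(rz η.1))⁻¹ : ℝ) : ℂ) • η.1 := by
      rw [proj, ← rz_eq_rw' η]; rfl
    have hpw : ((((√(rz η.1))⁻¹ : ℝ) : ℂ)) = pw (-(1 / 2)) η.1 := by
      rw [pw, show (-(1 / 2) : ℂ) * (Real.log (rz η.1) : ℂ) =
        ((-(Real.log (rz η.1) / 2) : ℝ) : ℂ) by push_cast; ring, ← Complex.ofReal_exp,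
        Real.exp_neg, Real.exp_half, Real.exp_log hr]
    have hpn : ∀ r : ℕ, pw (-(1 / 2)) η.1 ^ r = pw (-(r / 2)) η.1 := by
      intro r
      rw [pw, pw, ← Complex.exp_nat_mul]
      congr 1
      ring
    rw [hproj, ev_smul _ _ (mo_mem_Bi d), Complex.conj_ofReal, hpw, hpn, hpn]
    have hexp : α - (degX d : ℂ) = γ + (-((degX d : ℂ) / 2) + -((degY d : ℂ) / 2)) := by
      have h2 : (degX d : ℂ) = degY d + n := by exact_mod_cast ht m d hd
      rw [hγ, h2]
      linear_combination hn / 2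
    rw [hexp, pw_add, pw_add]
    ring
  choose g hg hg' using happ
  refine mem_of_tendsto_smoothTopology hW (l := atTop) (f := g) (Eventually.of_forall hg)
    fun d φ k C hC => ?_
  have hG : SmoothFamily fun (y : Ball20 p q) u =>
      pw γ (φ.toFun u).1 * F (proj (φ.toFun u).1 - y.1) := by
    refine SmoothFamily.of_ambient (G := fun x : V p q × EuclideanSpace ℝ (Fin d) =>
      pw γ (φ.toFun x.2).1 * F (proj (φ.toFun x.2).1 - x.1)) (e := Subtype.val)
      continuous_subtype_val fun y u => ?_
    have hφ : ContDiffAt ℝ ∞ (fun x : V p q × EuclideanSpace ℝ (Fin d) => (φ.toFun x.2).1)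
        (y.1, u) := (φ.contDiff.comp contDiff_snd).contDiffAt
    refine ContDiffAt.mul ?_ (hF.contDiffAt.comp (y.1, u) (ContDiffAt.sub ?_ contDiffAt_fst))
    · exact ContDiffAt.comp (g := pw γ) (y.1, u) (contDiffAt_pw γ (rz_pos _)) hφ
    · exact ContDiffAt.comp (g := proj) (y.1, u) (contDiffAt_proj (mem_Opn _)) hφ
  -- Points outside the ball are sent to 0 to give sampling points in a compact space; the measures
  -- do not charge them.
  let σ : V p q → Ball20 p q := fun y => ⟨(Ball20 p q).indicator id y, by
    by_cases hy : y ∈ Ball20 p q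
    · rwa [Set.indicator_of_mem hy]
    · rw [Set.indicator_of_notMem hy]; exact zero_mem_Ball20⟩
  have hσ : Measurable σ :=
    (measurable_id.indicator isCompact_Ball20.measurableSet).subtype_mk
  have hconv := tendstoUniformlyOn_average hG (l := atTop) (ν := fun m => nu20 p q m) (b := 1)
    (fun m => (nu20_univ m).le) (Φ := fun _ => 1) stronglyMeasurable_const (B := 1)
    (fun _ => by simp) (σ := fun _ => σ) (fun _ => hσ) (τ := fun _ => ⟨0, zero_mem_Ball20⟩)
    measurable_const ?_ (g := fun u => f.1 (φ.toFun u)) ?_ k hC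
  · refine hconv.congr (Eventually.of_forall fun m u _ => ?_)
    refine congrArg (fun G => iteratedFDeriv ℝ k G _) (funext fun u => ?_)
    rw [hg', integral_nu20, integral_nu20, mul_smul_comm, ← integral_const_mul]
    congr 1
    refine setIntegral_congr_fun isCompact_Ball20.measurableSet fun y hy => ?_
    simp only [σ, Set.indicator_of_mem hy, id, one_smul, mul_smul_comm]
  · intro δ hδ
    refine squeeze_zero (fun _ => measureReal_nonneg) (fun m => measureReal_mono ?_)
      (tendsto_nu20 hδ)
    intro y hy
    rw [Set.mem_ofPred_eq] at hy ⊢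
    refine hy.trans ?_
    by_cases hyB : y ∈ Ball20 p q
    · simp [σ, hyB, Subtype.dist_eq]
    · simp [σ, hyB]
  · intro m u
    have h1 := ext_coe f.2 (φ.toFun u)
    simp only [sub_zero, integral_const, nu20_univ, one_smul]
    rw [hFdef, cutExt_proj (mem_Opn _), ← h1]
    rfl

end LightCone

end

open scoped Topology ContDiff UniformConvergence ComplexConjugate

noncomputable section

namespace LightCone

set_option linter.unusedSectionVars false

open MeasureTheory Filter

variable {p q : ℕ} {α β : ℂ}

/-! ### Irreducibility for nonintegral parameters -/

section Orthogonal

variable [NeZero p] [NeZero q]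

/-- The functions orthogonal to a set of continuous functions on the base orbit. -/
def orthK (α β : ℂ) (A : Set (K p q → ℂ)) (hA : ∀ u ∈ A, Continuous u) :
    Submodule ℂ (S p q α β) where
  carrier := {f | ∀ u ∈ A, ∫ k, f.1 (orbX k) * u k ∂haarK p q = 0}
  zero_mem' u _ := by simp
  add_mem' {f g} hf hg u hu := by
    have h : ∀ f : S p q α β, Integrable (fun k => f.1 (orbX k) * u k) (haarK p q) := fun f =>
      integrable_K ((continuous_orbX_comp f.2.1).mul (hA u hu))
    have h2 : ∀ k, (f + g).1 (orbX k) * u k = f.1 (orbX k) * u k + g.1 (orbX k) * u k :=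
      fun k => add_mul _ _ _
    simp only [h2]
    rw [integral_add (h f) (h g), hf u hu, hg u hu, add_zero]
  smul_mem' c f hf u hu := by
    have h2 : ∀ k, (c • f).1 (orbX k) * u k = c * (f.1 (orbX k) * u k) :=
      fun k => mul_assoc _ _ _
    simp only [h2]
    rw [integral_const_mul, hf u hu, mul_zero]

lemma isClosed_orthK (A : Set (K p q → ℂ)) (hA : ∀ u ∈ A, Continuous u) :
    IsClosed[smoothTopology p q α β] (orthK α β A hA : Set (S p q α β)) := by
  have h : (orthK α β A hA : Set (S p q α β)) =
      ⋂ u ∈ A, {f : S p q α β | ∫ k, f.1 (orbX k) * u k ∂haarK p q = 0} := by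
    ext f
    simp only [Set.mem_iInter]
    rfl
  rw [h]
  exact @isClosed_biInter _ _ (smoothTopology p q α β) _ _ fun u hu =>
    isClosed_orthogonal (hA u hu)

lemma pw_mem_S (s : ℂ) : (fun η : X0 p q => pw s η.1) ∈ S p q s s := by
  have h : (1 : Ply p q) ∈ Bi p q 0 0 := by
    have := mo_mem_Bi (p := p) (q := q) 0
    simpa [mo, degX, degY] using this
  have h2 := ev_mul_pw_mem_S h (α := s) (β := s) (s := s) (by simp) (by simp)
  simpa using h2

/-- The conjugate restrictions to the base orbit. -/
def conjOrb (W : Submodule ℂ (S p q α β)) : Set (K p q → ℂ) :=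
  {u | ∃ f ∈ W, u = fun k => conj (f.1 (orbX k))}

lemma continuous_conjOrb (W : Submodule ℂ (S p q α β)) : ∀ u ∈ conjOrb W, Continuous u := by
  rintro _ ⟨f, _, rfl⟩
  exact Complex.continuous_conj.comp (continuous_orbX_comp f.2.1)

/-- Conjugates of elements of W have exponents (conj β, conj α), so α' and β' are exactly those for
which the pairing is invariant. Lie derivatives then move across it onto W with a sign. -/
lemma lieStable_orthK_conjOrb {α' β' : ℂ} {n : ℤ} (hn : α - β = n)
    (hα' : α' = -(p + q - 1) - conj β) (hβ' : β' = -(p + q - 1) - conj α)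
    {W : Submodule ℂ (S p q α β)} (hW : LieStable W) :
    LieStable (orthK α' β' (conjOrb W) (continuous_conjOrb W)) := by
  intro x hx h hh
  rintro _ ⟨f, hf, rfl⟩
  have h1 : ∫ k, h.1 (orbX k) * conj (lieFun α β x f.1 (orbX k)) ∂haarK p q = 0 :=
    hh _ ⟨_, hW x hx f hf, rfl⟩
  have h2 := integral_lieFun_mul (α := α') (β := β') (α' := conj β) (β' := conj α)
    (by rw [hα']; ring) (by rw [hβ']; ring) h.2 (conj_mem_S hn f.2) hx
  simp only [lieFun_conj hn f.2 hx] at h2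
  rw [h1, neg_zero] at h2
  exact h2

lemma eq_zero_of_integral_conj {f : S p q α β}
    (h : ∫ k, f.1 (orbX k) * conj (f.1 (orbX k)) ∂haarK p q = 0) : f = 0 := by
  have hc := continuous_orbX_comp (p := p) (q := q) f.2.1
  have h1 : ∫ k, Complex.normSq (f.1 (orbX k)) ∂haarK p q = 0 := by
    simp only [Complex.mul_conj] at h
    rw [integral_complex_ofReal] at h
    exact_mod_cast h
  have h2 : Continuous fun k : K p q => Complex.normSq (f.1 (orbX k)) :=
    Complex.continuous_normSq.comp hc
  refine Subtype.ext (eq_zero_of_orbX f.2 fun k => ?_)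
  by_contra hk
  exact (Continuous.integral_pos_of_hasCompactSupport_nonneg_nonzero (μ := haarK p q) (x := k) h2
    (HasCompactSupport.of_compactSpace _) (fun k => Complex.normSq_nonneg _)
    (fun h0 => hk (Complex.normSq_eq_zero.1 h0))).ne' h1

/-- Either W has a vector with nonzero highest weight coefficient, and then generation and density
make it everything; or the annihilator of its conjugates contains the dual highest weight vector,
and the same argument applied to the annihilator forces W to vanish. The dual exponent α' is again
nonintegral. -/
lemma eq_top_of_ne_bot_of_nonneg {n : ℕ} (hn : α - β = n) (hα : ∀ m : ℤ, α ≠ m)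
    {W : Submodule ℂ (S p q α β)}
    (hW : IsClosed[smoothTopology p q α β] (W : Set (S p q α β)))
    (hinv : ∀ g : U p q, ∀ f ∈ W, rho p q α β g f ∈ W) (hbot : W ≠ ⊥) : W = ⊤ := by
  have hL := lieStable_of_invariant hW hinv
  obtain ⟨α', hα'⟩ : ∃ a, a = -((p : ℂ) + q - 1) - conj β := ⟨_, rfl⟩
  obtain ⟨β', hβ'⟩ : ∃ a, a = -((p : ℂ) + q - 1) - conj α := ⟨_, rfl⟩
  have hn' : α' - β' = n := by
    have := congrArg conj hn
    rw [map_sub, Complex.conj_natCast] at this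
    rw [hα', hβ', ← this]
    ring
  have hαi : ∀ m : ℤ, α' ≠ m := by
    intro m hm
    have h1 : conj β = -((p : ℂ) + q - 1) - m := by rw [← hm, hα']; ring
    have h2 := congrArg conj h1
    simp only [Complex.conj_conj, map_sub, map_neg, map_add, map_one, Complex.conj_natCast,
      map_intCast] at h2
    refine hα (n - (p + q - 1) - m) ?_
    push_cast
    linear_combination hn + h2
  have hint : ∃ f ∈ W, ∫ k, f.1 (orbX k) * conj (k.1.1 0 0 ^ n) ∂haarK p q ≠ 0 := by
    by_contra! hc
    set A := orthK α' β' (conjOrb W) (continuous_conjOrb W) with hA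
    have hz : InL A (mo (n • eX (Sum.inl 0))) (α' - n) := by
      have hmem := ev_mul_pw_mem_S (mo_pow_mem (p := p) (q := q) n) (α := α') (β := β')
        (s := α' - n) (by ring) (by rw [← hn']; ring)
      refine ⟨⟨_, hmem⟩, ?_, fun η => rfl⟩
      rintro _ ⟨f, hf, rfl⟩
      have h1 := congrArg conj (hc f hf)
      rw [← integral_conj, map_zero] at h1
      rw [← h1]
      refine integral_congr_ae (Eventually.of_forall fun k => ?_)
      change ev (orb k) _ * pw _ (orb k) * conj (f.1 (orbX k)) = _
      rw [ev_mo_pow_orb, pw_of_rz_eq_one _ (rz_orb k)]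
      simp only [map_mul, Complex.conj_conj]
      ring
    have hAt : A = ⊤ := eq_top_of_inL hn' (isClosed_orthK _ _)
      (inL_of_inL_pow (lieStable_orthK_conjOrb (n := n) (by rw [hn]; simp) hα' hβ' hL) hαi 0 hz)
    refine hbot ((Submodule.eq_bot_iff _).2 fun f hf => eq_zero_of_integral_conj ?_)
    -- The power of |z|² corrects the exponents and equals 1 on the orbit, so f itself may be
    -- inserted into its own annihilator and has norm zero.
    have hs : (fun η => f.1 η * pw (α' - α) η.1) ∈ S p q α' β' := by
      have := mul_mem_S f.2 (pw_mem_S (α' - α))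
      rw [add_sub_cancel, show β + (α' - α) = β' by linear_combination hn' - hn] at this
      exact this
    have h1 : (⟨_, hs⟩ : S p q α' β') ∈ A := hAt ▸ Submodule.mem_top
    have h2 := h1 _ ⟨f, hf, rfl⟩
    rw [← h2]
    refine integral_congr_ae (Eventually.of_forall fun k => ?_)
    change _ = f.1 (orbX k) * pw _ (orb k) * conj (f.1 (orbX k))
    rw [pw_of_rz_eq_one _ (rz_orb k), mul_one]
  obtain ⟨f, hf, hf'⟩ := hint
  have h1 := inL_pow_of_integral_ne hW hinv hn hf hf'
  have h2 : InL W (mo (n • eX (Sum.inl 0))) (α - n) := by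
    have e : α - n = β := by rw [← hn]; ring
    rw [e]
    exact h1
  exact eq_top_of_inL hn hW (inL_of_inL_pow hL hα 0 h2)

end Orthogonal

/-! ### Complex conjugation -/

section Conjugation

lemma continuous_of_eq_conj {α' β' : ℂ} {Φ : S p q α β → S p q α' β'}
    (hΦ : ∀ f η, (Φ f).1 η = conj (f.1 η)) :
    Continuous[smoothTopology p q α β, smoothTopology p q α' β'] Φ := by
  refine continuous_iInf_rng.2 fun d => continuous_iInf_rng.2 fun φ =>
    continuous_iInf_rng.2 fun k => continuous_induced_rng.2 ?_
  let E := EuclideanSpace ℝ (Fin d)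
  let T : (E [×k]→L[ℝ] ℂ) →L[ℝ] (E [×k]→L[ℝ] ℂ) :=
    ContinuousLinearMap.compContinuousMultilinearMapL ℝ (fun _ : Fin k => E) ℂ ℂ
      Complex.conjCLE.toContinuousLinearMap
  have h1 : ∀ f : S p q α β, iteratedFDeriv ℝ k (fun u => (Φ f).1 (φ.toFun u)) =
      T ∘ iteratedFDeriv ℝ k (fun u => f.1 (φ.toFun u)) := by
    intro f
    funext u
    simp only [hΦ]
    exact Complex.conjCLE.iteratedFDeriv_comp_left
  have h2 : @Continuous _ _ (smoothTopology p q α β) _ fun f : S p q α β =>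
      UniformOnFun.ofFun {K : Set E | IsCompact K}
        (iteratedFDeriv ℝ k (fun u => f.1 (φ.toFun u))) :=
    continuous_iInf_dom (i := d) (continuous_iInf_dom (i := φ)
      (continuous_iInf_dom (i := k) continuous_induced_dom))
  have h3 := (UniformOnFun.postcomp_uniformContinuous (𝔖 := {K : Set E | IsCompact K})
    T.uniformContinuous).continuous
  have h4 := @Continuous.comp _ _ _ (smoothTopology p q α β) _ _ _ _ h3 h2
  have h5 : (fun f : S p q α β => UniformOnFun.ofFun {K : Set E | IsCompact K}
      (iteratedFDeriv ℝ k (fun u => (Φ f).1 (φ.toFun u)))) = _ := funext fun f =>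
    congrArg (UniformOnFun.ofFun {K : Set E | IsCompact K}) (h1 f)
  change @Continuous _ _ (smoothTopology p q α β) _ fun f : S p q α β =>
    UniformOnFun.ofFun {K : Set E | IsCompact K}
      (iteratedFDeriv ℝ k (fun u => (Φ f).1 (φ.toFun u)))
  rw [h5]
  exact h4

/-- Pointwise conjugation is an antilinear homeomorphism commuting with the group. It preserves α -
β up to the sign, which reduces the irreducibility argument to α - β ≥ 0. -/
lemma IsReducible.conj {n : ℤ} (hn : α - β = n) (h : IsReducible p q α β) :
    IsReducible p q (conj β) (conj α) := by
  obtain ⟨W, hW, hinv, hbot, htop⟩ := h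
  have hn' : (starRingEnd ℂ) β - (starRingEnd ℂ) α = ((-n : ℤ) : ℂ) := by
    rw [← map_sub, ← neg_sub α β, hn]; simp
  have key : ∀ f : S p q ((starRingEnd ℂ) β) ((starRingEnd ℂ) α),
      (fun η => (starRingEnd ℂ) (f.1 η)) ∈ S p q α β := by
    intro f
    have := conj_mem_S hn' f.2
    rwa [Complex.conj_conj, Complex.conj_conj] at this
  let Φ : S p q ((starRingEnd ℂ) β) ((starRingEnd ℂ) α) → S p q α β := fun f => ⟨_, key f⟩
  let W' : Submodule ℂ (S p q ((starRingEnd ℂ) β) ((starRingEnd ℂ) α)) :=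
    { carrier := {f | Φ f ∈ W}
      zero_mem' := by
        have h : Φ 0 = 0 := Subtype.ext (funext fun η => map_zero (starRingEnd ℂ))
        rw [Set.mem_ofPred_eq, h]
        exact W.zero_mem
      add_mem' := fun {f g} hf hg => by
        have h : Φ (f + g) = Φ f + Φ g :=
          Subtype.ext (funext fun η => map_add (starRingEnd ℂ) (f.1 η) (g.1 η))
        rw [Set.mem_ofPred_eq, h]
        exact W.add_mem hf hg
      smul_mem' := fun c f hf => by
        have h : Φ (c • f) = (starRingEnd ℂ) c • Φ f :=
          Subtype.ext (funext fun η => map_mul (starRingEnd ℂ) c (f.1 η))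
        rw [Set.mem_ofPred_eq, h]
        exact W.smul_mem _ hf }
  have hsurj : ∀ f : S p q α β,
      Φ ⟨fun η => (starRingEnd ℂ) (f.1 η), conj_mem_S hn f.2⟩ = f :=
    fun f => Subtype.ext (funext fun η => Complex.conj_conj (f.1 η))
  have hconj : ∀ f : S p q α β,
      (⟨fun η => (starRingEnd ℂ) (f.1 η), conj_mem_S hn f.2⟩ :
        S p q ((starRingEnd ℂ) β) ((starRingEnd ℂ) α)) ∈ W' ↔ f ∈ W := by
    intro f
    change Φ _ ∈ W ↔ _
    rw [hsurj]
  refine ⟨W', ?_, fun g f hf => hinv g _ hf, fun h => hbot ?_, fun h => htop ?_⟩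
  · have h := continuous_of_eq_conj (Φ := Φ) fun f η => rfl
    exact @IsClosed.preimage _ _ (smoothTopology p q _ _) (smoothTopology p q _ _) _ h _ hW
  · refine (Submodule.eq_bot_iff _).2 fun f hf => ?_
    have h1 := (hconj f).2 hf
    rw [h, Submodule.mem_bot] at h1
    refine Subtype.ext (funext fun η => ?_)
    exact (map_eq_zero (starRingEnd ℂ)).1 (congrFun (congrArg Subtype.val h1) η)
  · exact Submodule.eq_top_iff'.2 fun f => (hconj f).1 (h ▸ Submodule.mem_top)

end Conjugation

lemma IsReducible.exists_int [NeZero p] [NeZero q] (hn : ∃ n : ℤ, α - β = n)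
    (h : IsReducible p q α β) : (∃ a : ℤ, α = a) ∧ ∃ b : ℤ, β = b := by
  obtain ⟨n, hn⟩ := hn
  have key : ∀ {α β : ℂ} {n : ℕ}, α - β = n → IsReducible p q α β → ∃ a : ℤ, α = a := by
    intro α β n hn h
    by_contra! hc
    obtain ⟨W, hW, hinv, hbot, htop⟩ := h
    exact htop (eq_top_of_ne_bot_of_nonneg hn hc hW hinv hbot)
  rcases le_total 0 n with h0 | h0
  · lift n to ℕ using h0
    obtain ⟨a, ha⟩ := key (n := n) (by exact_mod_cast hn) h
    refine ⟨⟨a, ha⟩, a - n, ?_⟩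
    push_cast at hn ⊢
    rw [← ha]
    linear_combination -hn
  · obtain ⟨m, hm⟩ := Int.exists_eq_neg_ofNat h0
    have h1 := h.conj hn
    have hm' : (starRingEnd ℂ) β - (starRingEnd ℂ) α = m := by
      rw [← map_sub, ← neg_sub α β, hn, hm]; simp
    obtain ⟨b, hb⟩ := key hm' h1
    have hb' : β = b := by
      have := congrArg (starRingEnd ℂ) hb
      rwa [Complex.conj_conj, map_intCast] at this
    refine ⟨⟨b + n, ?_⟩, b, hb'⟩
    push_cast
    rw [← hb', ← hn]
    ring

end LightCone

end

/-! ### Formal derivations on rational functions with denominator |z|². -/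

open scoped Topology ContDiff UniformConvergence ComplexConjugate

noncomputable section

namespace LightCone

set_option linter.unusedSectionVars false

open MeasureTheory Filter

variable {p q : ℕ} {α β : ℂ}

/-! ### Polynomials in the coordinates, their conjugates, and the inverse of `|z|²` -/

section Rational

/-- Polynomials in the coordinates, their conjugates, and the inverse of the squared norm of the
first component. -/
abbrev Rat' (p q : ℕ) : Type := MvPolynomial (Option (Bool × Idx p q)) ℂ

/-- The coordinates (`false`) and their conjugates (`true`). -/
def var (b : Bool) (a : Idx p q) : Rat' p q := MvPolynomial.X (some (b, a))

/-- The inverse of the squared norm of the first component. -/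
def invN : Rat' p q := MvPolynomial.X none

/-- The indicator of the first component. -/
def zi : Idx p q → ℂ := Sum.elim (fun _ => 1) fun _ => 0

/-- The formal Wirtinger derivatives. -/
def der (b : Bool) (a : Idx p q) : Derivation ℂ (Rat' p q) (Rat' p q) :=
  MvPolynomial.mkDerivation ℂ fun
    | none => zi a • -(invN ^ 2 * var (!b) a)
    | some x => if (b, a) = x then 1 else 0

lemma der_var (b c : Bool) (a d : Idx p q) :
    der b a (var c d) = if (b, a) = (c, d) then 1 else 0 := by
  exact MvPolynomial.mkDerivation_X _ _ _

lemma der_invN (b : Bool) (a : Idx p q) : der b a invN = zi a • -(invN ^ 2 * var (!b) a) := by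
  rw [der, invN, MvPolynomial.mkDerivation_X]

lemma der_mul (b : Bool) (a : Idx p q) (P Q : Rat' p q) :
    der b a (P * Q) = P * der b a Q + Q * der b a P := by
  rw [Derivation.leibniz, smul_eq_mul, smul_eq_mul]

/-- The relation |z|² `invN` = 1 is not imposed in the polynomial ring, so commutation is not
inherited from analysis; it is checked on the generators, including `invN`. -/
lemma der_comm (b c : Bool) (a d : Idx p q) (P : Rat' p q) :
    der b a (der c d P) = der c d (der b a P) := by
  have h : ⁅der b a, der c d⁆ = (0 : Derivation ℂ (Rat' p q) (Rat' p q)) := by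
    refine MvPolynomial.derivation_ext fun x => ?_
    rw [Derivation.commutator_apply, Derivation.zero_apply]
    have hif : ∀ (b : Bool) (a : Idx p q) (s : Prop) [Decidable s],
        der b a (if s then (1 : Rat' p q) else 0) = 0 := by
      intro b a s _
      split_ifs <;> simp
    rcases x with _ | ⟨e, x⟩
    · change der b a (der c d invN) - der c d (der b a invN) = 0
      simp only [der_invN, Derivation.map_smul, Derivation.map_neg, der_mul, pow_two, der_var]
      by_cases h : (b, a) = (!c, d)
      · obtain ⟨rfl, rfl⟩ := Prod.mk.inj h
        simp only [Bool.not_not, if_true, MvPolynomial.smul_eq_C_mul]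
        ring
      · have h' : ¬ (c, d) = (!b, a) := fun h' => h (by
          obtain ⟨h1, h2⟩ := Prod.mk.inj h'
          rw [h1, h2, Bool.not_not])
        rw [if_neg h, if_neg h']
        simp only [MvPolynomial.smul_eq_C_mul]
        ring
    · change der b a (der c d (var e x)) - der c d (der b a (var e x)) = 0
      simp only [der_var, hif, sub_zero]
  have := congrArg (fun D : Derivation ℂ (Rat' p q) (Rat' p q) => D P) h
  rwa [Derivation.commutator_apply, Derivation.zero_apply, sub_eq_zero] at this

/-- The value of a coordinate or its conjugate. -/
def vval (b : Bool) (a : Idx p q) (v : V p q) : ℂ := if b then conj (crd a v) else crd a v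

/-- Evaluation. -/
def evr (v : V p q) : Rat' p q →ₐ[ℂ] ℂ :=
  MvPolynomial.aeval fun
    | none => ((rz v : ℝ) : ℂ)⁻¹
    | some x => vval x.1 x.2 v

lemma evr_var (v : V p q) (b : Bool) (a : Idx p q) : evr v (var b a) = vval b a v := by
  simp [evr, var]

lemma evr_invN (v : V p q) : evr v invN = ((rz v : ℝ) : ℂ)⁻¹ := by
  simp [evr, invN]

lemma contDiff_vval (b : Bool) (a : Idx p q) : ContDiff ℝ ∞ (vval b a : V p q → ℂ) := by
  cases b
  · exact (crdL a).contDiff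
  · exact (crdbL a).contDiff

lemma contDiffAt_inv_rz {v : V p q} (hv : 0 < rz v) :
    ContDiffAt ℝ ∞ (fun v : V p q => ((rz v : ℝ) : ℂ)⁻¹) v :=
  ContDiffAt.inv (f := fun v : V p q => ((rz v : ℝ) : ℂ))
    (Complex.ofRealCLM.contDiff.contDiffAt.comp v contDiff_rz.contDiffAt)
    (by exact_mod_cast hv.ne')

lemma contDiffAt_evr (P : Rat' p q) {v : V p q} (hv : 0 < rz v) :
    ContDiffAt ℝ ∞ (fun v => evr v P) v := by
  induction P using MvPolynomial.induction_on with
  | C c => simpa [evr] using contDiffAt_const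
  | add P Q hP hQ => simpa using hP.add hQ
  | mul_X P x hP =>
    rcases x with _ | ⟨b, a⟩
    · rw [← invN]
      simp only [map_mul, evr_invN]
      exact hP.mul (contDiffAt_inv_rz hv)
    · rw [← var]
      simp only [map_mul, evr_var]
      exact hP.mul (contDiff_vval b a).contDiffAt

lemma differentiableAt_evr (P : Rat' p q) {v : V p q} (hv : 0 < rz v) :
    DifferentiableAt ℝ (fun v => evr v P) v := (contDiffAt_evr P hv).differentiableAt (by simp)

/-- The Wirtinger derivatives. -/
def wd (b : Bool) (a : Idx p q) (F : V p q → ℂ) (v : V p q) : ℂ := if b then bd a F v else hd a F v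

lemma wd_mul (b : Bool) (a : Idx p q) {F G : V p q → ℂ} {v : V p q} (hF : DifferentiableAt ℝ F v)
    (hG : DifferentiableAt ℝ G v) :
    wd b a (fun v => F v * G v) v = F v * wd b a G v + wd b a F v * G v := by
  cases b
  · exact hd_mul a hF hG
  · exact bd_mul a hF hG

lemma wd_add (b : Bool) (a : Idx p q) {F G : V p q → ℂ} {v : V p q} (hF : DifferentiableAt ℝ F v)
    (hG : DifferentiableAt ℝ G v) :
    wd b a (fun v => F v + G v) v = wd b a F v + wd b a G v := by
  cases b
  · exact hd_add a hF hG
  · exact bd_add a hF hG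

lemma wd_const (b : Bool) (a : Idx p q) (c : ℂ) (v : V p q) : wd b a (fun _ => c) v = 0 := by
  cases b
  · exact hd_const a c v
  · exact bd_const a c v

lemma wd_congr (b : Bool) (a : Idx p q) {F G : V p q → ℂ} {v : V p q} (h : F =ᶠ[𝓝 v] G) :
    wd b a F v = wd b a G v := by
  simp only [wd, hd, bd, h.fderiv_eq]

lemma wd_vval (b c : Bool) (a d : Idx p q) (v : V p q) :
    wd b a (vval c d) v = if (b, a) = (c, d) then 1 else 0 := by
  cases b <;> cases c
  · exact (hd_crdL a d v).trans (by simp)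
  · exact (hd_crdbL a d v).trans (by simp)
  · exact (bd_crdL a d v).trans (by simp)
  · exact (bd_crdbL a d v).trans (by simp)

lemma ofReal_rz (v : V p q) : ((rz v : ℝ) : ℂ) = evr v (∑ i : Fin p, var false (Sum.inl i) * var true (Sum.inl i)) := by
  simp only [map_sum, map_mul, evr_var, vval, rz]
  push_cast
  exact Finset.sum_congr rfl fun i _ => by
    simp [crd, Complex.mul_conj]

lemma wd_sum {ι : Type*} (s : Finset ι) (b : Bool) (a : Idx p q) {F : ι → V p q → ℂ} {v : V p q}
    (hF : ∀ i, DifferentiableAt ℝ (F i) v) :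
    wd b a (fun v => ∑ i ∈ s, F i v) v = ∑ i ∈ s, wd b a (F i) v := by
  classical
  induction s using Finset.induction_on with
  | empty => simpa using wd_const b a 0 v
  | insert i s his ih =>
    simp only [Finset.sum_insert his]
    rw [wd_add b a (hF i) (DifferentiableAt.fun_sum fun i _ => hF i), ih]

lemma differentiableAt_vval (b : Bool) (a : Idx p q) (v : V p q) :
    DifferentiableAt ℝ (vval b a : V p q → ℂ) v :=
  (contDiff_vval b a).contDiffAt.differentiableAt (by simp)

lemma wd_rz (b : Bool) (a : Idx p q) (v : V p q) :
    wd b a (fun v => ((rz v : ℝ) : ℂ)) v = zi a * vval (!b) a v := by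
  simp only [ofReal_rz, map_sum, map_mul, evr_var]
  rw [wd_sum (F := fun i v => vval false (Sum.inl i) v * vval true (Sum.inl i) v) _ _ _
    fun i => (differentiableAt_vval _ _ v).mul (differentiableAt_vval _ _ v)]
  simp only [wd_mul b a (differentiableAt_vval _ _ v) (differentiableAt_vval _ _ v), wd_vval]
  rcases a with a | a
  · rw [Finset.sum_eq_single a]
    · cases b <;> simp [zi]
    · intro i _ hi
      cases b <;> simp [Ne.symm hi]
    · simp
  · simp [zi]

/-- Obtained by differentiating the product of |z|² and its inverse, which is locally the constant
1. -/
lemma wd_inv_rz (b : Bool) (a : Idx p q) {v : V p q} (hv : 0 < rz v) :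
    wd b a (fun v => ((rz v : ℝ) : ℂ)⁻¹) v =
      -(zi a * ((((rz v : ℝ) : ℂ)⁻¹) ^ 2 * vval (!b) a v)) := by
  have hv' : ((rz v : ℝ) : ℂ) ≠ 0 := by exact_mod_cast hv.ne'
  have h1 : DifferentiableAt ℝ (fun v : V p q => ((rz v : ℝ) : ℂ)) v :=
    (Complex.ofRealCLM.contDiff.contDiffAt.comp v contDiff_rz.contDiffAt).differentiableAt
      (n := ∞) (by simp)
  have h2 := wd_mul b a h1 ((contDiffAt_inv_rz hv).differentiableAt (by simp))
  have h3 : (fun v : V p q => ((rz v : ℝ) : ℂ) * ((rz v : ℝ) : ℂ)⁻¹) =ᶠ[𝓝 v] fun _ => 1 := by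
    filter_upwards [contDiff_rz.continuous.continuousAt.eventually_ne hv.ne'] with u hu
    exact mul_inv_cancel₀ (by exact_mod_cast hu)
  rw [wd_congr b a h3, wd_const, wd_rz] at h2
  have h4 : (((rz v : ℝ) : ℂ))⁻¹ * ((rz v : ℝ) : ℂ) = 1 := inv_mul_cancel₀ hv'
  generalize wd b a (fun v : V p q => ((rz v : ℝ) : ℂ)⁻¹) v = W at h2 ⊢
  linear_combination (-(((rz v : ℝ) : ℂ))⁻¹) * h2 - W * h4

/-- The formal derivatives compute the Wirtinger derivatives. -/
lemma wd_evr (b : Bool) (a : Idx p q) (P : Rat' p q) {v : V p q} (hv : 0 < rz v) :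
    wd b a (fun v => evr v P) v = evr v (der b a P) := by
  induction P using MvPolynomial.induction_on with
  | C c =>
    have h : (fun v : V p q => evr v (MvPolynomial.C c)) = fun _ => c := by
      funext v; simp [evr]
    rw [h, wd_const]
    simp [der]
  | add P Q hP hQ =>
    simp only [map_add]
    rw [wd_add b a (differentiableAt_evr P hv) (differentiableAt_evr Q hv), hP, hQ]
  | mul_X P x hP =>
    simp only [map_mul]
    rcases x with _ | ⟨c, d⟩
    · rw [← invN]
      have h : (fun v : V p q => evr v P * evr v invN) =
          fun v => evr v P * ((rz v : ℝ) : ℂ)⁻¹ := by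
        funext v; rw [evr_invN]
      rw [h, wd_mul b a (differentiableAt_evr P hv)
        ((contDiffAt_inv_rz hv).differentiableAt (by simp)), hP, wd_inv_rz b a hv, der_mul, der_invN]
      simp only [map_add, map_mul, map_neg, map_smul, map_pow, evr_invN, evr_var, smul_eq_mul]
      ring
    · rw [← var]
      have h : (fun v : V p q => evr v P * evr v (var c d)) =
          fun v => evr v P * vval c d v := by
        funext v; rw [evr_var]
      rw [h, wd_mul b a (differentiableAt_evr P hv) (differentiableAt_vval c d v), hP, wd_vval,
        der_mul, der_var]
      simp only [map_add, map_mul, evr_var]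
      split_ifs <;> simp <;> ring

/-- The formal counterpart of `lieE`. -/
def rE (a b : Idx p q) (P : Rat' p q) : Rat' p q :=
  sg b • (var false b * der false a P) - sg a • (var true a * der true b P)

lemma lieE_evr (a b : Idx p q) (P : Rat' p q) {v : V p q} (hv : 0 < rz v) :
    lieE a b (fun v => evr v P) v = evr v (rE a b P) := by
  have h1 : hd a (fun v => evr v P) v = _ := wd_evr false a P hv
  have h2 : bd b (fun v => evr v P) v = _ := wd_evr true b P hv
  rw [lieE, h1, h2, rE, map_sub, map_smul, map_smul, map_mul, map_mul, evr_var, evr_var]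
  simp only [vval, smul_eq_mul]
  simp [mul_assoc]

end Rational

end LightCone

end

/-! ### The Weyl algebra module of the Green function, and weights of polynomials in w. -/

open scoped Topology ContDiff UniformConvergence ComplexConjugate

noncomputable section

namespace LightCone

set_option linter.unusedSectionVars false

open MeasureTheory Filter

variable {p q : ℕ} {α β : ℂ}

/-! ### Derivatives of the Green function of the first component -/

section Green

/-- Bidegree vectors of the two kinds of coordinates. -/
def e1 (b : Bool) : Bool → ℤ := Pi.single b 1

lemma e1_apply (b c : Bool) : e1 b c = if c = b then 1 else 0 := by
  rw [e1, Pi.single_apply]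

/-- Multiples of the Green function `|z|^{-2(p-1)}` by monomials in the first component. -/
inductive GreenMul (p q : ℕ) : (Bool → ℤ) → Rat' p q → Prop
  | one : GreenMul p q (fun _ => -(p - 1 : ℕ)) (invN ^ (p - 1))
  | mul {d κ} (b : Bool) (i : Fin p) : GreenMul p q d κ →
      GreenMul p q (d + e1 b) (var b (Sum.inl i) * κ)

/-- The bihomogeneous elements of the module of derivatives of multiples of the Green function. -/
inductive Green (p q : ℕ) : (Bool → ℤ) → Rat' p q → Prop
  | base {d κ} : GreenMul p q d κ → Green p q d κ
  | der {d κ} (b : Bool) (i : Fin p) : Green p q d κ → Green p q (d - e1 b) (der b (Sum.inl i) κ)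
  | add {d κ κ'} : Green p q d κ → Green p q d κ' → Green p q d (κ + κ')
  | smul {d κ} (c : ℂ) : Green p q d κ → Green p q d (c • κ)

variable {d : Bool → ℤ} {κ : Rat' p q}

/-- The exponent p - 1 stays below p, so elements of degree -p or lower can arise only through
differentiation; this makes their spherical means vanish. -/
lemma GreenMul.neg_le (h : GreenMul p q d κ) (b : Bool) : -(p - 1 : ℕ) ≤ d b := by
  induction h with
  | one => exact le_rfl
  | mul c i h ih =>
    rw [Pi.add_apply, e1_apply]
    split_ifs <;> omega

lemma Green.of_eq {d d' : Bool → ℤ} {κ κ' : Rat' p q} (h : Green p q d κ) (hd : d = d')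
    (hκ : κ = κ') : Green p q d' κ' := hd ▸ hκ ▸ h

/-- Multiplication is moved past a derivative by the Weyl relation: x ∂κ is ∂(xκ), minus κ when x is
the variable of ∂. -/
lemma Green.mul (h : Green p q d κ) (b : Bool) (i : Fin p) :
    Green p q (d + e1 b) (var b (Sum.inl i) * κ) := by
  induction h with
  | base h => exact .base (h.mul b i)
  | @der d κ c j h ih =>
    by_cases hh : (c, (Sum.inl j : Idx p q)) = (b, Sum.inl i)
    · obtain ⟨rfl, hji⟩ := Prod.mk.inj hh
      obtain rfl := Sum.inl_injective hji
      have h1 : Green p q (d + e1 c - e1 c) κ := h.of_eq (by abel) rfl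
      refine ((ih.der c j).add (h1.smul (-1))).of_eq (by abel) ?_
      rw [der_mul, der_var, if_pos rfl, neg_one_smul]
      ring
    · refine (ih.der c j).of_eq (by abel) ?_
      rw [der_mul, der_var, if_neg hh, mul_zero, add_zero]
  | add _ _ ih ih' => rw [mul_add]; exact ih.add ih'
  | smul c _ ih => rw [mul_smul_comm]; exact ih.smul c

lemma GreenMul.der_inr (h : GreenMul p q d κ) (b : Bool) (j : Fin q) :
    LightCone.der b (Sum.inr j) κ = 0 := by
  induction h with
  | one => rw [Derivation.leibniz_pow, der_invN]; simp [zi]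
  | mul c i h ih => rw [der_mul, ih, der_var]; simp

lemma Green.der_inr (h : Green p q d κ) (b : Bool) (j : Fin q) :
    LightCone.der b (Sum.inr j) κ = 0 := by
  induction h with
  | base h => exact h.der_inr b j
  | der c i h ih => rw [der_comm, ih, map_zero]
  | add _ _ ih ih' => rw [map_add, ih, ih', add_zero]
  | smul c _ ih => rw [Derivation.map_smul, ih, smul_zero]

/-- The Euler operators of the first component. -/
def eulerZ (b : Bool) (P : Rat' p q) : Rat' p q :=
  ∑ j : Fin p, var b (Sum.inl j) * der b (Sum.inl j) P

lemma eulerZ_mul (b : Bool) (P Q : Rat' p q) :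
    eulerZ b (P * Q) = P * eulerZ b Q + Q * eulerZ b P := by
  simp only [eulerZ, der_mul, mul_add, Finset.sum_add_distrib, Finset.mul_sum]
  congr 1 <;> exact Finset.sum_congr rfl fun j _ => by ring

lemma eulerZ_var (b c : Bool) (i : Fin p) :
    eulerZ b (var c (Sum.inl i) : Rat' p q) = if b = c then var c (Sum.inl i) else 0 := by
  simp only [eulerZ, der_var]
  by_cases h : b = c
  · subst h
    simp
  · simp [h]

lemma eulerZ_add (b : Bool) (P Q : Rat' p q) : eulerZ b (P + Q) = eulerZ b P + eulerZ b Q := by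
  simp only [eulerZ, map_add, mul_add, Finset.sum_add_distrib]

lemma eulerZ_smul (b : Bool) (c : ℂ) (P : Rat' p q) : eulerZ b (c • P) = c • eulerZ b P := by
  simp only [eulerZ, Derivation.map_smul, mul_smul_comm, Finset.smul_sum]

lemma eulerZ_der (b c : Bool) (i : Fin p) (P : Rat' p q) :
    eulerZ b (der c (Sum.inl i) P) =
      der c (Sum.inl i) (eulerZ b P) - if b = c then der c (Sum.inl i) P else 0 := by
  have h1 : der c (Sum.inl i) (eulerZ b P) =
      (∑ j : Fin p, var b (Sum.inl j) * der b (Sum.inl j) (der c (Sum.inl i) P)) +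
      ∑ j : Fin p, der b (Sum.inl j) P * der c (Sum.inl i) (var b (Sum.inl j)) := by
    rw [eulerZ, map_sum, ← Finset.sum_add_distrib]
    exact Finset.sum_congr rfl fun j _ => by rw [der_mul, der_comm]
  have h2 : ∑ j : Fin p, der b (Sum.inl j) P * der c (Sum.inl i) (var b (Sum.inl j)) =
      if b = c then der c (Sum.inl i) P else 0 := by
    by_cases h : b = c
    · subst h
      rw [if_pos rfl, Finset.sum_eq_single i]
      · rw [der_var, if_pos rfl, mul_one]
      · intro j _ hj
        rw [der_var, if_neg (by simpa using hj.symm), mul_zero]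
      · simp
    · rw [if_neg h]
      refine Finset.sum_eq_zero fun j _ => ?_
      rw [der_var, if_neg (by simp [Ne.symm h]), mul_zero]
  rw [h1, h2, eulerZ, add_sub_cancel_right]

/-- Euler's identity holds only after evaluation, because `invN` is a free variable of the formal
ring. -/
lemma evr_eulerZ_invN (b : Bool) {v : V p q} (hv : 0 < rz v) :
    evr v (eulerZ b invN) = -evr v invN := by
  have h0 : ((rz v : ℝ) : ℂ) ≠ 0 := by exact_mod_cast hv.ne'
  have h1 : eulerZ b (invN : Rat' p q) =
      -(invN ^ 2 * ∑ i : Fin p, var false (Sum.inl i) * var true (Sum.inl i)) := by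
    rw [eulerZ, Finset.mul_sum, ← Finset.sum_neg_distrib]
    refine Finset.sum_congr rfl fun i _ => ?_
    rw [der_invN]
    cases b <;> simp [zi] <;> ring
  rw [h1, map_neg, map_mul, ← ofReal_rz, map_pow, evr_invN]
  field_simp

lemma evr_eulerZ_invN_pow (b : Bool) (n : ℕ) {v : V p q} (hv : 0 < rz v) :
    evr v (eulerZ b (invN ^ n)) = -n * evr v (invN ^ n) := by
  induction n with
  | zero => simp [eulerZ]
  | succ n ih =>
    rw [pow_succ, eulerZ_mul, map_add, map_mul, map_mul, ih, evr_eulerZ_invN b hv, map_mul]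
    push_cast
    ring

lemma GreenMul.euler (h : GreenMul p q d κ) (b : Bool) {v : V p q} (hv : 0 < rz v) :
    evr v (eulerZ b κ) = d b * evr v κ := by
  induction h with
  | one => rw [evr_eulerZ_invN_pow b _ hv]; push_cast; rfl
  | mul c i h ih =>
    rw [eulerZ_mul, map_add, map_mul, map_mul, ih, eulerZ_var, map_mul, Pi.add_apply, e1_apply]
    split_ifs <;> simp <;> ring

/-- Euler's identity. -/
lemma Green.euler (h : Green p q d κ) (b : Bool) : ∀ {v : V p q}, 0 < rz v →
    evr v (eulerZ b κ) = d b * evr v κ := by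
  induction h with
  | base h => exact fun hv => h.euler b hv
  | @der d κ c i h ih =>
    intro v hv
    have h1 : wd c (Sum.inl i) (fun v => evr v (eulerZ b κ)) v =
        wd c (Sum.inl i) (fun v => (d b : ℂ) * evr v κ) v := by
      refine wd_congr _ _ ?_
      filter_upwards [contDiff_rz.continuous.continuousAt.eventually (lt_mem_nhds hv)] with u hu
      exact ih hu
    rw [wd_evr _ _ _ hv, wd_mul _ _ (differentiableAt_const _) (differentiableAt_evr _ hv),
      wd_const, wd_evr _ _ _ hv] at h1
    rw [eulerZ_der, map_sub, h1, Pi.sub_apply, e1_apply]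
    split_ifs <;> simp <;> ring
  | add _ _ ih ih' => intro v hv; rw [eulerZ_add, map_add, ih hv, ih' hv, map_add, mul_add]
  | smul c _ ih =>
    intro v hv
    rw [eulerZ_smul, map_smul, ih hv, map_smul, smul_eq_mul, smul_eq_mul]
    ring

end Green

/-! ### Monomials in the second component -/

section Psi

/-- Combinations of monomials of given bidegree in the second component, of given weight in one of
the coordinates. -/
inductive WPoly {p q : ℕ} (j₁ : Fin q) : (Bool → ℤ) → ℤ → Rat' p q → Prop
  | zero {d m} : WPoly j₁ d m 0
  | one : WPoly j₁ 0 0 1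
  | mul {d m ψ} (b : Bool) (j : Fin q) : WPoly j₁ d m ψ →
      WPoly j₁ (d + e1 b) (m + if j = j₁ then (if b then -1 else 1) else 0)
        (var b (Sum.inr j) * ψ)
  | add {d m ψ ψ'} : WPoly j₁ d m ψ → WPoly j₁ d m ψ' → WPoly j₁ d m (ψ + ψ')

variable {j₁ : Fin q} {d : Bool → ℤ} {m : ℤ} {ψ : Rat' p q}

lemma WPoly.of_eq {d d' : Bool → ℤ} {m m' : ℤ} {ψ ψ' : Rat' p q} (h : WPoly j₁ d m ψ)
    (hd : d = d') (hm : m = m') (hψ : ψ = ψ') : WPoly j₁ d' m' ψ' := hd ▸ hm ▸ hψ ▸ h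

/-- Only a holomorphic factor w_{j₁} raises the weight, and it raises the holomorphic degree as
well. The exception is needed because 0 is given every weight. -/
lemma WPoly.le_or (h : WPoly j₁ d m ψ) : ψ = 0 ∨ m ≤ d false := by
  induction h with
  | zero => exact Or.inl rfl
  | one => exact Or.inr le_rfl
  | mul b j h ih =>
    rcases ih with ih | ih
    · exact Or.inl (by rw [ih, mul_zero])
    · right
      rw [Pi.add_apply, e1_apply]
      cases b <;> split_ifs <;> simp_all <;> omega
  | add _ _ ih ih' =>
    rcases ih with ih | ih
    · rcases ih' with ih' | ih'
      · exact Or.inl (by rw [ih, ih', add_zero])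
      · exact Or.inr ih'
    · exact Or.inr ih

lemma WPoly.der_inl (h : WPoly j₁ d m ψ) (b : Bool) (i : Fin p) : der b (Sum.inl i) ψ = 0 := by
  induction h with
  | zero => exact map_zero _
  | one => exact Derivation.map_one_eq_zero _
  | mul c j h ih => rw [der_mul, ih, der_var]; simp
  | add _ _ ih ih' => rw [map_add, ih, ih', add_zero]

lemma WPoly.der_inr (h : WPoly j₁ d m ψ) (b : Bool) (j : Fin q) :
    ∃ m', WPoly j₁ (d - e1 b) m' (der b (Sum.inr j) ψ) := by
  -- The induction needs the exact weight, since both Leibniz terms must have the same one.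
  suffices h : WPoly j₁ (d - e1 b) (m - if j = j₁ then (if b then -1 else 1) else 0)
      (der b (Sum.inr j) ψ) from ⟨_, h⟩
  induction h with
  | zero => rw [map_zero]; exact .zero
  | one => rw [Derivation.map_one_eq_zero]; exact .zero
  | @mul d m ψ c i h ih =>
    rw [der_mul, der_var]
    refine .add ((ih.mul c i).of_eq (by abel) (by ring) rfl) ?_
    by_cases hh : (b, (Sum.inr j : Idx p q)) = (c, Sum.inr i)
    · obtain ⟨rfl, hji⟩ := Prod.mk.inj hh
      obtain rfl := Sum.inr_injective hji
      exact h.of_eq (by abel) (by ring) (by simp)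
    · rw [if_neg hh, mul_zero]
      exact .zero
  | add _ _ ih ih' => rw [map_add]; exact ih.add ih'

/-- The infinitesimal rotation of a coordinate of the second component. -/
lemma WPoly.weight (h : WPoly j₁ d m ψ) : var false (Sum.inr j₁) * der false (Sum.inr j₁) ψ -
    var true (Sum.inr j₁) * der true (Sum.inr j₁) ψ = (m : ℂ) • ψ := by
  induction h with
  | zero => simp
  | one => simp
  | @mul d m ψ c i h ih =>
    rw [der_mul, der_mul, der_var, der_var]
    by_cases hi : i = j₁
    · subst hi
      cases c <;> simp [MvPolynomial.smul_eq_C_mul] at ih ⊢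
      · linear_combination (var false (Sum.inr i)) * ih
      · linear_combination (var true (Sum.inr i)) * ih
    · have hi' : ¬ j₁ = i := fun h => hi h.symm
      simp [hi, hi', MvPolynomial.smul_eq_C_mul] at ih ⊢
      linear_combination (var c (Sum.inr i)) * ih
  | add _ _ ih ih' =>
    rw [smul_add, ← ih, ← ih', map_add, map_add]
    ring

end Psi

end LightCone

end

/-! ### The Lie stable test space and integrals over the sphere in z. -/

open scoped Topology ContDiff UniformConvergence ComplexConjugate

noncomputable section

namespace LightCone

set_option linter.unusedSectionVars false

open MeasureTheory Filter

variable {p q : ℕ} {α β : ℂ}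

/-! ### Homogeneity -/

section Homogeneous

/-- Bihomogeneity under dilations. -/
def IsHom (d : Bool → ℤ) (P : Rat' p q) : Prop := ∀ t : ℂ, t ≠ 0 → ∀ v : V p q, 0 < rz v →
  evr (t • v) P = t ^ d false * conj t ^ d true * evr v P

variable {d d' : Bool → ℤ} {P Q : Rat' p q}

lemma IsHom.add (hP : IsHom d P) (hQ : IsHom d Q) : IsHom d (P + Q) := fun t ht v hv => by
  rw [map_add, hP t ht v hv, hQ t ht v hv, map_add, mul_add]

lemma IsHom.smul (c : ℂ) (hP : IsHom d P) : IsHom d (c • P) := fun t ht v hv => by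
  rw [map_smul, hP t ht v hv, map_smul, smul_eq_mul, smul_eq_mul]; ring

lemma IsHom.mul (hP : IsHom d P) (hQ : IsHom d' Q) : IsHom (d + d') (P * Q) := fun t ht v hv => by
  have ht' : conj t ≠ 0 := (map_ne_zero _).2 ht
  rw [map_mul, hP t ht v hv, hQ t ht v hv, map_mul, Pi.add_apply, Pi.add_apply, zpow_add₀ ht,
    zpow_add₀ ht']
  ring

lemma isHom_zero : IsHom d (0 : Rat' p q) := fun t _ v _ => by simp

lemma isHom_one : IsHom 0 (1 : Rat' p q) := fun t _ v _ => by simp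

lemma isHom_var (b : Bool) (a : Idx p q) : IsHom (e1 b) (var b a) := fun t _ v _ => by
  rw [evr_var, evr_var]
  cases b <;> simp [vval, e1_apply, crd_smul]

lemma rz_smul (t : ℂ) (v : V p q) : rz (t • v) = Complex.normSq t * rz v := by
  simp only [rz, Prod.smul_fst, Pi.smul_apply, smul_eq_mul, map_mul, Finset.mul_sum]

lemma isHom_invN : IsHom (fun _ => -1) (invN : Rat' p q) := fun t _ v _ => by
  rw [evr_invN, evr_invN, rz_smul, Complex.ofReal_mul, ← Complex.mul_conj, mul_inv, mul_inv,
    zpow_neg_one, zpow_neg_one]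

lemma isHom_invN_pow (n : ℕ) : IsHom (fun _ => -n) (invN ^ n : Rat' p q) := by
  induction n with
  | zero => simp [IsHom]
  | succ n ih =>
    rw [pow_succ]
    convert ih.mul isHom_invN using 1
    funext b
    simp only [Pi.add_apply]
    push_cast
    ring

lemma fderiv_comp_smul {F : V p q → ℂ} {t : ℂ} {v : V p q} (hF : DifferentiableAt ℝ F (t • v))
    (u : V p q) : fderiv ℝ (fun v => F (t • v)) v u = fderiv ℝ F (t • v) (t • u) := by
  let L : V p q →L[ℝ] V p q :=
    ((LinearMap.lsmul ℂ (V p q) t).restrictScalars ℝ).toContinuousLinearMap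
  have h1 : HasFDerivAt (fun v : V p q => F (t • v)) ((fderiv ℝ F (t • v)).comp L) v :=
    HasFDerivAt.comp v (f := L) (g := F) hF.hasFDerivAt L.hasFDerivAt
  rw [h1.fderiv]
  rfl

lemma wd_comp_smul (b : Bool) (a : Idx p q) {F : V p q → ℂ} {t : ℂ} {v : V p q}
    (hF : DifferentiableAt ℝ F (t • v)) :
    wd b a (fun v => F (t • v)) v = (if b then conj t else t) * wd b a F (t • v) := by
  have hI := Complex.I_mul_I
  cases b
  · change (_ - _) / 2 = t * hd a F (t • v)
    rw [fderiv_comp_smul hF, fderiv_comp_smul hF, smul_smul, fderiv_smul_bas, fderiv_smul_bas,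
      map_mul, Complex.conj_I]
    linear_combination (-(t * hd a F (t • v)) / 2 + conj t * bd a F (t • v) / 2) * hI
  · change (_ + _) / 2 = conj t * bd a F (t • v)
    rw [fderiv_comp_smul hF, fderiv_comp_smul hF, smul_smul, fderiv_smul_bas, fderiv_smul_bas,
      map_mul, Complex.conj_I]
    linear_combination ((t * hd a F (t • v)) / 2 - conj t * bd a F (t • v) / 2) * hI

lemma IsHom.der (hP : IsHom d P) (b : Bool) (a : Idx p q) : IsHom (d - e1 b) (der b a P) := by
  intro t ht v hv
  have ht' : conj t ≠ 0 := (map_ne_zero _).2 ht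
  have hv' : 0 < rz (t • v) := by rw [rz_smul]; exact mul_pos (Complex.normSq_pos.2 ht) hv
  have h1 : wd b a (fun v => evr (t • v) P) v =
      wd b a (fun v => (t ^ d false * conj t ^ d true) * evr v P) v := by
    refine wd_congr _ _ ?_
    filter_upwards [contDiff_rz.continuous.continuousAt.eventually (lt_mem_nhds hv)] with u hu
    exact hP t ht u hu
  rw [wd_comp_smul b a (F := fun v => evr v P) (differentiableAt_evr P hv'), wd_evr _ _ _ hv',
    wd_mul _ _ (differentiableAt_const _) (differentiableAt_evr _ hv), wd_const,
    wd_evr _ _ _ hv] at h1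
  cases b
  · simp only [Pi.sub_apply, e1_apply]
    simp only [Bool.false_eq_true, if_false, if_true, reduceCtorEq, sub_zero,
      zpow_sub_one₀ ht] at h1 ⊢
    field_simp
    linear_combination h1
  · simp only [Pi.sub_apply, e1_apply]
    simp only [if_false, if_true, reduceCtorEq, sub_zero, zpow_sub_one₀ ht'] at h1 ⊢
    field_simp
    linear_combination h1

lemma IsHom.mem_S (hP : IsHom d P) : (fun η : X0 p q => evr η.1 P) ∈ S p q (d false) (d true) := by
  refine ⟨fun η => ⟨Opn p q, fun v => evr v P, isOpen_Opn, mem_Opn η, fun v hv =>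
    (contDiffAt_evr P hv.1).contDiffWithinAt, fun _ _ => rfl⟩, fun t η => ?_⟩
  change evr ((t : ℂ) • η.1) P = _
  have ht := norm_units_pos t
  have ht' : (‖(t : ℂ)‖ : ℂ) ≠ 0 := by exact_mod_cast ht.ne'
  have hn : ((d false : ℤ) : ℂ) - (d true : ℤ) = ((d false - d true : ℤ) : ℂ) := by push_cast; ring
  rw [hP _ t.ne_zero _ (rz_pos η), psi_eq hn]
  congr 1
  have h1 : Complex.exp (((d false : ℤ) + (d true : ℤ)) * (Real.log ‖(t : ℂ)‖ : ℂ)) =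
      (‖(t : ℂ)‖ : ℂ) ^ (d false + d true) := by
    have : (‖(t : ℂ)‖ : ℂ) = Complex.exp (Real.log ‖(t : ℂ)‖ : ℂ) := by
      rw [← Complex.ofReal_exp, Real.exp_log ht]
    conv_rhs => rw [this]
    rw [← Complex.exp_int_mul]
    push_cast
    rfl
  have h2 : conj (t : ℂ) = (‖(t : ℂ)‖ : ℂ) * (‖(t : ℂ)‖ : ℂ) * (t : ℂ)⁻¹ := by
    rw [eq_mul_inv_iff_mul_eq₀ t.ne_zero, mul_comm, Complex.mul_conj, Complex.normSq_eq_norm_sq]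
    push_cast
    ring
  rw [h1, h2, mul_zpow, mul_zpow, inv_zpow, div_zpow, zpow_sub₀ t.ne_zero, zpow_add₀ ht',
    zpow_sub₀ ht']
  field_simp

lemma GreenMul.isHom (h : GreenMul p q d P) : IsHom d P := by
  induction h with
  | one => exact isHom_invN_pow _
  | mul b i h ih =>
    rw [add_comm]
    exact (isHom_var _ _).mul ih

lemma Green.isHom (h : Green p q d P) : IsHom d P := by
  induction h with
  | base h => exact h.isHom
  | der b i h ih => exact ih.der b _
  | add _ _ ih ih' => exact ih.add ih'
  | smul c _ ih => exact ih.smul c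

lemma WPoly.isHom {j₁ : Fin q} {m : ℤ} (h : WPoly j₁ d m P) : IsHom d P := by
  induction h with
  | zero => exact isHom_zero
  | one => exact isHom_one
  | mul b j h ih =>
    rw [add_comm]
    exact (isHom_var _ _).mul ih
  | add _ _ ih ih' => exact ih.add ih'

end Homogeneous

/-! ### The invariant space of test functions -/

section Test

/-- The space spanned by the products of derivatives of multiples of the Green function of the
first component and of polynomials in the second component. -/
def test (j₁ : Fin q) (d : Bool → ℤ) : Submodule ℂ (Rat' p q) :=
  Submodule.span ℂ {P | ∃ c c' m κ ψ, Green p q c κ ∧ WPoly j₁ c' m ψ ∧ c + c' = d ∧ κ * ψ = P}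

variable {j₁ : Fin q} {d : Bool → ℤ} {P : Rat' p q}

lemma test_induction {C : (P : Rat' p q) → Prop}
    (h : ∀ c c' m κ ψ, Green p q c κ → WPoly j₁ c' m ψ → c + c' = d → C (κ * ψ)) (h0 : C 0)
    (hadd : ∀ P Q, C P → C Q → C (P + Q)) (hsmul : ∀ (c : ℂ) P, C P → C (c • P))
    (hP : P ∈ test j₁ d) : C P := by
  refine Submodule.span_induction (p := fun P _ => C P) ?_ h0 (fun P Q _ _ => hadd P Q)
    (fun c P _ => hsmul c P) hP
  rintro _ ⟨c, c', m, κ, ψ, h1, h2, h3, rfl⟩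
  exact h c c' m κ ψ h1 h2 h3

lemma mul_mem_test {c c' : Bool → ℤ} {m : ℤ} {κ ψ : Rat' p q} (hκ : Green p q c κ)
    (hψ : WPoly j₁ c' m ψ) (h : c + c' = d) : κ * ψ ∈ test j₁ d :=
  Submodule.subset_span ⟨c, c', m, κ, ψ, hκ, hψ, h, rfl⟩

lemma isHom_of_mem_test (hP : P ∈ test j₁ d) : IsHom d P :=
  test_induction (C := IsHom d) (fun c c' m κ ψ h1 h2 h3 => by rw [← h3]; exact h1.isHom.mul h2.isHom) isHom_zero
    (fun _ _ => IsHom.add) (fun c _ => IsHom.smul c) hP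

lemma var_mul_mem_test (b : Bool) (a : Idx p q) (hP : P ∈ test j₁ d) :
    var b a * P ∈ test j₁ (d + e1 b) := by
  refine test_induction (C := fun P => var b a * P ∈ test j₁ (d + e1 b)) ?_ ?_ ?_ ?_ hP
  · rintro c c' m κ ψ h1 h2 rfl
    rcases a with i | j
    · rw [← mul_assoc]
      exact mul_mem_test (h1.mul b i) h2 (by abel)
    · rw [mul_left_comm]
      exact mul_mem_test h1 (h2.mul b j) (by abel)
  · rw [mul_zero]; exact Submodule.zero_mem _
  · intro P Q hP hQ; rw [mul_add]; exact Submodule.add_mem _ hP hQ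
  · intro c P hP; rw [mul_smul_comm]; exact Submodule.smul_mem _ c hP

lemma der_mem_test (b : Bool) (a : Idx p q) (hP : P ∈ test j₁ d) :
    der b a P ∈ test j₁ (d - e1 b) := by
  refine test_induction (C := fun P => der b a P ∈ test j₁ (d - e1 b)) ?_ ?_ ?_ ?_ hP
  · rintro c c' m κ ψ h1 h2 rfl
    rcases a with i | j
    · rw [der_mul, h2.der_inl, mul_zero, zero_add, mul_comm]
      exact mul_mem_test (h1.der b i) h2 (by abel)
    · obtain ⟨m', hm'⟩ := h2.der_inr b j
      rw [der_mul, h1.der_inr, mul_zero, add_zero]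
      exact mul_mem_test h1 hm' (by abel)
  · rw [map_zero]; exact Submodule.zero_mem _
  · intro P Q hP hQ; rw [map_add]; exact Submodule.add_mem _ hP hQ
  · intro c P hP; rw [Derivation.map_smul]; exact Submodule.smul_mem _ c hP

/-- Coordinates and derivatives act on the span of all products κψ, and a matrix unit operator is a
coordinate times the derivative of the same type, which restores the bidegree. -/
lemma rE_mem_test (a b : Idx p q) (hP : P ∈ test j₁ d) : rE a b P ∈ test j₁ d := by
  have h : ∀ c (a b : Idx p q), var c b * der c a P ∈ test j₁ d := fun c a b => by
    have := var_mul_mem_test c b (der_mem_test c a hP)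
    rwa [sub_add_cancel] at this
  exact Submodule.sub_mem _ (Submodule.smul_mem _ _ (h _ _ _)) (Submodule.smul_mem _ _ (h _ _ _))

end Test

/-! ### Integrals over the base orbit -/

section Integrals

variable [NeZero p] [NeZero q]

/-- The integral over the base orbit. -/
def intK (P : Rat' p q) : ℂ := ∫ k, evr (orb k) P ∂haarK p q

lemma rz_orb_pos (k : K p q) : 0 < rz (orb k) := by rw [rz_orb]; exact one_pos

lemma smoothOnOrb_evr (P : Rat' p q) : SmoothOnOrb fun v : V p q => evr v P :=
  fun k => contDiffAt_evr P (rz_orb_pos k)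

lemma integrable_evr (P : Rat' p q) : Integrable (fun k => evr (orb k) P) (haarK p q) :=
  integrable_K (smoothOnOrb_evr P).continuous

lemma intK_congr {P Q : Rat' p q} (h : ∀ k : K p q, evr (orb k) P = evr (orb k) Q) :
    intK P = intK Q := integral_congr_ae (Eventually.of_forall h)

lemma intK_add (P Q : Rat' p q) : intK (P + Q) = intK P + intK Q := by
  simp only [intK, map_add]
  exact integral_add (integrable_evr P) (integrable_evr Q)

lemma intK_smul (c : ℂ) (P : Rat' p q) : intK (c • P) = c * intK P := by
  simp only [intK, map_smul, smul_eq_mul]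
  exact integral_const_mul _ _

lemma intK_zero : intK (0 : Rat' p q) = 0 := by simp [intK]

lemma intK_sum {ι : Type*} (s : Finset ι) (P : ι → Rat' p q) :
    intK (∑ i ∈ s, P i) = ∑ i ∈ s, intK (P i) := by
  simp only [intK, map_sum]
  exact integral_finsetSum _ fun i _ => integrable_evr _

lemma intK_rE {a b : Idx p q} (hab : SameSide a b) (P : Rat' p q) : intK (rE a b P) = 0 := by
  rw [← integral_lieE_same (smoothOnOrb_evr P) hab]
  exact integral_congr_ae (Eventually.of_forall fun k => (lieE_evr a b P (rz_orb_pos k)).symm)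

lemma intK_rot (b : Bool) (i j : Fin p) (P : Rat' p q) :
    intK (var b (Sum.inl j) * der b (Sum.inl i) P -
      var (!b) (Sum.inl i) * der (!b) (Sum.inl j) P) = 0 := by
  cases b
  · have := intK_rE (p := p) (q := q) (a := Sum.inl i) (b := Sum.inl j) trivial P
    simpa [rE, sg] using this
  · have := intK_rE (p := p) (q := q) (a := Sum.inl j) (b := Sum.inl i) trivial P
    have h2 : var true (Sum.inl j) * der true (Sum.inl i) P -
        var (!true) (Sum.inl i) * der (!true) (Sum.inl j) P =
        (-1 : ℂ) • rE (Sum.inl j) (Sum.inl i) P := by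
      simp [rE, sg]
    rw [h2, intK_smul, this, mul_zero]

/-- Elements not involving the first component. -/
def IsW (φ : Rat' p q) : Prop := ∀ (b : Bool) (i : Fin p), der b (Sum.inl i) φ = 0

lemma IsW.eulerZ {φ : Rat' p q} (h : IsW φ) (b : Bool) : eulerZ b φ = 0 := by
  simp [LightCone.eulerZ, h b]

lemma evr_orb_sum (b : Bool) (k : K p q) :
    ∑ j : Fin p, evr (orb k) (var b (Sum.inl j)) * evr (orb k) (var (!b) (Sum.inl j)) = 1 := by
  have h := sum_fst_orb k
  cases b <;> simp only [evr_var, vval]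
  · simpa using h
  · simpa [mul_comm] using h

variable {d : Bool → ℤ} {κ φ : Rat' p q}

/-- Integration by parts on the sphere of the first component. -/
lemma intK_der_mul (h : Green p q d κ) (hφ : IsW φ) (b : Bool) (i : Fin p) :
    intK (der b (Sum.inl i) κ * φ) = (d (!b) + p) * intK (var (!b) (Sum.inl i) * κ * φ) := by
  -- Rotations of the sphere are applied to x_j' κ φ, where x_j' is the coordinate of type !b, and
  -- summed over j. The sum of the products x_j x_j' is 1 on the orbit, Euler's identity contributes
  -- d (!b), and differentiating the x_j' contributes p.
  have h1 : ∑ j : Fin p, intK (var b (Sum.inl j) * der b (Sum.inl i)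
      (var (!b) (Sum.inl j) * κ * φ) - var (!b) (Sum.inl i) * der (!b) (Sum.inl j)
      (var (!b) (Sum.inl j) * κ * φ)) = 0 := Finset.sum_eq_zero fun j _ => intK_rot b i j _
  rw [← intK_sum] at h1
  rw [← sub_eq_zero, sub_eq_add_neg, ← neg_mul, ← intK_smul, ← intK_add, ← h1]
  refine intK_congr fun k => ?_
  have hE := h.euler (!b) (rz_orb_pos k)
  have hs := evr_orb_sum b k
  have hne : ∀ j : Fin p, der b (Sum.inl i) (var (!b) (Sum.inl j) : Rat' p q) = 0 := fun j => by
    rw [der_var, if_neg (by cases b <;> simp)]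
  have h2 : ∀ j : Fin p, var b (Sum.inl j) * der b (Sum.inl i)
      (var (!b) (Sum.inl j) * κ * φ) - var (!b) (Sum.inl i) * der (!b) (Sum.inl j)
      (var (!b) (Sum.inl j) * κ * φ) =
      (var b (Sum.inl j) * var (!b) (Sum.inl j)) * (der b (Sum.inl i) κ * φ) -
      var (!b) (Sum.inl i) * φ * (κ + var (!b) (Sum.inl j) * der (!b) (Sum.inl j) κ) := by
    intro j
    rw [der_mul, der_mul, der_mul, der_mul, hφ, hφ, hne, der_var, if_pos rfl]
    ring
  simp only [h2]
  rw [Finset.sum_sub_distrib, ← Finset.sum_mul, ← Finset.mul_sum, Finset.sum_add_distrib]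
  change _ = evr (orb k) (_ - _ * (_ + LightCone.eulerZ (!b) κ))
  simp only [map_add, map_sub, map_mul, map_sum, map_smul, hs, hE, smul_eq_mul, Finset.sum_const,
    Finset.card_univ, Fintype.card_fin, nsmul_eq_mul, map_natCast]
  ring

/-- Derivatives of the Green function of very negative degree integrate to zero. -/
lemma intK_green_eq_zero (n : ℕ) : ∀ {d : Bool → ℤ} {κ φ : Rat' p q}, Green p q d κ → IsW φ →
    (∀ b, d b = -p - n) → intK (κ * φ) = 0 := by
  have hp : 0 < p := NeZero.pos p
  induction n with
  | zero =>
    intro d κ φ h hφ hd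
    induction h with
    -- Undifferentiated elements have degree at least -(p - 1), so this case is empty.
    | base h => have := h.neg_le false; rw [hd] at this; omega
    | @der d κ b i h ih =>
      have h1 := hd (!b)
      rw [Pi.sub_apply, e1_apply, if_neg (by cases b <;> simp)] at h1
      -- The vanishing of the residue of a derivative: at degree -p the factor d (!b) + p of the
      -- integration by parts is zero.
      rw [intK_der_mul h hφ, show d (!b) = -p by omega]
      push_cast
      ring
    | add _ _ ih ih' => rw [add_mul, intK_add, ih hd, ih' hd, add_zero]
    | smul c _ ih => rw [smul_mul_assoc, intK_smul, ih hd, mul_zero]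
  | succ n ihn =>
    intro d κ φ h hφ hd
    induction h with
    | base h => have := h.neg_le false; rw [hd] at this; omega
    | @der d κ b i h ih =>
      -- Replacing the derivative of type b by the coordinate of type !b raises both degrees by one,
      -- to -p - n.
      rw [intK_der_mul h hφ, ihn (h.mul (!b) i) hφ, mul_zero]
      intro c
      have h1 := hd c
      rw [Pi.sub_apply, e1_apply] at h1
      rw [Pi.add_apply, e1_apply]
      have h2 : (c = !b) ↔ ¬ c = b := by cases b <;> cases c <;> simp
      by_cases hc : c = b
      · rw [if_pos hc] at h1
        rw [if_neg fun h => h2.1 h hc]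
        push_cast at h1
        omega
      · rw [if_neg hc] at h1
        rw [if_pos (h2.2 hc)]
        push_cast at h1
        omega
    | add _ _ ih ih' => rw [add_mul, intK_add, ih hd, ih' hd, add_zero]
    | smul c _ ih => rw [smul_mul_assoc, intK_smul, ih hd, mul_zero]

/-- The difference of the two Euler operators generates the phase rotation of z alone. Its integral
vanishes, and it acts on the integrand by d false - d true. -/
lemma intK_green_eq_zero_of_ne (h : Green p q d κ) (hφ : IsW φ) (hd : d false ≠ d true) :
    intK (κ * φ) = 0 := by
  have h1 : ∑ i : Fin p, intK (var false (Sum.inl i) * der false (Sum.inl i) (κ * φ) -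
      var (!false) (Sum.inl i) * der (!false) (Sum.inl i) (κ * φ)) = 0 :=
    Finset.sum_eq_zero fun i _ => intK_rot false i i _
  rw [← intK_sum, Finset.sum_sub_distrib] at h1
  change intK (eulerZ false (κ * φ) - eulerZ true (κ * φ)) = 0 at h1
  rw [eulerZ_mul, eulerZ_mul, hφ.eulerZ, hφ.eulerZ] at h1
  have h2 : intK (((d false : ℂ) - d true) • (κ * φ)) = 0 := by
    rw [← h1]
    refine intK_congr fun k => ?_
    simp only [map_smul, map_sub, map_add, map_mul, h.euler _ (rz_orb_pos k), smul_eq_mul,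
      map_zero]
    ring
  rw [intK_smul] at h2
  refine (mul_eq_zero.1 h2).resolve_left (sub_ne_zero.2 ?_)
  exact_mod_cast hd

end Integrals

end LightCone

end

/-! ### Vanishing integrals, and test functions that are not zero. -/

open scoped Topology ContDiff UniformConvergence ComplexConjugate

noncomputable section

namespace LightCone

set_option linter.unusedSectionVars false

open MeasureTheory Filter

variable {p q : ℕ} {α β : ℂ} [NeZero p] [NeZero q]

/-! ### A function orthogonal to the test functions -/

section Orthogonality

lemma isW_var_pow_mul (b c : Bool) (j l : Fin q) (m n : ℕ) :
    IsW (var b (Sum.inr j) ^ m * var c (Sum.inr l) ^ n : Rat' p q) := fun e i => by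
  rw [der_mul, Derivation.leibniz_pow, Derivation.leibniz_pow, der_var, der_var]
  simp

lemma IsW.mul {φ ψ : Rat' p q} (hφ : IsW φ) (hψ : IsW ψ) : IsW (φ * ψ) := fun b i => by
  rw [der_mul, hφ, hψ, mul_zero, mul_zero, add_zero]

/-- The weight of one coordinate of the second component. -/
def wtOp (j₁ : Fin q) (P : Rat' p q) : Rat' p q :=
  var false (Sum.inr j₁) * der false (Sum.inr j₁) P - var true (Sum.inr j₁) * der true (Sum.inr j₁) P

lemma wtOp_mul (j₁ : Fin q) (P Q : Rat' p q) :
    wtOp j₁ (P * Q) = P * wtOp j₁ Q + Q * wtOp j₁ P := by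
  simp only [wtOp, der_mul]
  ring

lemma intK_wtOp (j₁ : Fin q) (P : Rat' p q) : intK (wtOp j₁ P) = 0 := by
  have h := intK_rE (p := p) (q := q) (a := Sum.inr j₁) (b := Sum.inr j₁) trivial P
  have h2 : wtOp j₁ P = (-1 : ℂ) • rE (Sum.inr j₁) (Sum.inr j₁) P := by
    simp [rE, wtOp, sg]
    ring
  rw [h2, intK_smul, h, mul_zero]

lemma intK_eq_zero_of_weight {j₁ : Fin q} {P : Rat' p q} {m : ℤ} (h : wtOp j₁ P = (m : ℂ) • P)
    (hm : m ≠ 0) : intK P = 0 := by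
  have h1 := intK_wtOp j₁ P
  rw [h, intK_smul] at h1
  exact (mul_eq_zero.1 h1).resolve_left (by exact_mod_cast hm)

lemma wtOp_var_pow {j₀ j₁ : Fin q} (hj : j₀ ≠ j₁) (a b : ℕ) :
    wtOp j₁ (var false (Sum.inr j₀) ^ a * var true (Sum.inr j₁) ^ b : Rat' p q) =
      ((-b : ℤ) : ℂ) • (var false (Sum.inr j₀) ^ a * var true (Sum.inr j₁) ^ b) := by
  have h1 : wtOp j₁ (var false (Sum.inr j₀) ^ a : Rat' p q) = 0 := by
    rw [wtOp, Derivation.leibniz_pow, Derivation.leibniz_pow, der_var, der_var]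
    simp [hj.symm]
  have h2 : wtOp j₁ (var true (Sum.inr j₁) ^ b : Rat' p q) =
      ((-b : ℤ) : ℂ) • var true (Sum.inr j₁) ^ b := by
    rw [wtOp, Derivation.leibniz_pow, Derivation.leibniz_pow, der_var, der_var]
    rcases b with _ | b
    · simp
    · simp [MvPolynomial.smul_eq_C_mul, pow_succ]
      ring
  rw [wtOp_mul, h1, h2, mul_zero, add_zero, mul_smul_comm]

/-- High powers of a conjugate coordinate of the second component are orthogonal to the test
functions. -/
lemma intK_test_eq_zero {j₀ j₁ : Fin q} (hj : j₀ ≠ j₁) {d : Bool → ℤ} {a b : ℕ}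
    (hb : d false + p - 1 < b) {P : Rat' p q} (hP : P ∈ test j₁ d) :
    intK (P * (var false (Sum.inr j₀) ^ a * var true (Sum.inr j₁) ^ b)) = 0 := by
  set φ : Rat' p q := var false (Sum.inr j₀) ^ a * var true (Sum.inr j₁) ^ b with hφ
  refine test_induction (C := fun P => intK (P * φ) = 0) ?_ ?_ ?_ ?_ hP
  · rintro c c' m κ ψ h1 h2 rfl
    have hψ : IsW ψ := fun b i => h2.der_inl b i
    have hφ' : IsW φ := isW_var_pow_mul _ _ _ _ _ _
    rw [mul_assoc]
    -- Unequal bidegrees of κ are killed by the phase rotation in z, equal ones at most -p by the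
    -- residue argument, and all others by the weight in w_{j₁}.
    by_cases hc : c false = c true
    · by_cases hcp : c false ≤ -p
      · obtain ⟨n, hn⟩ := Int.le.dest hcp
        refine intK_green_eq_zero n h1 (hψ.mul hφ') fun e => ?_
        cases e <;> omega
      · rcases h2.le_or with h0 | hm
        · rw [h0, zero_mul, mul_zero, intK_zero]
        -- Here c false ≥ 1 - p, so the weight of ψ satisfies m ≤ c' false ≤ d false + p - 1 < b,
        -- and the total weight m - b is negative.
        · have h3 : wtOp j₁ (κ * (ψ * φ)) = ((m - b : ℤ) : ℂ) • (κ * (ψ * φ)) := by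
            have h4 : wtOp j₁ κ = 0 := by simp [wtOp, h1.der_inr]
            have h5 : wtOp j₁ ψ = (m : ℂ) • ψ := h2.weight
            rw [wtOp_mul, wtOp_mul, h4, h5, hφ, wtOp_var_pow hj]
            simp only [MvPolynomial.smul_eq_C_mul]
            push_cast
            simp only [map_sub, map_neg]
            ring
          refine intK_eq_zero_of_weight h3 ?_
          rw [Pi.add_apply] at hb
          omega
    · exact intK_green_eq_zero_of_ne h1 (hψ.mul hφ') hc
  · rw [zero_mul, intK_zero]
  · intro P Q hP hQ
    rw [add_mul, intK_add, hP, hQ, add_zero]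
  · intro c P hP
    rw [smul_mul_assoc, intK_smul, hP, mul_zero]

end Orthogonality

/-! ### A nonzero test function -/

section Nonzero

lemma Green.of_smul {d : Bool → ℤ} {κ : Rat' p q} {c : ℂ} (hc : c ≠ 0)
    (h : Green p q d (c • κ)) : Green p q d κ := by
  have := h.smul c⁻¹
  rwa [smul_smul, inv_mul_cancel₀ hc, one_smul] at this

/-- The derivative of |z|^(-2N) is -N |z|^(-2N-2) times the coordinate of opposite type, and -N can
be divided out. -/
lemma Green.invN_pow {d : Bool → ℤ} {N : ℕ} {φ : Rat' p q} (hN : N ≠ 0)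
    (h : Green p q d (invN ^ N * φ)) {b : Bool} {i : Fin p}
    (hφ : LightCone.der b (Sum.inl i) φ = 0) :
    Green p q (d - e1 b) (invN ^ (N + 1) * (var (!b) (Sum.inl i) * φ)) := by
  refine (((h.der b i).of_eq rfl (κ' := (-(N : ℂ)) • _) ?_).of_smul
    (neg_ne_zero.2 (Nat.cast_ne_zero.2 hN)))
  rw [der_mul, hφ, Derivation.leibniz_pow, der_invN]
  obtain ⟨N, rfl⟩ := Nat.exists_eq_succ_of_ne_zero hN
  simp [zi, MvPolynomial.smul_eq_C_mul, pow_succ]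
  ring

/-- Repeated differentiation of the Green function. Since p ≥ 2 the initial exponent p - 1 is
positive and no numerical factor vanishes. The two distinct indices keep each new derivative from
acting on the monomial already produced. -/
lemma green_monomial (hp : 2 ≤ p) {i₀ i₁ : Fin p} (hi : i₀ ≠ i₁) (m n : ℕ) :
    ∃ d : Bool → ℤ, d false = -(p - 1 : ℕ) - m ∧ d true = -(p - 1 : ℕ) - n ∧
    Green p q d (invN ^ (p - 1 + m + n) *
      (var true (Sum.inl i₀) ^ m * var false (Sum.inl i₁) ^ n)) := by
  have hne : ∀ (b c : Bool) (i j : Fin p) (k : ℕ), (b, i) ≠ (c, j) →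
      der b (Sum.inl i) (var c (Sum.inl j) ^ k : Rat' p q) = 0 := by
    intro b c i j k h
    rw [Derivation.leibniz_pow, der_var, if_neg (by simpa using h)]
    simp
  induction m with
  | zero =>
    induction n with
    | zero =>
      exact ⟨fun _ => -(p - 1 : ℕ), by simp, by simp, by simpa using Green.base GreenMul.one⟩
    | succ n ih =>
      obtain ⟨d, h1, h2, h3⟩ := ih
      refine ⟨d - e1 true, ?_, ?_, (h3.invN_pow (b := true) (i := i₁) (by omega) ?_).of_eq rfl ?_⟩
      · rw [Pi.sub_apply, e1_apply, h1]; simp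
      · rw [Pi.sub_apply, e1_apply, h2]; push_cast; simp; ring
      · rw [der_mul, hne _ _ _ _ _ (by simp), hne _ _ _ _ _ (by simp [hi.symm])]; simp
      · simp [pow_succ]; ring
  | succ m ih =>
    obtain ⟨d, h1, h2, h3⟩ := ih
    refine ⟨d - e1 false, ?_, ?_, (h3.invN_pow (b := false) (i := i₀) (by omega) ?_).of_eq rfl ?_⟩
    · rw [Pi.sub_apply, e1_apply, h1]; push_cast; simp; ring
    · rw [Pi.sub_apply, e1_apply, h2]; simp
    · rw [der_mul, hne _ _ _ _ _ (by simp [hi]), hne _ _ _ _ _ (by simp)]; simp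
    · rw [Bool.not_false, show p - 1 + (m + 1) + n = p - 1 + m + n + 1 by ring]
      ring

lemma wpoly_pow (j₁ j : Fin q) (m n : ℕ) : ∃ (d : Bool → ℤ) (k : ℤ), d false = m ∧ d true = n ∧
    WPoly j₁ d k (var false (Sum.inr j) ^ m * var true (Sum.inr j) ^ n : Rat' p q) := by
  induction m with
  | zero =>
    induction n with
    | zero => exact ⟨0, 0, rfl, rfl, by simpa using WPoly.one⟩
    | succ n ih =>
      obtain ⟨d, k, h1, h2, h3⟩ := ih
      refine ⟨_, _, ?_, ?_, (h3.mul true j).of_eq rfl rfl (by ring)⟩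
      · rw [Pi.add_apply, e1_apply, h1]; simp
      · rw [Pi.add_apply, e1_apply, h2]; push_cast; simp
  | succ m ih =>
    obtain ⟨d, k, h1, h2, h3⟩ := ih
    refine ⟨_, _, ?_, ?_, (h3.mul false j).of_eq rfl rfl (by ring)⟩
    · rw [Pi.add_apply, e1_apply, h1]; push_cast; simp
    · rw [Pi.add_apply, e1_apply, h2]; simp

/-- There are test functions that do not vanish identically. -/
lemma exists_test_ne_zero (hp : 2 ≤ p) (j₁ : Fin q) (d : Bool → ℤ) :
    ∃ P ∈ test (p := p) j₁ d, ∃ k : K p q, evr (orb k) P ≠ 0 := by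
  let i₀ : Fin p := ⟨0, by omega⟩
  let i₁ : Fin p := ⟨1, by omega⟩
  have hi : i₀ ≠ i₁ := by simp [i₀, i₁]
  -- The derivatives make the bidegree of κ so negative that the missing bidegree d - c is
  -- nonnegative and is supplied by a monomial in w.
  obtain ⟨c, h1, h2, h3⟩ := green_monomial (q := q) hp hi (d false).natAbs (d true).natAbs
  obtain ⟨c', k, h1', h2', h3'⟩ := wpoly_pow (p := p) j₁ j₁
    (d false + (p - 1 : ℕ) + (d false).natAbs).toNat (d true + (p - 1 : ℕ) + (d true).natAbs).toNat
  refine ⟨_, mul_mem_test h3 h3' ?_, ?_⟩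
  · funext b
    rw [Pi.add_apply]
    cases b <;> omega
  -- A point of the product of spheres at which every coordinate in the chosen test function is
  -- nonzero.
  · let v : V p q := (Pi.single i₀ (3 / 5) + Pi.single i₁ (4 / 5), Pi.single j₁ 1)
    have hv0 : v.1 i₀ = 3 / 5 := by simp [v, hi]
    have hv1 : v.1 i₁ = 4 / 5 := by simp [v, hi.symm]
    have hvw : v.2 j₁ = 1 := by simp [v]
    have hrz : rz v = 1 := by
      rw [rz, ← Finset.sum_subset (Finset.subset_univ {i₀, i₁}), Finset.sum_pair hi, hv0, hv1]
      · norm_num [Complex.normSq_div]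
      · intro i _ hi'
        simp only [Finset.mem_insert, Finset.mem_singleton, not_or] at hi'
        simp [v, hi'.1, hi'.2]
    have hrw : rw' v = 1 := by
      rw [rw', Finset.sum_eq_single j₁]
      · simp [hvw]
      · intro j _ hj
        simp [v, hj]
      · simp
    obtain ⟨k, hk⟩ := exists_orb_eq hrz hrw
    refine ⟨k, ?_⟩
    rw [hk]
    simp [evr_var, evr_invN, vval, crd, hrz, hv0, hv1, hvw]

end Nonzero

end LightCone

end

/-! ### From Lie algebra invariance to group invariance. -/

open scoped Topology ContDiff UniformConvergence ComplexConjugate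

noncomputable section

namespace LightCone

set_option linter.unusedSectionVars false

open MeasureTheory Filter

variable {p q : ℕ} {α β : ℂ}

/-! ### Generation by reflections -/

section Generation

lemma form_bas (a b : Idx p q) (hab : a ≠ b) : form (bas a : V p q) (bas b) = 0 := by
  rw [form_eq_sum]
  refine Finset.sum_eq_zero fun c _ => ?_
  rw [crd_bas, crd_bas]
  by_cases h : c = a
  · rw [if_neg (fun h' => hab (h.symm.trans h'))]; simp
  · rw [if_neg h]; simp

lemma form_bas_self (a : Idx p q) : form (bas a : V p q) (bas a) ≠ 0 := by
  rcases a with i | i <;> simp [form, bas, Pi.single_apply]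

lemma refl_of_form_eq_zero {x v : V p q} (hx : form x x ≠ 0) (t : ℝ) (h : form v x = 0) :
    (refl x hx t).1 v = v := by
  rw [refl_apply, h, mul_zero, zero_smul, add_zero]

/-- The group `U(p,q)` is generated by reflections. -/
lemma mem_of_refl_mem (H : Subgroup (U p q)) (h : ∀ x hx t, refl x hx t ∈ H) (g : U p q) :
    g ∈ H := by
  suffices key : ∀ (s : Finset (Idx p q)) (g : U p q), (∀ b, b ∉ s → g.1 (bas b) = bas b) → g ∈ H
    from key Finset.univ g fun b hb => (hb (Finset.mem_univ b)).elim
  intro s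
  induction s using Finset.induction_on with
  | empty =>
    intro g hg
    have : g = 1 := by
      refine Subtype.ext (LinearEquiv.ext fun v => ?_)
      change g.1 v = v
      conv_lhs => rw [← sum_crd_bas v]
      conv_rhs => rw [← sum_crd_bas v]
      rw [map_sum]
      exact Finset.sum_congr rfl fun b _ => by rw [map_smul, hg b (Finset.notMem_empty b)]
    rw [this]
    exact H.one_mem
  | insert a s ha ih =>
    intro g hg
    -- Two reflections in the span of g e_a and e_a bring g e_a back to e_a. They fix the basis
    -- vectors already fixed by g, because these are orthogonal to that span.
    obtain ⟨x, y, hx, hy, t, u, hxs, hys, hxy⟩ :=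
      exists_refl_refl (v := g.1 (bas a)) (e := bas a) (g.2 _ _) (form_bas_self a)
    have hort : ∀ b, b ∉ insert a s →
        ∀ x ∈ Submodule.span ℂ {g.1 (bas a), bas a}, form (bas b) x = 0 := by
      intro b hb x hx
      have hba : b ≠ a := fun h => hb (h ▸ Finset.mem_insert_self _ _)
      obtain ⟨c, d, rfl⟩ := Submodule.mem_span_pair.1 hx
      have h1 : form (bas b) (g.1 (bas a)) = 0 := by
        have := g.2 (bas b) (bas a)
        rwa [hg b hb, form_bas b a hba] at this
      rw [form_add_right, form_smul_right, form_smul_right, h1, form_bas b a hba]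
      simp
    have hr : refl x hx t * refl y hy u * g ∈ H := by
      refine ih _ fun b hb => ?_
      change (refl x hx t).1 ((refl y hy u).1 (g.1 (bas b))) = bas b
      by_cases hba : b = a
      · rw [hba]; exact hxy
      · have hb' : b ∉ insert a s := fun h => (Finset.mem_insert.1 h).elim hba hb
        rw [hg b hb', refl_of_form_eq_zero hy u (hort b hb' y hys),
          refl_of_form_eq_zero hx t (hort b hb' x hxs)]
    exact (H.mul_mem_cancel_left (H.mul_mem (h _ _ _) (h _ _ _))).1 hr

end Generation

variable [NeZero p] [NeZero q]

/-! ### Invariance of the pairing -/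

section Pairing

lemma continuous_refl_orbX (x : V p q) (hx : form x x ≠ 0) :
    Continuous fun y : ℝ × K p q => act (refl x hx y.1) (orbX y.2) := by
  refine Continuous.subtype_mk ?_ _
  have h1 : Continuous fun y : ℝ × K p q => form (orb y.2) x :=
    (((formL x).toContinuousLinearMap).continuous).comp (continuous_orb.comp continuous_snd)
  have h2 : Continuous fun y : ℝ × K p q => orb y.2 := continuous_orb.comp continuous_snd
  change Continuous fun y : ℝ × K p q => (refl x hx y.1).1 (orb y.2)
  simp only [refl_apply]
  refine h2.add (Continuous.fun_smul ?_ continuous_const)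
  refine Continuous.mul ?_ h1
  fun_prop

lemma continuous_of_isSmooth {f : X0 p q → ℂ} (hf : IsSmooth f) : Continuous f := by
  refine continuous_iff_continuousAt.2 fun x => ?_
  obtain ⟨O, F, hO, hx, hF, hfF⟩ := hf x
  have h1 : ContinuousAt (fun y : X0 p q => F y.1) x :=
    ((hF.continuousOn.continuousAt (hO.mem_nhds hx))).comp continuous_subtype_val.continuousAt
  refine h1.congr ?_
  filter_upwards [continuous_subtype_val.continuousAt.preimage_mem_nhds (hO.mem_nhds hx)] with y hy
  exact (hfF y hy).symm

/-- Global form of integration by parts: the derivative in t is the integral of a Lie derivative of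
a density of the same kind, so it vanishes for all t. -/
lemma integral_refl {h : X0 p q → ℂ} (hα : α = -(p + q - 1)) (hβ : β = -(p + q - 1))
    (hh : h ∈ S p q α β) (x : V p q) (hx : form x x ≠ 0) (t : ℝ) :
    ∫ k, h (act (refl x hx t) (orbX k)) ∂haarK p q = ∫ k, h (orbX k) ∂haarK p q := by
  have hc' : Continuous fun y : ℝ × K p q =>
      lieFun α β x h (act (refl x hx y.1) (orbX y.2)) :=
    Continuous.comp (continuous_of_isSmooth (lieFun_mem hh hx).1) (continuous_refl_orbX x hx)
  have hct : ∀ t, Continuous fun k : K p q => h (act (refl x hx t) (orbX k)) :=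
    fun t => continuous_orbX_comp (comp_act_mem (refl x hx t) hh).1
  have hct' : ∀ t, Continuous fun k : K p q => lieFun α β x h (act (refl x hx t) (orbX k)) :=
    fun t => continuous_orbX_comp (comp_act_mem (refl x hx t) (lieFun_mem hh hx)).1
  have hder : ∀ t₀ : ℝ, HasDerivAt
      (fun t : ℝ => ∫ k, h (act (refl x hx t) (orbX k)) ∂haarK p q) 0 t₀ := by
    intro t₀
    obtain ⟨B, hB⟩ := (isCompact_Icc.prod isCompact_univ :
      IsCompact (Set.Icc (t₀ - 1) (t₀ + 1) ×ˢ (Set.univ : Set (K p q)))).exists_bound_of_continuousOn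
      hc'.continuousOn
    have hd := hasDerivAt_integral_of_dominated_loc_of_deriv_le (μ := haarK p q)
      (F := fun (t : ℝ) k => h (act (refl x hx t) (orbX k)))
      (F' := fun t k => lieFun α β x h (act (refl x hx t) (orbX k)))
      (x₀ := t₀) (s := Set.Icc (t₀ - 1) (t₀ + 1)) (bound := fun _ => B)
      (Icc_mem_nhds (by linarith) (by linarith))
      (Eventually.of_forall fun t => (hct t).aestronglyMeasurable)
      (integrable_K (hct t₀))
      (hct' t₀).aestronglyMeasurable
      (Eventually.of_forall fun k t ht => hB (t, k) ⟨ht, trivial⟩)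
      (integrable_const B)
      (Eventually.of_forall fun k t _ => hasDerivAt_act hh hx (orbX k) t)
    have h2 := hd.2
    -- By the one-parameter group law the derivative at t₀ is the Lie derivative at time 0 of the
    -- translated function.
    have h3 : ∀ η, lieFun α β x h (act (refl x hx t₀) η) =
        lieFun α β x (fun η => h (act (refl x hx t₀) η)) η := by
      intro η
      refine (lieFun_eq (f' := fun η => lieFun α β x h (act (refl x hx t₀) η))
        (comp_act_mem _ hh) hx ?_).symm
      have h4 := hasDerivAt_act hh hx η (t₀ + 0)
      have h5 := h4.comp_const_add t₀ 0
      simpa only [refl_add, refl_zero, mul_one, act_mul, add_zero] using h5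
    simp only [h3] at h2
    rwa [integral_lieFun hα hβ (comp_act_mem _ hh) x] at h2
  have hd : Differentiable ℝ (fun t : ℝ => ∫ k, h (act (refl x hx t) (orbX k)) ∂haarK p q) :=
    fun t => (hder t).differentiableAt
  have := is_const_of_deriv_eq_zero hd (fun t => (hder t).deriv) t 0
  simpa only [refl_zero, act_one] using this

end Pairing

/-! ### Analyticity along reflections -/

section Analytic

lemma rz_refl_orb_pos (x : V p q) (hx : form x x ≠ 0) (t : ℝ) (k : K p q) :
    0 < rz ((refl x hx t).1 (orb k)) := rz_pos (act (refl x hx t) (orbX k))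

/-- The restriction of a rational function to the reflected base orbit. -/
def curve (x : V p q) (hx : form x x ≠ 0) (P : Rat' p q) (t : ℝ) : C(K p q, ℂ) :=
  ⟨fun k => evr ((refl x hx t).1 (orb k)) P, by
    have h1 : Continuous fun k : K p q => (refl x hx t).1 (orb k) :=
      continuous_subtype_val.comp ((continuous_refl_orbX x hx).comp
        (continuous_const.prodMk continuous_id : Continuous fun k : K p q => (t, k)))
    exact continuous_iff_continuousAt.2 fun k => ContinuousAt.comp
      (g := fun v => evr v P) (contDiffAt_evr P (rz_refl_orb_pos x hx t k)).continuousAt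
      h1.continuousAt⟩

lemma curve_apply (x : V p q) (hx : form x x ≠ 0) (P : Rat' p q) (t : ℝ) (k : K p q) :
    curve x hx P t k = evr ((refl x hx t).1 (orb k)) P := rfl

/-- As a function of t the coordinate is A + c(t) B with fixed A and B in C(K, ℂ) and an analytic
scalar c, conjugated for the conjugate coordinate. -/
lemma contDiff_curve_var (x : V p q) (hx : form x x ≠ 0) (b : Bool) (a : Idx p q) :
    ContDiff ℝ ω (curve x hx (var b a)) := by
  have hc : ContDiff ℝ ω fun t : ℝ =>
      (Complex.exp (Complex.I * t * form x x) - 1) / form x x := by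
    refine ContDiff.div_const (ContDiff.sub ?_ contDiff_const) _
    exact ((contDiff_const.mul Complex.ofRealCLM.contDiff).mul contDiff_const).cexp
  have hc' : ContDiff ℝ ω fun t : ℝ =>
      conj ((Complex.exp (Complex.I * t * form x x) - 1) / form x x) :=
    Complex.conjCLE.contDiff.comp hc
  have hv : Continuous fun k : K p q => vval b a (orb k) :=
    (contDiff_vval b a).continuous.comp continuous_orb
  have hf : Continuous fun k : K p q => form (orb k) x :=
    (((formL x).toContinuousLinearMap).continuous).comp continuous_orb
  let A : C(K p q, ℂ) := ⟨_, hv⟩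
  cases b
  · let B : C(K p q, ℂ) := ⟨fun k => form (orb k) x * crd a x, hf.mul continuous_const⟩
    have h : curve x hx (var false a) = fun t : ℝ => A +
        ((Complex.exp (Complex.I * t * form x x) - 1) / form x x) • B := by
      funext t
      refine ContinuousMap.ext fun k => ?_
      rw [curve_apply, evr_var, refl_apply]
      change crdL a _ = crdL a (orb k) + _ * (_ * crd a x)
      rw [map_add, crdL_apply a (_ • x), crd_smul]
      ring
    rw [h]
    exact contDiff_const.add (hc.smul contDiff_const)
  · let B : C(K p q, ℂ) := ⟨fun k => conj (form (orb k) x * crd a x),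
      Complex.continuous_conj.comp (hf.mul continuous_const)⟩
    have h : curve x hx (var true a) = fun t : ℝ => A +
        (conj ((Complex.exp (Complex.I * t * form x x) - 1) / form x x)) • B := by
      funext t
      refine ContinuousMap.ext fun k => ?_
      rw [curve_apply, evr_var, refl_apply]
      change conj (crdL a _) = conj (crdL a (orb k)) + _ * (conj (_ * crd a x))
      rw [map_add, map_add, crdL_apply a (_ • x), crd_smul, ← map_mul, mul_assoc]
    rw [h]
    exact contDiff_const.add (hc'.smul contDiff_const)

lemma curve_mul (x : V p q) (hx : form x x ≠ 0) (P Q : Rat' p q) :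
    curve x hx (P * Q) = fun t => curve x hx P t * curve x hx Q t := by
  funext t
  exact ContinuousMap.ext fun k => map_mul (evr _) P Q

lemma curve_add (x : V p q) (hx : form x x ≠ 0) (P Q : Rat' p q) :
    curve x hx (P + Q) = fun t => curve x hx P t + curve x hx Q t := by
  funext t
  exact ContinuousMap.ext fun k => map_add (evr _) P Q

/-- The reflected |z|² is a unit of the Banach algebra C(K, ℂ), and inversion is analytic on the
units. -/
lemma contDiff_curve_invN (x : V p q) (hx : form x x ≠ 0) :
    ContDiff ℝ ω (curve x hx invN) := by
  let R : Rat' p q := ∑ i : Fin p, var false (Sum.inl i) * var true (Sum.inl i)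
  have hR : ContDiff ℝ ω (curve x hx R) := by
    have h : curve x hx R = fun t => ∑ i : Fin p,
        curve x hx (var false (Sum.inl i)) t * curve x hx (var true (Sum.inl i)) t := by
      funext t
      refine ContinuousMap.ext fun k => ?_
      simp [R, curve_apply]
    rw [h]
    exact ContDiff.sum fun i _ => (contDiff_curve_var x hx _ _).mul (contDiff_curve_var x hx _ _)
  have hmul : ∀ t, curve x hx R t * curve x hx invN t = 1 := by
    intro t
    refine ContinuousMap.ext fun k => ?_
    change evr _ R * evr _ invN = 1
    rw [← ofReal_rz, evr_invN]
    exact mul_inv_cancel₀ (by exact_mod_cast (rz_refl_orb_pos x hx t k).ne')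
  let u : ℝ → (C(K p q, ℂ))ˣ := fun t =>
    ⟨curve x hx R t, curve x hx invN t, hmul t, by rw [mul_comm]; exact hmul t⟩
  have h : curve x hx invN = fun t => Ring.inverse (curve x hx R t) := by
    funext t
    exact (Ring.inverse_unit (u t)).symm
  rw [h]
  refine contDiff_iff_contDiffAt.2 fun t => ?_
  exact ContDiffAt.comp t (contDiffAt_ringInverse ℝ (u t)) hR.contDiffAt

lemma contDiff_curve (x : V p q) (hx : form x x ≠ 0) (P : Rat' p q) :
    ContDiff ℝ ω (curve x hx P) := by
  induction P using MvPolynomial.induction_on with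
  | C c =>
    have h : curve x hx (MvPolynomial.C c) = fun _ => algebraMap ℂ _ c := by
      funext t
      refine ContinuousMap.ext fun k => ?_
      simp [curve_apply, evr]
    rw [h]
    exact contDiff_const
  | add P Q hP hQ => rw [curve_add]; exact hP.add hQ
  | mul_X P y hP =>
    rw [curve_mul]
    refine hP.mul ?_
    rcases y with _ | ⟨b, a⟩
    · exact contDiff_curve_invN x hx
    · exact contDiff_curve_var x hx b a

/-- The infinitesimal reflection on rational functions. -/
def rX (x : V p q) (P : Rat' p q) : Rat' p q :=
  ∑ a, ∑ b, (Complex.I * (crd a x * conj (crd b x))) • rE a b P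

lemma fderiv_evr_vf (x : V p q) (P : Rat' p q) {v : V p q} (hv : 0 < rz v) :
    fderiv ℝ (fun v => evr v P) v (vf x v) = evr v (rX x P) := by
  rw [fderiv_vf, rX, map_sum]
  refine Finset.sum_congr rfl fun a _ => ?_
  rw [map_sum]
  exact Finset.sum_congr rfl fun b _ => by rw [lieE_evr a b P hv, map_smul, smul_eq_mul]

lemma hasDerivAt_curve (x : V p q) (hx : form x x ≠ 0) (P : Rat' p q) (t : ℝ) :
    HasDerivAt (curve x hx P) (curve x hx (rX x P) t) t := by
  have h1 : HasDerivAt (curve x hx P) (deriv (curve x hx P) t) t :=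
    ((contDiff_curve x hx P).differentiable (by simp) t).hasDerivAt
  convert h1 using 1
  refine ContinuousMap.ext fun k => ?_
  have h2 : HasDerivAt (fun t => curve x hx P t k) (deriv (curve x hx P) t k) t := by
    let E : C(K p q, ℂ) →L[ℝ] ℂ := ContinuousMap.evalCLM ℝ k
    exact E.hasFDerivAt.comp_hasDerivAt t h1
  have h3 : HasDerivAt (fun t => curve x hx P t k)
      (fderiv ℝ (fun v => evr v P) _ (vf x ((refl x hx t).1 (orb k)))) t :=
    hasDerivAt_refl_comp (F := fun v => evr v P) hx
      (differentiableAt_evr P (rz_refl_orb_pos x hx t k))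
  rw [fderiv_evr_vf x P (rz_refl_orb_pos x hx t k)] at h3
  exact h3.unique h2

/-- Integration against a continuous function on the base orbit. -/
def pairL {f : K p q → ℂ} (hf : Continuous f) : C(K p q, ℂ) →L[ℝ] ℂ :=
  LinearMap.mkContinuous
    { toFun := fun u => ∫ k, f k * u k ∂haarK p q
      map_add' := fun u w => by
        have h : ∀ u : C(K p q, ℂ), Integrable (fun k => f k * u k) (haarK p q) :=
          fun u => integrable_K (hf.mul u.continuous)
        simp only [ContinuousMap.add_apply, mul_add]
        exact integral_add (h u) (h w)
      map_smul' := fun c u => by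
        simp only [ContinuousMap.smul_apply, mul_smul_comm, RingHom.id_apply]
        exact integral_smul _ _ } (∫ k, ‖f k‖ ∂haarK p q) fun u => by
    refine (norm_integral_le_integral_norm _).trans ?_
    rw [← integral_mul_const]
    refine integral_mono (integrable_K (hf.mul u.continuous)).norm
      ((integrable_K hf).norm.mul_const _) fun k => ?_
    rw [norm_mul]
    exact mul_le_mul_of_nonneg_left (u.norm_coe_le_norm k) (norm_nonneg _)

lemma pairL_apply {f : K p q → ℂ} (hf : Continuous f) (u : C(K p q, ℂ)) :
    pairL hf u = ∫ k, f k * u k ∂haarK p q := rfl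

/-- A function orthogonal to all iterated derivatives along a reflection is orthogonal to all
reflected functions. -/
lemma integral_refl_eq_zero {f : K p q → ℂ} (hf : Continuous f) (x : V p q) (hx : form x x ≠ 0)
    (P : Rat' p q) (h : ∀ n, ∫ k, f k * evr (orb k) ((rX x)^[n] P) ∂haarK p q = 0) (t : ℝ) :
    ∫ k, f k * evr ((refl x hx t).1 (orb k)) P ∂haarK p q = 0 := by
  let Ψ : Rat' p q → ℝ → ℂ := fun P t => pairL hf (curve x hx P t)
  have hd : ∀ P t, HasDerivAt (Ψ P) (Ψ (rX x P) t) t := fun P t =>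
    (pairL hf).hasFDerivAt.comp_hasDerivAt t (hasDerivAt_curve x hx P t)
  have han : AnalyticOnNhd ℝ (Ψ P) Set.univ :=
    contDiff_omega_iff_analyticOnNhd.1 ((pairL hf).contDiff.comp (contDiff_curve x hx P))
  have hit : ∀ n P, iteratedDeriv n (Ψ P) = Ψ ((rX x)^[n] P) := by
    intro n
    induction n with
    | zero => intro P; rw [iteratedDeriv_zero]; rfl
    | succ n ih =>
      intro P
      rw [iteratedDeriv_succ', Function.iterate_succ_apply, ← ih]
      congr 1
      funext t
      exact (hd P t).deriv
  -- All derivatives at 0 vanish by hypothesis, so the analytic function has infinite order there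
  -- and is zero on the whole line.
  have h0 : analyticOrderAt (Ψ P) 0 = ⊤ := by
    refine ENat.eq_top_iff_forall_ge.2 fun n => ?_
    rw [natCast_le_analyticOrderAt_iff_iteratedDeriv_eq_zero (han 0 trivial)]
    intro i _
    rw [hit]
    simp only [Ψ, pairL_apply, curve_apply, refl_zero]
    exact h i
  exact han.eqOn_zero_of_preconnected_of_eventuallyEq_zero isPreconnected_univ trivial
    (analyticOrderAt_eq_top.1 h0) (Set.mem_univ t)

end Analytic

end LightCone

end

open scoped Topology ContDiff UniformConvergence ComplexConjugate

noncomputable section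

namespace LightCone

set_option linter.unusedSectionVars false

open MeasureTheory Filter

variable {p q : ℕ} {α β : ℂ} [NeZero p] [NeZero q]

/-! ### Reducibility for integral parameters -/

section Reducible

lemma rX_iterate_mem_test {j₁ : Fin q} {d : Bool → ℤ} (x : V p q) {P : Rat' p q}
    (hP : P ∈ test j₁ d) (n : ℕ) : (rX x)^[n] P ∈ test j₁ d := by
  induction n with
  | zero => exact hP
  | succ n ih =>
    rw [Function.iterate_succ_apply']
    exact Submodule.sum_mem _ fun a _ => Submodule.sum_mem _ fun b _ =>
      Submodule.smul_mem _ _ (rE_mem_test a b ih)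

/-- The restrictions of the test functions to the base orbit. -/
def testOrb (p : ℕ) {q : ℕ} [NeZero p] [NeZero q] (j₁ : Fin q) (d : Bool → ℤ) :
    Set (K p q → ℂ) :=
  {u | ∃ P ∈ test j₁ d, u = fun k => evr (orb k) P}

lemma continuous_testOrb (j₁ : Fin q) (d : Bool → ℤ) : ∀ u ∈ testOrb p j₁ d, Continuous u := by
  rintro _ ⟨P, _, rfl⟩
  exact (smoothOnOrb_evr P).continuous

/-- For a reflection g, invariance of the pairing moves g onto the test function, and the result is
zero by analyticity because all iterated Lie derivatives of a test function are test functions.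
Reflections generate the group. -/
lemma rho_mem_orthK_testOrb {j₁ : Fin q} {d : Bool → ℤ} (hα : α + d false = -(p + q - 1))
    (hβ : β + d true = -(p + q - 1)) (g : U p q) {f : S p q α β}
    (hf : f ∈ orthK α β (testOrb p j₁ d) (continuous_testOrb j₁ d)) :
    rho p q α β g f ∈ orthK α β (testOrb p j₁ d) (continuous_testOrb j₁ d) := by
  set W := orthK α β (testOrb p j₁ d) (continuous_testOrb j₁ d) with hW
  have hmul : ∀ g h : U p q, ∀ f, rho p q α β (g * h) f = rho p q α β g (rho p q α β h f) :=
    fun g h f => by rw [map_mul]; rfl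
  have hinv : ∀ (g : U p q) f, rho p q α β g (rho p q α β g⁻¹ f) = f := fun g f => by
    rw [← hmul, mul_inv_cancel, map_one]; rfl
  have hinv' : ∀ (g : U p q) f, rho p q α β g⁻¹ (rho p q α β g f) = f := fun g f => by
    rw [← hmul, inv_mul_cancel, map_one]; rfl
  -- The stabilizer is defined by an equivalence so that it is closed under inverses.
  let H : Subgroup (U p q) :=
    { carrier := {g | ∀ f, f ∈ W ↔ rho p q α β g f ∈ W}
      one_mem' := fun f => by rw [map_one]; rfl
      mul_mem' := fun {g h} hg hh f => by rw [hmul, hh f, hg]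
      inv_mem' := fun {g} hg f => by rw [hg (rho p q α β g⁻¹ f), hinv] }
  have key : ∀ (x : V p q) (hx : form x x ≠ 0) (t : ℝ) (f : S p q α β), f ∈ W →
      rho p q α β (refl x hx t) f ∈ W := by
    rintro x hx t f hf _ ⟨P, hP, rfl⟩
    have h0 := integral_refl_eq_zero (continuous_orbX_comp f.2.1) x hx P
      (fun n => hf _ ⟨_, rX_iterate_mem_test x hP n, rfl⟩) t
    have hh := mul_mem_S (comp_act_mem (refl x hx t)⁻¹ f.2) (isHom_of_mem_test hP).mem_S
    have h1 := integral_refl hα hβ hh x hx t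
    rw [← h0]
    refine h1.symm.trans (integral_congr_ae (Eventually.of_forall fun k => ?_))
    change f.1 (act _ (act _ (orbX k))) * _ = _
    rw [← act_mul, inv_mul_cancel, act_one]
    rfl
  refine (mem_of_refl_mem H (fun x hx t f => ⟨key x hx t f, fun h => ?_⟩) g f).1 hf
  have := key x hx (-t) _ h
  rwa [refl_neg, hinv'] at this

lemma pow_mul_pow_mem_Bi (a b : Idx p q) (m n : ℕ) : cX a ^ m * cY b ^ n ∈ Bi p q m n := by
  induction m with
  | zero =>
    rw [pow_zero, one_mul]
    induction n with
    | zero => simpa [mo, degX, degY] using mo_mem_Bi (p := p) (q := q) 0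
    | succ n ih => rw [pow_succ']; exact cY_mul_mem b ih
  | succ m ih => rw [pow_succ', mul_assoc]; exact cX_mul_mem a ih

/-- The annihilator of the test space of dual bidegree d is the required subspace; integrality is
what makes d an integer bidegree. The hypothesis on q provides two coordinates of w, that on p a
nonzero test function. -/
lemma isReducible_of_int (hp : 2 ≤ p) (hq : 2 ≤ q) {a b : ℤ} (hα : α = a) (hβ : β = b) :
    IsReducible p q α β := by
  let j₀ : Fin q := ⟨0, by omega⟩
  let j₁ : Fin q := ⟨1, by omega⟩
  have hj : j₀ ≠ j₁ := by simp [j₀, j₁]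
  obtain ⟨d, hd, hd'⟩ : ∃ d : Bool → ℤ, d false = -(p + q - 1) - a ∧ d true = -(p + q - 1) - b :=
    ⟨fun c => if c then -(p + q - 1) - b else -(p + q - 1) - a, by simp, by simp⟩
  have hdα : α + d false = -(p + q - 1) := by rw [hd, hα]; push_cast; ring
  have hdβ : β + d true = -(p + q - 1) := by rw [hd', hβ]; push_cast; ring
  refine ⟨orthK α β (testOrb p j₁ d) (continuous_testOrb j₁ d), isClosed_orthK _ _,
    fun g f hf => rho_mem_orthK_testOrb hdα hdβ g hf, fun h => ?_, fun h => ?_⟩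
  -- The exponent n is large enough for the weight argument and for m = n + a - b to be a natural
  -- number.
  · obtain ⟨m, n, hmn, hn⟩ : ∃ m n : ℕ, (m : ℤ) - n = a - b ∧ d false + p - 1 < n :=
      ⟨((d false).natAbs + p + a.natAbs + b.natAbs + (a - b)).toNat,
        (d false).natAbs + p + a.natAbs + b.natAbs, by omega, by omega⟩
    have hmn' : (m : ℂ) - n = a - b := by exact_mod_cast hmn
    have hP : cX (Sum.inr j₀) ^ m * cY (Sum.inr j₁) ^ n ∈ Bi p q m n :=
      pow_mul_pow_mem_Bi _ _ m n
    have hS := ev_mul_pw_mem_S hP (α := α) (β := β) (s := α - m) (by ring)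
      (by rw [hα, hβ]; linear_combination hmn')
    have hval : ∀ k : K p q, ev (orb k) (cX (Sum.inr j₀) ^ m * cY (Sum.inr j₁) ^ n) *
        pw (α - m) (orb k) = evr (orb k) (var false (Sum.inr j₀) ^ m * var true (Sum.inr j₁) ^ n) := by
      intro k
      rw [pw_of_rz_eq_one _ (rz_orb k)]
      simp [ev_cX, ev_cY, evr_var, vval]
    have hmem : (⟨_, hS⟩ : S p q α β) ∈ orthK α β (testOrb p j₁ d) (continuous_testOrb j₁ d) := by
      rintro _ ⟨P, hP, rfl⟩
      rw [← intK_test_eq_zero hj hn hP (a := m)]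
      refine integral_congr_ae (Eventually.of_forall fun k => ?_)
      change ev (orb k) _ * pw _ (orb k) * _ = evr (orb k) (P * _)
      rw [hval, mul_comm]
      exact (map_mul (evr (orb k)) P _).symm
    rw [h, Submodule.mem_bot] at hmem
    -- A point of the orbit where both w_{j₀} and w_{j₁} are nonzero, so that the monomial does not
    -- vanish there.
    let v : V p q := (Pi.single 0 1, Pi.single j₀ (3 / 5) + Pi.single j₁ (4 / 5))
    have hv0 : v.2 j₀ = 3 / 5 := by simp [v, hj]
    have hv1 : v.2 j₁ = 4 / 5 := by simp [v, hj.symm]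
    have hrz : rz v = 1 := by
      rw [rz, Finset.sum_eq_single 0]
      · simp [v]
      · intro i _ hi
        simp [v, hi]
      · simp
    have hrw : rw' v = 1 := by
      rw [rw', ← Finset.sum_subset (Finset.subset_univ {j₀, j₁}), Finset.sum_pair hj, hv0, hv1]
      · norm_num [Complex.normSq_div]
      · intro i _ hi'
        simp only [Finset.mem_insert, Finset.mem_singleton, not_or] at hi'
        simp [v, hi'.1, hi'.2]
    obtain ⟨k, hk⟩ := exists_orb_eq hrz hrw
    have h1 := congrFun (congrArg Subtype.val hmem) (orbX k)
    change ev (orb k) _ * pw _ (orb k) = 0 at h1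
    rw [hval, hk] at h1
    simp [evr_var, vval, crd, hv0, hv1] at h1
  · obtain ⟨P, hP, k, hk⟩ := exists_test_ne_zero hp j₁ d
    have hu := (isHom_of_mem_test hP).mem_S
    have hn : ((d false : ℤ) : ℂ) - (d true : ℤ) = ((d false - d true : ℤ) : ℂ) := by
      push_cast; ring
    -- The conjugate of a nonzero test function, with its exponents corrected by a power of |z|²
    -- that is 1 on the orbit, pairs with that test function to its squared norm and so is not
    -- annihilated.
    have hs := mul_mem_S (conj_mem_S hn hu) (pw_mem_S (α - d true))
    rw [map_intCast, map_intCast, add_sub_cancel, show (d false : ℂ) + (α - d true) = β by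
      linear_combination hdα - hdβ] at hs
    have hmem : (⟨_, hs⟩ : S p q α β) ∈ orthK α β (testOrb p j₁ d) (continuous_testOrb j₁ d) :=
      h ▸ Submodule.mem_top
    have h1 := hmem _ ⟨P, hP, rfl⟩
    have h2 : (⟨_, hu⟩ : S p q (d false) (d true)) = 0 := by
      refine eq_zero_of_integral_conj ?_
      rw [← h1]
      refine integral_congr_ae (Eventually.of_forall fun k => ?_)
      change evr (orb k) P * conj (evr (orb k) P) = conj (evr (orb k) P) * pw _ (orb k) * evr (orb k) P
      rw [pw_of_rz_eq_one _ (rz_orb k)]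
      ring
    exact hk (congrFun (congrArg Subtype.val h2) (orbX k))

end Reducible

end LightCone

end

theorem corollary4p3 (p q : ℕ) (hp : 2 ≤ p) (hq : 2 ≤ q) (α β : ℂ)
    (hαβ : ∃ n : ℤ, α - β = (n : ℂ)) :
    (LightCone.IsReducible p q α β ↔ (∃ a : ℤ, α = (a : ℂ)) ∧ (∃ b : ℤ, β = (b : ℂ))) ∧
    (LightCone.IsReducible p q α β ↔
      ∃ m n : ℤ, α + β = (m : ℂ) ∧ α - β = (n : ℂ) ∧ m ≡ n [ZMOD 2]) := by
  have : NeZero p := ⟨by omega⟩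
  have : NeZero q := ⟨by omega⟩
  have h1 : LightCone.IsReducible p q α β ↔
      (∃ a : ℤ, α = (a : ℂ)) ∧ (∃ b : ℤ, β = (b : ℂ)) :=
    ⟨fun h => h.exists_int hαβ, fun ⟨⟨_, ha⟩, _, hb⟩ => LightCone.isReducible_of_int hp hq ha hb⟩
  refine ⟨h1, h1.trans ⟨?_, ?_⟩⟩
  · rintro ⟨⟨a, rfl⟩, b, rfl⟩
    refine ⟨a + b, a - b, by push_cast; rfl, by push_cast; rfl, ?_⟩
    exact Int.emod_emod_of_dvd _ dvd_rfl |>.symm.trans (by omega)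
  · rintro ⟨m, n, hm, hn, hmn⟩
    -- With m - n = 2c one gets β = c and α = n + c.
    obtain ⟨c, hc⟩ := hmn.symm.dvd
    have hc' : (m : ℂ) - n = 2 * c := by exact_mod_cast hc
    refine ⟨⟨n + c, ?_⟩, c, ?_⟩
    · push_cast
      linear_combination (hm + hn + hc') / 2
    · linear_combination (hm - hn + hc') / 2
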